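/- \textbf{Theorem (law of large numbers for discovered sites).} For $N\ge 1$ let $V_N=\{0,1\}^N$ be the hypercube with the Hamming distance $|x-y|$, and write $x\sim y$ if $|x-y|=1$. Let $(E_x)_{x\in V_N}$ be i.i.d.\ random variables distributed as the positive part of a standard Gaussian, with joint law $\mathbb P$. Let $(a_N)$ be real numbers such that, for some $\overline a<1/20$ and all $N$ large enough, $1\le a_N\le \overline a\sqrt{2\log N}$. Given $(E_x)$, let $X=(X_s)_{s\ge0}$ be the continuous-time Markov chain on $V_N$ (with c\`adl\`ag paths) whose jump rate from $x$ to $y$ is $e^{a_N(E_x+E_y)}$ if $x\sim y$ and $0$ for every other $y\neq x$, started from the uniform distribution on $V_N$. Let $\overline{\mathbb P}_N$ be the resulting joint law of $(E_x)$ and $X$ (averaged over the $E_x$'s), and $\overline{\mathbb E}_N$ its expectation. For $t\ge0$ let $$D_N(t)=\bigl|\{x\in V_N:\ \exists\, s\le t \text{ such that } |X_s-x|\le 1\}\bigr|$$ be the number of sites discovered before time $t$. Let $\overline c\in(0,\log 2)$, let $(\mathsf t_N)$ be positive real numbers such that $\log \mathsf t_N\sim\overline c N$ as $N\to\infty$,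 and let $\mathsf d_N=\overline{\mathbb E}_N[D_N(\mathsf t_N)]$. Then for every $t>0$ and every $\varepsilon>0$, $$\overline{\mathbb P}_N\left[\,\left|\frac{D_N(t\,\mathsf t_N)}{t\,\mathsf d_N}-1\right|\ge\varepsilon\right]\xrightarrow[N\to\infty]{}0 .$$ Moreover, $\log \mathsf d_N\sim\overline c N$ as $N\to\infty$. -/

import Mathlib

open MeasureTheory ProbabilityTheory Filter Topology Asymptotics
open scoped NNReal ENNReal

namespace REM

noncomputable section

/-- The hypercube `{0,1}^N`; its graph distance is Mathlib's `hammingDist`. -/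
abbrev V (N : ℕ) : Type := Fin N → Bool

/-- The law of the positive part of a standard Gaussian random variable. -/
def posGaussian : Measure ℝ := (gaussianReal 0 1).map (fun u => max u 0)

/-- The joint law of the energies `(E_x)`, i.i.d. with marginal `posGaussian`. -/
def envLaw (N : ℕ) : Measure (V N → ℝ) := Measure.pi (fun _ => posGaussian)

/-- Jump rate of the accelerated walk from `x` to `y` in the environment `e`:
`exp (a (e x + e y))` if `x` and `y` are neighbours, and `0` otherwise. -/
def rate {N : ℕ} (a : ℝ) (e : V N → ℝ) (x y : V N) : ℝ :=
  if hammingDist x y = 1 then Real.exp (a * (e x + e y)) else 0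

/-- Generator (`Q`-matrix) of the continuous-time Markov chain with jump rates `rate a e`. -/
def generator {N : ℕ} (a : ℝ) (e : V N → ℝ) : Matrix (V N) (V N) ℝ :=
  Matrix.of fun x y => if x = y then -∑ z, rate a e x z else rate a e x y

/-- Transition matrix at time `t` of the chain in the environment `e`: `exp (t Q)`. -/
def transition {N : ℕ} (a : ℝ) (e : V N → ℝ) (t : ℝ) : Matrix (V N) (V N) ℝ :=
  NormedSpace.exp (t • generator a e)

/-- Quenched finite-dimensional distributions of the chain started from the uniform
distribution: for `0 = s 0 ≤ s 1 ≤ ... ≤ s n`, the probability in the environment `e` of being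
at `x i` at time `s i` for every `i`. -/
def quenchedProb {N : ℕ} (a : ℝ) (e : V N → ℝ) (n : ℕ) (s : Fin (n + 1) → ℝ≥0)
    (x : Fin (n + 1) → V N) : ℝ :=
  ((2 : ℝ) ^ N)⁻¹ * ∏ i : Fin n,
    transition a e ((s i.succ : ℝ) - (s i.castSucc : ℝ)) (x i.castSucc) (x i.succ)

/-- On the probability space `(Ω, P)`, the pair `(E, X)` has the annealed law: the energies
`E` have law `envLaw N` and, given `E = e`, the process `X` is the continuous-time Markov chain
with jump rates `rate a e`, started from the uniform distribution, with càdlàg paths (that is,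
piecewise constant and right-continuous ones, as the state space is finite). -/
structure IsAnnealedWalk {N : ℕ} (a : ℝ) {Ω : Type*} [MeasurableSpace Ω] (P : Measure Ω)
    (E : Ω → V N → ℝ) (X : ℝ≥0 → Ω → V N) : Prop where
  measurable_env : Measurable E
  measurable_walk : ∀ s, Measurable (X s)
  map_env : P.map E = envLaw N
  /-- The joint law of `E` and of finitely many positions of `X`. -/
  finite_dim : ∀ (A : Set (V N → ℝ)), MeasurableSet A →
    ∀ (n : ℕ) (s : Fin (n + 1) → ℝ≥0), s 0 = 0 → Monotone s → ∀ x : Fin (n + 1) → V N,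
      P {ω | E ω ∈ A ∧ ∀ i, X (s i) ω = x i}
        = ∫⁻ e in A, ENNReal.ofReal (quenchedProb a e n s x) ∂(envLaw N)
  right_continuous : ∀ᵐ ω ∂P, ∀ s, ∀ᶠ r in 𝓝[≥] s, X r ω = X s ω
  left_limits : ∀ᵐ ω ∂P, ∀ s, ∃ x, ∀ᶠ r in 𝓝[<] s, X r ω = x

/-- The set of sites discovered before time `t` along the path `p`: those within distance `1` of
a position of the path at some time `s ≤ t`. -/
def discovered {N : ℕ} (p : ℝ≥0 → V N) (t : ℝ) : Set (V N) :=
  {x | ∃ s : ℝ≥0, (s : ℝ) ≤ t ∧ hammingDist (p s) x ≤ 1}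

/-- The number `D_N(t)` of sites discovered before time `t` by the walk `X`. -/
def numDiscovered {N : ℕ} {Ω : Type*} (X : ℝ≥0 → Ω → V N) (t : ℝ) (ω : Ω) : ℕ :=
  (discovered (fun s => X s ω) t).ncard

/-- The annealed mean of the number of sites discovered before time `t`. -/
def meanDiscovered {N : ℕ} {Ω : Type*} [MeasurableSpace Ω] (P : Measure Ω)
    (X : ℝ≥0 → Ω → V N) (t : ℝ) : ℝ :=
  ∫ ω, (numDiscovered X t ω : ℝ) ∂P

end

end REM

/-! Energies are nonnegative, so every rate is at least 1, and the walk is reversible with respect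
to the uniform law. The Poincaré inequality of the cube then gives a spectral gap in almost every
environment: after a time 2N the walk is uniform up to a factor 1 + 2^(-N), wherever it started
(`stepKernel_pow_le`).

Cut time into blocks made of an active window of length 2N^13 and a gap of length 2N. Distinct
windows are almost independent. The mean overlap of the sites found in two windows is a polynomial
in N times 2^(-N), and a gap brings few discoveries compared with a window. The number of blocks is
about e^(cN) with 0 < c < log 2, so there are many blocks but few overlaps: the number of discovered
sites is close to a sum of nearly independent terms, and a second moment computation gives a
quenched law of large numbers around K times the quenched mean of one window
(`statExp_abs_discCount_sub_le`).

That quenched mean concentrates by the Efron–Stein inequality (`efronStein`). The mean of the count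
restricted to paths that do not discover y does not depend on the energy at y, and it differs from
the full mean only through paths that discover y (`integral_sq_statExp_sub_annealedExp_le`).

All moments rest on one estimate, `sum_statExp_mul_hits_pow_le`, for the mean of (1 + number of
jumps) on the event that z is visited. Reversibility decouples a visit to z from a jump at a given
step, and Jensen's inequality reduces the result to moments of the escape probability. The fourth
moment suffices; its average over the environment is controlled by exp(32 a²), which is at most N
under the bound on a. Hence all these quantities are polynomial in N, apart from explicit factors
2^(-N).

The estimates are proved for a chain with time step 1/q, uniformly in q ≥ 2N. For fixed N, letting q
tend to infinity transfers them to the continuous-time walk (`tendsto_annealedExp_discCount`).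
Finally `integral_abs_numDiscovered_sub_le_relError` compares the number of sites discovered before
any time with a quantity linear in that time; taking times t·t_N and t_N gives the limit law, and
polynomial bounds on the window mean give log d_N. -/

namespace REM

noncomputable section

/-! ### Path functionals of a finite Markov chain -/

section Chain

variable {S : Type*}

/-- The path `ω` preceded by the state `y`. -/
def consPath (y : S) (ω : ℕ → S) : ℕ → S
  | 0 => y
  | n + 1 => ω n

/-- The path `ω` seen from time `i` on. -/
def shiftPath (i : ℕ) (ω : ℕ → S) : ℕ → S := fun l => ω (i + l)

@[simp] lemma consPath_zero (y : S) (ω : ℕ → S) : consPath y ω 0 = y := rfl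

@[simp] lemma consPath_succ (y : S) (ω : ℕ → S) (n : ℕ) : consPath y ω (n + 1) = ω n := rfl

lemma shiftPath_apply (i : ℕ) (ω : ℕ → S) (l : ℕ) : shiftPath i ω l = ω (i + l) := rfl

lemma shiftPath_shiftPath (i j : ℕ) (ω : ℕ → S) :
    shiftPath i (shiftPath j ω) = shiftPath (j + i) ω := by
  funext l; simp [shiftPath, add_assoc]

lemma shiftPath_zero (ω : ℕ → S) : shiftPath 0 ω = ω := by
  funext l; simp [shiftPath]

lemma shiftPath_succ_consPath (i : ℕ) (y : S) (ω : ℕ → S) :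
    shiftPath (i + 1) (consPath y ω) = shiftPath i ω := by
  funext l
  simp only [shiftPath]
  rw [show i + 1 + l = (i + l) + 1 by ring, consPath_succ]

lemma dependsOn_consPath {β : Type*} {G : (ℕ → S) → β} {k : ℕ}
    (hG : DependsOn G (Set.Iic (k + 1))) (y : S) :
    DependsOn (fun ω => G (consPath y ω)) (Set.Iic k) := by
  intro ω ω' h
  refine hG fun i hi => ?_
  cases i with
  | zero => rfl
  | succ i => exact h i (by simpa using hi)

lemma dependsOn_shiftPath {β : Type*} {G : (ℕ → S) → β} {k : ℕ}
    (hG : DependsOn G (Set.Iic k)) (i : ℕ) :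
    DependsOn (fun ω => G (shiftPath i ω)) (Set.Iic (i + k)) := by
  intro ω ω' h
  refine hG fun l hl => h (i + l) ?_
  simp only [Set.mem_Iic] at hl ⊢
  omega

lemma dependsOn_mul {F G : (ℕ → S) → ℝ} {s : Set ℕ}
    (hF : DependsOn F s) (hG : DependsOn G s) : DependsOn (fun ω => F ω * G ω) s :=
  fun _ _ h => by simp only [hF h, hG h]

variable [Fintype S]

/-- The mean, for the chain with transition matrix `A` started from `y`, of the functional `G`
of the path stopped after `n` steps. -/
def pathExp (A : Matrix S S ℝ) : ℕ → ((ℕ → S) → ℝ) → S → ℝ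
  | 0, G, y => G (fun _ => y)
  | n + 1, G, y => ∑ z, A y z * pathExp A n (fun ω => G (consPath y ω)) z

/-- The mean of `G` for the chain started from the uniform distribution. -/
def statExp (A : Matrix S S ℝ) (n : ℕ) (G : (ℕ → S) → ℝ) : ℝ :=
  (Fintype.card S : ℝ)⁻¹ * ∑ y, pathExp A n G y

/-- Symmetric stochastic matrices. -/
structure IsSymmStochastic (A : Matrix S S ℝ) : Prop where
  nonneg : ∀ x y, 0 ≤ A x y
  row_sum : ∀ x, ∑ y, A x y = 1
  symm : ∀ x y, A x y = A y x

lemma pathExp_mono {A : Matrix S S ℝ} (hA : ∀ x y, 0 ≤ A x y) :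
    ∀ (n : ℕ) {G G' : (ℕ → S) → ℝ}, (∀ ω, G ω ≤ G' ω) → ∀ y, pathExp A n G y ≤ pathExp A n G' y
  | 0, _, _, h, _ => h _
  | n + 1, _, _, h, y => Finset.sum_le_sum fun z _ =>
      mul_le_mul_of_nonneg_left (pathExp_mono hA n (fun _ => h _) z) (hA y z)

lemma pathExp_add (A : Matrix S S ℝ) : ∀ (n : ℕ) (G G' : (ℕ → S) → ℝ) (y : S),
    pathExp A n (fun ω => G ω + G' ω) y = pathExp A n G y + pathExp A n G' y
  | 0, _, _, _ => rfl
  | n + 1, G, G', y => by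
      simp only [pathExp, pathExp_add A n, mul_add, Finset.sum_add_distrib]

lemma pathExp_const_mul (A : Matrix S S ℝ) (c : ℝ) : ∀ (n : ℕ) (G : (ℕ → S) → ℝ) (y : S),
    pathExp A n (fun ω => c * G ω) y = c * pathExp A n G y
  | 0, _, _ => rfl
  | n + 1, G, y => by
      simp only [pathExp, pathExp_const_mul A c n, Finset.mul_sum]
      exact Finset.sum_congr rfl fun z _ => by ring

lemma pathExp_const {A : Matrix S S ℝ} (hA : ∀ x, ∑ y, A x y = 1) (c : ℝ) :
    ∀ (n : ℕ) (y : S), pathExp A n (fun _ => c) y = c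
  | 0, _ => rfl
  | n + 1, y => by
      simp only [pathExp, pathExp_const hA c n, ← Finset.sum_mul, hA y, one_mul]

lemma pathExp_nonneg {A : Matrix S S ℝ} (hA : ∀ x y, 0 ≤ A x y) :
    ∀ (n : ℕ) {G : (ℕ → S) → ℝ}, (∀ ω, 0 ≤ G ω) → ∀ y, 0 ≤ pathExp A n G y
  | 0, _, h, _ => h _
  | n + 1, _, h, y => Finset.sum_nonneg fun z _ =>
      mul_nonneg (hA y z) (pathExp_nonneg hA n (fun _ => h _) z)

lemma abs_pathExp_le {A : Matrix S S ℝ} (hA : ∀ x y, 0 ≤ A x y) (hA1 : ∀ x, ∑ y, A x y = 1)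
    (n : ℕ) {G : (ℕ → S) → ℝ} {c : ℝ} (hG : ∀ ω, |G ω| ≤ c) (y : S) : |pathExp A n G y| ≤ c := by
  rw [abs_le]
  constructor
  · rw [← pathExp_const hA1 (-c) n y]
    exact pathExp_mono hA n (fun ω => (abs_le.1 (hG ω)).1) y
  · rw [← pathExp_const hA1 c n y]
    exact pathExp_mono hA n (fun ω => (abs_le.1 (hG ω)).2) y

/-- Two chains whose transition matrices are `δ`-close give `n δ`-close means after `n` steps. -/
lemma abs_pathExp_sub_le {A B : Matrix S S ℝ} (hA : ∀ x y, 0 ≤ A x y)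
    (hA1 : ∀ x, ∑ y, A x y = 1) (hB : ∀ x y, 0 ≤ B x y) (hB1 : ∀ x, ∑ y, B x y = 1)
    {δ : ℝ} (hδ : ∀ x, ∑ y, |A x y - B x y| ≤ δ) {c : ℝ} (hc : 0 ≤ c) :
    ∀ (n : ℕ) {G : (ℕ → S) → ℝ}, (∀ ω, |G ω| ≤ c) → ∀ y,
      |pathExp A n G y - pathExp B n G y| ≤ n * δ * c
  | 0, _, _, y => by simp [pathExp]
  | n + 1, G, hG, y => by
      -- Replace the transition matrix one step at a time: exchanging the first step costs δ c, and
      -- the remaining n steps are the induction hypothesis.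
      have e : pathExp A (n + 1) G y - pathExp B (n + 1) G y
          = ∑ z, (A y z - B y z) * pathExp A n (fun ω => G (consPath y ω)) z
            + ∑ z, B y z * (pathExp A n (fun ω => G (consPath y ω)) z
                - pathExp B n (fun ω => G (consPath y ω)) z) := by
        simp only [pathExp]
        rw [← Finset.sum_add_distrib, ← Finset.sum_sub_distrib]
        exact Finset.sum_congr rfl fun z _ => by ring
      rw [e]
      refine (abs_add_le _ _).trans ?_
      have h1 : |∑ z, (A y z - B y z) * pathExp A n (fun ω => G (consPath y ω)) z| ≤ δ * c := by
        refine (Finset.abs_sum_le_sum_abs _ _).trans ?_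
        refine le_trans (Finset.sum_le_sum fun z _ => ?_)
          ((Finset.sum_mul (Finset.univ) (fun z => |A y z - B y z|) c).symm.le.trans
            (mul_le_mul_of_nonneg_right (hδ y) hc))
        rw [abs_mul]
        exact mul_le_mul_of_nonneg_left (abs_pathExp_le hA hA1 n (fun ω => hG _) z) (abs_nonneg _)
      have h2 : |∑ z, B y z * (pathExp A n (fun ω => G (consPath y ω)) z
                - pathExp B n (fun ω => G (consPath y ω)) z)| ≤ n * δ * c := by
        refine (Finset.abs_sum_le_sum_abs _ _).trans ?_
        calc ∑ z, |B y z * (pathExp A n (fun ω => G (consPath y ω)) z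
                - pathExp B n (fun ω => G (consPath y ω)) z)|
            ≤ ∑ z, B y z * (n * δ * c) := Finset.sum_le_sum fun z _ => by
              rw [abs_mul, abs_of_nonneg (hB y z)]
              exact mul_le_mul_of_nonneg_left
                (abs_pathExp_sub_le hA hA1 hB hB1 hδ hc n (fun ω => hG _) z) (hB y z)
          _ = n * δ * c := by rw [← Finset.sum_mul, hB1, one_mul]
      push_cast
      linarith

/-- Rows sum to one, so steps later than k can be summed out. A functional of one block can thus be
evaluated over the length of that block alone. -/
lemma pathExp_of_dependsOn {A : Matrix S S ℝ} (hA : ∀ x, ∑ y, A x y = 1) :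
    ∀ (k n : ℕ) {G : (ℕ → S) → ℝ}, DependsOn G (Set.Iic k) → k ≤ n → ∀ y,
      pathExp A n G y = pathExp A k G y
  | 0, 0, _, _, _, _ => rfl
  | 0, n + 1, G, hG, _, y => by
      have h : ∀ ω, G (consPath y ω) = G (fun _ => y) := fun ω =>
        hG fun i hi => by
          have : i = 0 := by simpa using hi
          simp [this]
      simp only [pathExp, h, pathExp_const hA, ← Finset.sum_mul, hA y, one_mul]
  | k + 1, 0, _, _, h, _ => by omega
  | k + 1, n + 1, G, hG, h, y => by
      simp only [pathExp]
      exact Finset.sum_congr rfl fun z _ => by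
        rw [pathExp_of_dependsOn hA k n (dependsOn_consPath hG y) (by omega)]

/-- Two transition matrices with the same rows outside `B` give the same mean to a functional
that vanishes on the paths that meet `B`. -/
lemma pathExp_eq_of_avoid {A A' : Matrix S S ℝ} {B : Set S}
    (hAA : ∀ x, x ∉ B → ∀ y, A x y = A' x y) :
    ∀ (n : ℕ) {G : (ℕ → S) → ℝ}, (∀ ω, (∃ i < n, ω i ∈ B) → G ω = 0) → ∀ y,
      pathExp A n G y = pathExp A' n G y
  | 0, _, _, _ => rfl
  | n + 1, G, hG, y => by
      by_cases hy : y ∈ B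
      · have h : ∀ ω, G (consPath y ω) = 0 := fun ω => hG _ ⟨0, by omega, by simpa using hy⟩
        have h0 : ∀ (M : Matrix S S ℝ) (z : S), pathExp M n (fun _ => (0 : ℝ)) z = 0 :=
          fun M z => by simpa using pathExp_const_mul M 0 n (fun _ => 0) z
        simp only [pathExp, h, h0]
        simp
      · simp only [pathExp]
        refine Finset.sum_congr rfl fun z _ => ?_
        rw [hAA y hy z, pathExp_eq_of_avoid hAA n (fun ω hω => ?_) z]
        obtain ⟨i, hi, hB⟩ := hω
        exact hG _ ⟨i + 1, by omega, by simpa using hB⟩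

lemma measurable_pathExp {E : Type*} [MeasurableSpace E] {A : E → Matrix S S ℝ}
    (hA : ∀ x y, Measurable fun e => A e x y) :
    ∀ (n : ℕ) (G : (ℕ → S) → ℝ) (y : S), Measurable fun e => pathExp (A e) n G y
  | 0, _, _ => measurable_const
  | n + 1, G, y => by
      simp only [pathExp]
      exact Finset.measurable_sum _ fun z _ => (hA y z).mul (measurable_pathExp hA n _ z)

/-- Self-adjointness of A, that is, reversibility for the uniform law. It turns an exit from z after
a given jump into a quantity computed from z. -/
lemma IsSymmStochastic.sum_mul_mulVec {A : Matrix S S ℝ} (hA : IsSymmStochastic A)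
    (f g : S → ℝ) : ∑ y, f y * (A.mulVec g) y = ∑ y, (A.mulVec f) y * g y := by
  simp only [Matrix.mulVec, dotProduct, Finset.mul_sum, Finset.sum_mul]
  rw [Finset.sum_comm]
  exact Finset.sum_congr rfl fun x _ => Finset.sum_congr rfl fun y _ => by
    rw [hA.symm y x]; ring

lemma IsSymmStochastic.mulVec_const {A : Matrix S S ℝ} (hA : IsSymmStochastic A) (c : ℝ)
    (x : S) : (A.mulVec fun _ => c) x = c := by
  simp only [Matrix.mulVec, dotProduct, ← Finset.sum_mul, hA.row_sum, one_mul]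

lemma IsSymmStochastic.sum_mulVec {A : Matrix S S ℝ} (hA : IsSymmStochastic A)
    (f : S → ℝ) : ∑ y, (A.mulVec f) y = ∑ y, f y := by
  have h := hA.sum_mul_mulVec (fun _ => 1) f
  simpa [hA.mulVec_const] using h

lemma IsSymmStochastic.mulVec_pow_le {A : Matrix S S ℝ} (hA : IsSymmStochastic A)
    {f : S → ℝ} (hf : ∀ x, 0 ≤ f x) (p : ℕ) (x : S) :
    (A.mulVec f x) ^ p ≤ A.mulVec (fun y => f y ^ p) x :=
  Real.pow_arith_mean_le_arith_mean_pow _ _ _ (fun y _ => hA.nonneg x y) (hA.row_sum x)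
    (fun y _ => hf y) p

lemma IsSymmStochastic.mulVec_nonneg {A : Matrix S S ℝ} (hA : IsSymmStochastic A)
    {f : S → ℝ} (hf : ∀ x, 0 ≤ f x) (x : S) : 0 ≤ A.mulVec f x :=
  Finset.sum_nonneg fun y _ => mul_nonneg (hA.nonneg x y) (hf y)

variable [DecidableEq S]

lemma pathExp_shiftPath (A : Matrix S S ℝ) (n : ℕ) (G : (ℕ → S) → ℝ) :
    ∀ (m : ℕ) (y : S), pathExp A (m + n) (fun ω => G (shiftPath m ω)) y
      = ((A ^ m).mulVec (pathExp A n G)) y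
  | 0, y => by
      simp only [shiftPath_zero, pow_zero, Matrix.one_mulVec, zero_add]
  | m + 1, y => by
      rw [show m + 1 + n = (m + n) + 1 by ring, pow_succ', ← Matrix.mulVec_mulVec]
      simp only [pathExp, shiftPath_succ_consPath, pathExp_shiftPath A n G m]
      rfl

/-- The Markov property. -/
lemma pathExp_mul_shiftPath (A : Matrix S S ℝ) (j n : ℕ) (G : (ℕ → S) → ℝ) :
    ∀ (m : ℕ) {F : (ℕ → S) → ℝ}, DependsOn F (Set.Iic m) → ∀ y,
      pathExp A (m + (j + n)) (fun ω => F ω * G (shiftPath (m + j) ω)) y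
        = pathExp A m (fun ω => F ω * ((A ^ j).mulVec (pathExp A n G)) (ω m)) y
  | 0, F, hF, y => by
      -- When m = 0 the factor F sees only the starting point, hence is a constant along paths from
      -- y.
      have key : ∀ (k : ℕ) (H : (ℕ → S) → ℝ), pathExp A k (fun ω => F ω * H ω) y
          = F (fun _ => y) * pathExp A k H y := by
        intro k H
        cases k with
        | zero => rfl
        | succ k =>
          have h : ∀ ω, F (consPath y ω) = F (fun _ => y) := fun ω =>
            hF fun i hi => by
              have : i = 0 := by simpa using hi
              simp [this]
          simp only [pathExp, h, pathExp_const_mul, Finset.mul_sum]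
          exact Finset.sum_congr rfl fun z _ => by ring
      simp only [zero_add]
      rw [key, pathExp_shiftPath]
      rfl
  | m + 1, F, hF, y => by
      rw [show m + 1 + (j + n) = (m + (j + n)) + 1 by ring]
      simp only [pathExp]
      refine Finset.sum_congr rfl fun z _ => ?_
      congr 1
      have h := pathExp_mul_shiftPath A j n G m (dependsOn_consPath hF y) z
      rw [show m + 1 + j = (m + j) + 1 by ring]
      simp only [shiftPath_succ_consPath, consPath_succ]
      exact h

lemma IsSymmStochastic.one : IsSymmStochastic (1 : Matrix S S ℝ) where
  nonneg x y := by rw [Matrix.one_apply]; split_ifs <;> norm_num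
  row_sum x := by simp [Matrix.one_apply]
  symm x y := by simp [Matrix.one_apply, eq_comm]

lemma IsSymmStochastic.pow {A : Matrix S S ℝ} (hA : IsSymmStochastic A) (k : ℕ) :
    IsSymmStochastic (A ^ k) := by
  have hT : ∀ k : ℕ, (A ^ k).transpose = A ^ k := fun k => by
    rw [Matrix.transpose_pow, show A.transpose = A from Matrix.ext fun x y => hA.symm y x]
  induction k with
  | zero => simpa using IsSymmStochastic.one
  | succ k ih =>
    refine ⟨fun x y => ?_, fun x => ?_, fun x y => ?_⟩
    · rw [pow_succ, Matrix.mul_apply]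
      exact Finset.sum_nonneg fun z _ => mul_nonneg (ih.nonneg _ _) (hA.nonneg _ _)
    · simp only [pow_succ, Matrix.mul_apply]
      rw [Finset.sum_comm]
      simp only [← Finset.mul_sum, hA.row_sum, mul_one, ih.row_sum]
    · exact (congrFun (congrFun (hT (k + 1)) x) y).symm

end Chain

section Paths

variable {S : Type*} [DecidableEq S]

/-! ### Jumps and hitting -/

/-- Indicator of a jump at step `i`. -/
def jumpAt (i : ℕ) (ω : ℕ → S) : ℝ := if ω i = ω (i + 1) then 0 else 1

/-- Indicator of a jump into `z` at step `i`. -/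
def jumpInto (z : S) (i : ℕ) (ω : ℕ → S) : ℝ := if ω i ≠ ω (i + 1) ∧ ω (i + 1) = z then 1 else 0

/-- Indicator of a jump out of `z` at step `i`. -/
def jumpOutOf (z : S) (i : ℕ) (ω : ℕ → S) : ℝ := if ω i ≠ ω (i + 1) ∧ ω i = z then 1 else 0

/-- Indicator of being at `z` at step `i`. -/
def atSite (z : S) (i : ℕ) (ω : ℕ → S) : ℝ := if ω i = z then 1 else 0

/-- The number of jumps in the first `n` steps. -/
def numJumps (n : ℕ) (ω : ℕ → S) : ℝ := ∑ i ∈ Finset.range n, jumpAt i ω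

open Classical in
/-- Indicator of a visit to `z` in the first `n` steps. -/
def hits (z : S) (n : ℕ) (ω : ℕ → S) : ℝ := if ∃ i ≤ n, ω i = z then 1 else 0

lemma jumpAt_nonneg (i : ℕ) (ω : ℕ → S) : 0 ≤ jumpAt i ω := by
  unfold jumpAt; split_ifs <;> norm_num

lemma atSite_nonneg (z : S) (i : ℕ) (ω : ℕ → S) : 0 ≤ atSite z i ω := by
  unfold atSite; split_ifs <;> norm_num

lemma jumpInto_nonneg (z : S) (i : ℕ) (ω : ℕ → S) : 0 ≤ jumpInto z i ω := by
  unfold jumpInto; split_ifs <;> norm_num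

lemma jumpOutOf_nonneg (z : S) (i : ℕ) (ω : ℕ → S) : 0 ≤ jumpOutOf z i ω := by
  unfold jumpOutOf; split_ifs <;> norm_num

lemma numJumps_nonneg (n : ℕ) (ω : ℕ → S) : 0 ≤ numJumps n ω :=
  Finset.sum_nonneg fun i _ => jumpAt_nonneg i ω

lemma hits_nonneg (z : S) (n : ℕ) (ω : ℕ → S) : 0 ≤ hits z n ω := by
  unfold hits; split_ifs <;> norm_num

lemma dependsOn_jumpAt_zero : DependsOn (jumpAt (S := S) 0) (Set.Iic 1) := fun ω ω' h => by
  simp only [jumpAt, h 0 (by simp), h (0 + 1) (by simp)]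

lemma dependsOn_jumpInto_zero (z : S) : DependsOn (jumpInto z 0) (Set.Iic 1) := fun ω ω' h => by
  simp only [jumpInto, h 0 (by simp), h (0 + 1) (by simp)]

lemma dependsOn_jumpOutOf_zero (z : S) : DependsOn (jumpOutOf z 0) (Set.Iic 1) :=
  fun ω ω' h => by simp only [jumpOutOf, h 0 (by simp), h (0 + 1) (by simp)]

lemma dependsOn_atSite_zero (z : S) : DependsOn (atSite z 0) (Set.Iic 0) := fun ω ω' h => by
  simp only [atSite, h 0 (by simp)]

lemma jumpAt_shiftPath (i j : ℕ) (ω : ℕ → S) : jumpAt j (shiftPath i ω) = jumpAt (i + j) ω := rfl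

lemma jumpInto_shiftPath (z : S) (i j : ℕ) (ω : ℕ → S) :
    jumpInto z j (shiftPath i ω) = jumpInto z (i + j) ω := rfl

lemma jumpOutOf_shiftPath (z : S) (i j : ℕ) (ω : ℕ → S) :
    jumpOutOf z j (shiftPath i ω) = jumpOutOf z (i + j) ω := rfl

lemma atSite_shiftPath (z : S) (i j : ℕ) (ω : ℕ → S) :
    atSite z j (shiftPath i ω) = atSite z (i + j) ω := rfl

lemma exists_jumpInto {z : S} {ω : ℕ → S} {m : ℕ} (h : ω m = z) (h0 : ω 0 ≠ z) :
    ∃ j < m, ω j ≠ ω (j + 1) ∧ ω (j + 1) = z := by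
  induction m with
  | zero => exact absurd h h0
  | succ m ih =>
    by_cases hm : ω m = z
    · obtain ⟨j, hj, h'⟩ := ih hm
      exact ⟨j, by omega, h'⟩
    · exact ⟨m, by omega, by rwa [h], h⟩

lemma exists_jumpOutOf {z : S} {ω : ℕ → S} {m n : ℕ} (hmn : m ≤ n) (h : ω m = z) (hn : ω n ≠ z) :
    ∃ j, m ≤ j ∧ j < n ∧ ω j ≠ ω (j + 1) ∧ ω j = z := by
  induction n, hmn using Nat.le_induction with
  | base => exact absurd h hn
  | succ n hmn ih =>
    by_cases h' : ω n = z
    · exact ⟨n, hmn, by omega, by rw [h']; exact hn.symm, h'⟩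
    · obtain ⟨j, h1, h2, h3⟩ := ih h'
      exact ⟨j, h1, by omega, h3⟩

lemma hits_le (z : S) (n : ℕ) (ω : ℕ → S) :
    hits z n ω ≤ atSite z 0 ω + ∑ j ∈ Finset.range n, jumpInto z j ω := by
  have hs : 0 ≤ ∑ j ∈ Finset.range n, jumpInto z j ω :=
    Finset.sum_nonneg fun j _ => jumpInto_nonneg z j ω
  unfold hits
  split_ifs with h
  · obtain ⟨m, hm, h⟩ := h
    by_cases h0 : ω 0 = z
    · simp only [atSite, h0, if_true]; linarith
    · obtain ⟨j, hj, h'⟩ := exists_jumpInto h h0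
      have := Finset.single_le_sum (f := fun j => jumpInto z j ω)
        (fun j _ => jumpInto_nonneg z j ω) (Finset.mem_range.2 (by omega : j < n))
      have e : jumpInto z j ω = 1 := by simp only [jumpInto]; exact if_pos h'
      have := atSite_nonneg z 0 ω
      linarith
  · have := atSite_nonneg z 0 ω
    linarith

/-- A visit up to time i is charged to an entrance before step i (or to the start), a later visit to
an exit after step i (or to the end). No term involves step i itself, so each can be decoupled from
the jump at step i by the Markov property. -/
lemma hits_le_add (z : S) (i n : ℕ) (ω : ℕ → S) :
    hits z n ω ≤ (atSite z 0 ω + ∑ j ∈ Finset.range i, jumpInto z j ω)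
      + (∑ j ∈ Finset.Ico (i + 1) n, jumpOutOf z j ω + atSite z n ω) := by
  have h1 : 0 ≤ ∑ j ∈ Finset.range i, jumpInto z j ω :=
    Finset.sum_nonneg fun j _ => jumpInto_nonneg z j ω
  have h2 : 0 ≤ ∑ j ∈ Finset.Ico (i + 1) n, jumpOutOf z j ω :=
    Finset.sum_nonneg fun j _ => jumpOutOf_nonneg z j ω
  have h3 := atSite_nonneg z 0 ω
  have h4 := atSite_nonneg z n ω
  by_cases h : ∃ m ≤ n, ω m = z
  · have e : hits z n ω = 1 := by unfold hits; exact if_pos h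
    obtain ⟨m, hm, h⟩ := h
    rcases Nat.lt_or_ge i m with him | him
    · by_cases hn : ω n = z
      · have : atSite z n ω = 1 := if_pos hn
        linarith
      · obtain ⟨j, hj1, hj2, h'⟩ := exists_jumpOutOf hm h hn
        have := Finset.single_le_sum (f := fun j => jumpOutOf z j ω)
          (fun j _ => jumpOutOf_nonneg z j ω)
          (Finset.mem_Ico.2 ⟨by omega, hj2⟩ : j ∈ Finset.Ico (i + 1) n)
        have e' : jumpOutOf z j ω = 1 := if_pos h'
        linarith
    · have e2 : hits z i ω = 1 := by unfold hits; exact if_pos ⟨m, him, h⟩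
      have := hits_le z i ω
      linarith
  · have e : hits z n ω = 0 := by unfold hits; exact if_neg h
    linarith

end Paths

/-! ### Stationary reversible chains: correlations of jumps with visits, and their moments -/

section Stationary

variable {S : Type*} [Fintype S] {A : Matrix S S ℝ}

lemma statExp_mono (hA : IsSymmStochastic A) (n : ℕ) {G G' : (ℕ → S) → ℝ}
    (h : ∀ ω, G ω ≤ G' ω) : statExp A n G ≤ statExp A n G' :=
  mul_le_mul_of_nonneg_left (Finset.sum_le_sum fun y _ => pathExp_mono hA.nonneg n h y)
    (by positivity)

lemma statExp_nonneg (hA : IsSymmStochastic A) (n : ℕ) {G : (ℕ → S) → ℝ}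
    (h : ∀ ω, 0 ≤ G ω) : 0 ≤ statExp A n G :=
  mul_nonneg (by positivity) (Finset.sum_nonneg fun y _ => pathExp_nonneg hA.nonneg n h y)

lemma statExp_add (A : Matrix S S ℝ) (n : ℕ) (G G' : (ℕ → S) → ℝ) :
    statExp A n (fun ω => G ω + G' ω) = statExp A n G + statExp A n G' := by
  simp only [statExp, pathExp_add, Finset.sum_add_distrib, mul_add]

lemma statExp_const_mul (A : Matrix S S ℝ) (n : ℕ) (c : ℝ) (G : (ℕ → S) → ℝ) :
    statExp A n (fun ω => c * G ω) = c * statExp A n G := by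
  simp only [statExp, pathExp_const_mul, ← Finset.mul_sum]
  ring

lemma statExp_sub (A : Matrix S S ℝ) (n : ℕ) (G G' : (ℕ → S) → ℝ) :
    statExp A n (fun ω => G ω - G' ω) = statExp A n G - statExp A n G' := by
  have h := statExp_add A n G (fun ω => (-1) * G' ω)
  rw [statExp_const_mul] at h
  rw [show (fun ω => G ω - G' ω) = fun ω => G ω + (-1) * G' ω by funext ω; ring, h]
  ring

lemma statExp_sum (A : Matrix S S ℝ) (n : ℕ) {ι : Type*} (s : Finset ι)
    (G : ι → (ℕ → S) → ℝ) :
    statExp A n (fun ω => ∑ i ∈ s, G i ω) = ∑ i ∈ s, statExp A n (G i) := by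
  classical
  induction s using Finset.induction_on with
  | empty => simpa using statExp_const_mul A n 0 (fun _ => 0)
  | insert i s hi ih => simp only [Finset.sum_insert hi, statExp_add, ih]

lemma statExp_const [Nonempty S] (hA : IsSymmStochastic A) (n : ℕ) (c : ℝ) :
    statExp A n (fun _ => c) = c := by
  simp only [statExp, pathExp_const hA.row_sum]
  simp

lemma statExp_of_dependsOn (hA : IsSymmStochastic A) {k n : ℕ} {G : (ℕ → S) → ℝ}
    (hG : DependsOn G (Set.Iic k)) (hkn : k ≤ n) : statExp A n G = statExp A k G := by
  simp only [statExp, pathExp_of_dependsOn hA.row_sum k n hG hkn]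

lemma abs_statExp_le [Nonempty S] (hA : ∀ x y, 0 ≤ A x y) (hA1 : ∀ x, ∑ y, A x y = 1) (n : ℕ)
    {G : (ℕ → S) → ℝ} {c : ℝ} (hG : ∀ ω, |G ω| ≤ c) : |statExp A n G| ≤ c := by
  rw [statExp, abs_mul, abs_of_nonneg (by positivity : (0 : ℝ) ≤ (Fintype.card S : ℝ)⁻¹)]
  calc (Fintype.card S : ℝ)⁻¹ * |∑ y, pathExp A n G y|
      ≤ (Fintype.card S : ℝ)⁻¹ * ∑ _y : S, c :=
        mul_le_mul_of_nonneg_left ((Finset.abs_sum_le_sum_abs _ _).trans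
          (Finset.sum_le_sum fun y _ => abs_pathExp_le hA hA1 n hG y)) (by positivity)
    _ = c := by simp

lemma measurable_statExp {E : Type*} [MeasurableSpace E] {A : E → Matrix S S ℝ}
    (hA : ∀ x y, Measurable fun e => A e x y) (n : ℕ) (G : (ℕ → S) → ℝ) :
    Measurable fun e => statExp (A e) n G :=
  (Finset.measurable_sum _ fun y _ => measurable_pathExp hA n G y).const_mul _

variable [DecidableEq S]

/-- Stationarity of the uniform distribution. -/
lemma statExp_shiftPath (hA : IsSymmStochastic A) {i k n : ℕ} {G : (ℕ → S) → ℝ}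
    (hG : DependsOn G (Set.Iic k)) (hn : i + k ≤ n) :
    statExp A n (fun ω => G (shiftPath i ω)) = statExp A k G := by
  rw [statExp_of_dependsOn hA (dependsOn_shiftPath hG i) hn]
  simp only [statExp, pathExp_shiftPath, (hA.pow i).sum_mulVec]

lemma statExp_mul_shiftPath (hA : IsSymmStochastic A) {i m j k n : ℕ} {F G : (ℕ → S) → ℝ}
    (hF : DependsOn F (Set.Iic m)) (hG : DependsOn G (Set.Iic k)) (hn : i + m + j + k ≤ n) :
    statExp A n (fun ω => F (shiftPath i ω) * G (shiftPath (i + m + j) ω))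
      = statExp A m (fun ω => F ω * ((A ^ j).mulVec (pathExp A k G)) (ω m)) := by
  have hFG : DependsOn (fun ω => F ω * G (shiftPath (m + j) ω)) (Set.Iic (m + j + k)) :=
    dependsOn_mul (hF.mono (Set.Iic_subset_Iic.2 (by omega))) (dependsOn_shiftPath hG _)
  have h1 := statExp_shiftPath hA (i := i) (n := n) hFG (by omega)
  simp only [shiftPath_shiftPath] at h1
  rw [show i + m + j = i + (m + j) by ring, h1, statExp, statExp, add_assoc]
  simp only [pathExp_mul_shiftPath A j k G m hF]

/-- Approximate independence of events that are separated by a time gap. -/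
lemma statExp_mul_shiftPath_le (hA : IsSymmStochastic A) {i m j k n : ℕ}
    {F G : (ℕ → S) → ℝ} (hF : DependsOn F (Set.Iic m)) (hG : DependsOn G (Set.Iic k))
    (hF0 : ∀ ω, 0 ≤ F ω) (hG0 : ∀ ω, 0 ≤ G ω) {η : ℝ}
    (hη : ∀ x y, (A ^ j) x y ≤ (Fintype.card S : ℝ)⁻¹ * (1 + η)) (hn : i + m + j + k ≤ n) :
    statExp A n (fun ω => F (shiftPath i ω) * G (shiftPath (i + m + j) ω))
      ≤ (1 + η) * (statExp A m F * statExp A k G) := by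
  rw [statExp_mul_shiftPath hA hF hG hn]
  calc statExp A m (fun ω => F ω * ((A ^ j).mulVec (pathExp A k G)) (ω m))
      ≤ statExp A m (fun ω => ((1 + η) * statExp A k G) * F ω) := by
        refine statExp_mono hA m fun ω => ?_
        rw [mul_comm]
        refine mul_le_mul_of_nonneg_right ?_ (hF0 ω)
        simp only [Matrix.mulVec, dotProduct, statExp, Finset.mul_sum]
        refine Finset.sum_le_sum fun y _ => ?_
        calc (A ^ j) (ω m) y * pathExp A k G y
            ≤ (Fintype.card S : ℝ)⁻¹ * (1 + η) * pathExp A k G y :=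
              mul_le_mul_of_nonneg_right (hη _ _) (pathExp_nonneg hA.nonneg k hG0 y)
          _ = _ := by ring
    _ = _ := by rw [statExp_const_mul]; ring

/-- The probability to leave `x` in one step. -/
def escape (A : Matrix S S ℝ) (x : S) : ℝ := ∑ y, if x = y then 0 else A x y

lemma escape_nonneg (hA : IsSymmStochastic A) (x : S) : 0 ≤ escape A x :=
  Finset.sum_nonneg fun y _ => by split_ifs; exacts [le_rfl, hA.nonneg x y]

lemma pathExp_jumpAt (x : S) : pathExp A 1 (jumpAt 0) x = escape A x := by
  simp only [pathExp, jumpAt, escape, consPath_zero, consPath_succ]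
  exact Finset.sum_congr rfl fun y _ => by by_cases h : x = y <;> simp [h]

lemma pathExp_jumpOutOf (z x : S) :
    pathExp A 1 (jumpOutOf z 0) x = if x = z then escape A z else 0 := by
  simp only [pathExp, jumpOutOf, escape, consPath_zero, consPath_succ]
  by_cases h : x = z
  · subst h
    simp only [and_true, if_true]
    exact Finset.sum_congr rfl fun y _ => by by_cases hy : x = y <;> simp [hy]
  · simp [h]

lemma pathExp_atSite (z x : S) : pathExp A 0 (atSite z 0) x = if x = z then 1 else 0 := rfl

/-- Reversing the single step: under the uniform law, the endpoint of a jump has the same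
distribution as its starting point, with weight `escape`. -/
lemma statExp_jumpAt_mul (hA : IsSymmStochastic A) (f : S → ℝ) :
    statExp A 1 (fun ω => jumpAt 0 ω * f (ω 1))
      = (Fintype.card S : ℝ)⁻¹ * ∑ y, escape A y * f y := by
  simp only [statExp, pathExp, jumpAt, escape, consPath_zero, consPath_succ, Finset.sum_mul]
  congr 1
  rw [Finset.sum_comm]
  refine Finset.sum_congr rfl fun y _ => Finset.sum_congr rfl fun x _ => ?_
  rw [hA.symm x y]
  by_cases h : x = y
  · simp [h]
  · simp [h, Ne.symm h]

lemma statExp_jumpInto_mul (hA : IsSymmStochastic A) (z : S) (f : S → ℝ) :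
    statExp A 1 (fun ω => jumpInto z 0 ω * f (ω 1))
      = (Fintype.card S : ℝ)⁻¹ * (escape A z * f z) := by
  simp only [statExp, pathExp, jumpInto, escape, consPath_zero, consPath_succ, Finset.sum_mul]
  congr 1
  refine Finset.sum_congr rfl fun y _ => ?_
  rw [Finset.sum_eq_single z]
  · rw [hA.symm y z]
    by_cases h : y = z
    · simp [h]
    · simp [h, Ne.symm h]
  · intro x _ hx
    simp [hx]
  · simp

lemma statExp_jumpInto (hA : IsSymmStochastic A) (z : S) {i n : ℕ} (h : i < n) :
    statExp A n (jumpInto z i) = (Fintype.card S : ℝ)⁻¹ * escape A z := by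
  have h1 := statExp_shiftPath hA (i := i) (n := n) (dependsOn_jumpInto_zero z) (by omega)
  simp only [jumpInto_shiftPath, add_zero] at h1
  have h2 := statExp_jumpInto_mul hA z (fun _ => 1)
  simp only [mul_one] at h2
  exact h1.trans h2

lemma statExp_atSite (hA : IsSymmStochastic A) (z : S) {i n : ℕ} (h : i ≤ n) :
    statExp A n (atSite z i) = (Fintype.card S : ℝ)⁻¹ := by
  have h1 := statExp_shiftPath hA (i := i) (n := n) (dependsOn_atSite_zero z) (by omega)
  simp only [atSite_shiftPath, add_zero] at h1
  refine h1.trans ?_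
  simp [statExp, pathExp, atSite]

lemma statExp_jumpInto_mul_jumpAt (hA : IsSymmStochastic A) (z : S) {i k n : ℕ}
    (h : i + 1 + k < n) : statExp A n (fun ω => jumpInto z i ω * jumpAt (i + 1 + k) ω)
      = (Fintype.card S : ℝ)⁻¹ * (escape A z * ((A ^ k).mulVec (escape A)) z) := by
  have h1 := statExp_mul_shiftPath hA (i := i) (j := k) (n := n)
    (dependsOn_jumpInto_zero z) dependsOn_jumpAt_zero (by omega)
  simp only [jumpInto_shiftPath, jumpAt_shiftPath, add_zero] at h1
  rw [h1, statExp_jumpInto_mul hA,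
    show pathExp A 1 (jumpAt 0) = escape A from funext pathExp_jumpAt]

lemma statExp_jumpAt_mul_jumpOutOf (hA : IsSymmStochastic A) (z : S) {i k n : ℕ}
    (h : i + 1 + k < n) : statExp A n (fun ω => jumpAt i ω * jumpOutOf z (i + 1 + k) ω)
      = (Fintype.card S : ℝ)⁻¹ * (escape A z * ((A ^ k).mulVec (escape A)) z) := by
  have h1 := statExp_mul_shiftPath hA (i := i) (j := k) (n := n)
    dependsOn_jumpAt_zero (dependsOn_jumpOutOf_zero z) (by omega)
  simp only [jumpOutOf_shiftPath, jumpAt_shiftPath, add_zero] at h1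
  rw [h1, statExp_jumpAt_mul hA, (hA.pow k).sum_mul_mulVec]
  simp [pathExp_jumpOutOf, mul_comm]

lemma statExp_atSite_zero_mul_jumpAt (hA : IsSymmStochastic A) (z : S) {k n : ℕ}
    (h : k < n) : statExp A n (fun ω => atSite z 0 ω * jumpAt k ω)
      = (Fintype.card S : ℝ)⁻¹ * ((A ^ k).mulVec (escape A)) z := by
  have h1 := statExp_mul_shiftPath hA (i := 0) (j := k) (n := n)
    (dependsOn_atSite_zero z) dependsOn_jumpAt_zero (by omega)
  simp only [atSite_shiftPath, jumpAt_shiftPath, add_zero, zero_add] at h1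
  rw [h1, show pathExp A 1 (jumpAt 0) = escape A from funext pathExp_jumpAt]
  simp [statExp, pathExp, atSite]

lemma statExp_jumpAt_mul_atSite (hA : IsSymmStochastic A) (z : S) {i k n : ℕ}
    (h : i + 1 + k ≤ n) : statExp A n (fun ω => jumpAt i ω * atSite z (i + 1 + k) ω)
      = (Fintype.card S : ℝ)⁻¹ * ((A ^ k).mulVec (escape A)) z := by
  have h1 := statExp_mul_shiftPath hA (i := i) (j := k) (n := n)
    dependsOn_jumpAt_zero (dependsOn_atSite_zero z) (by omega)
  simp only [atSite_shiftPath, jumpAt_shiftPath, add_zero] at h1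
  rw [h1, statExp_jumpAt_mul hA, (hA.pow k).sum_mul_mulVec]
  simp [pathExp_atSite]

lemma statExp_hits_le (hA : IsSymmStochastic A) (z : S) (n : ℕ) :
    statExp A n (hits z n) ≤ (Fintype.card S : ℝ)⁻¹ * (1 + n * escape A z) := by
  refine (statExp_mono hA n (hits_le z n)).trans ?_
  rw [statExp_add, statExp_sum, statExp_atSite hA z (by omega),
    Finset.sum_congr rfl fun i hi => statExp_jumpInto hA z (Finset.mem_range.1 hi)]
  simp only [Finset.sum_const, Finset.card_range, nsmul_eq_mul]
  exact le_of_eq (by ring)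

/-- The Green function `∑_{k<n} A^k` applied to the escape probability. -/
def greenEscape (A : Matrix S S ℝ) (n : ℕ) (z : S) : ℝ :=
  ∑ k ∈ Finset.range n, ((A ^ k).mulVec (escape A)) z

lemma greenEscape_nonneg (hA : IsSymmStochastic A) (n : ℕ) (z : S) : 0 ≤ greenEscape A n z :=
  Finset.sum_nonneg fun k _ => (hA.pow k).mulVec_nonneg (escape_nonneg hA) z

lemma greenEscape_mono (hA : IsSymmStochastic A) {m n : ℕ} (h : m ≤ n) (z : S) :
    greenEscape A m z ≤ greenEscape A n z :=
  Finset.sum_le_sum_of_subset_of_nonneg (Finset.range_mono h)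
    fun k _ _ => (hA.pow k).mulVec_nonneg (escape_nonneg hA) z

/-- Apply `hits_le_add` at the time i of the jump. Entrances into z before i are followed forwards
from z, exits from z after i are followed backwards by reversibility; in both cases the chain seen
from z jumps k steps away with probability `(A ^ k).mulVec (escape A)` at z, and summing over k
produces the Green function. -/
lemma statExp_jumpAt_mul_hits_le (hA : IsSymmStochastic A) (z : S) {i n : ℕ} (hi : i < n) :
    statExp A n (fun ω => jumpAt i ω * hits z n ω) ≤ (Fintype.card S : ℝ)⁻¹ *
      (((A ^ i).mulVec (escape A)) z + escape A z * greenEscape A n z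
        + (escape A z * greenEscape A n z + ((A ^ (n - 1 - i)).mulVec (escape A)) z)) := by
  have hρ := escape_nonneg hA z
  calc statExp A n (fun ω => jumpAt i ω * hits z n ω)
      ≤ statExp A n (fun ω => (atSite z 0 ω * jumpAt i ω
          + ∑ j ∈ Finset.range i, jumpInto z j ω * jumpAt i ω)
          + (∑ j ∈ Finset.Ico (i + 1) n, jumpAt i ω * jumpOutOf z j ω
            + jumpAt i ω * atSite z n ω)) := by
        refine statExp_mono hA n fun ω => ?_
        refine (mul_le_mul_of_nonneg_left (hits_le_add z i n ω) (jumpAt_nonneg i ω)).trans ?_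
        rw [← Finset.sum_mul, ← Finset.mul_sum]
        exact le_of_eq (by ring)
    _ ≤ _ := by
        simp only [statExp_add, statExp_sum]
        rw [statExp_atSite_zero_mul_jumpAt hA z hi]
        have e1 : ∑ j ∈ Finset.range i, statExp A n (fun ω => jumpInto z j ω * jumpAt i ω)
            = (Fintype.card S : ℝ)⁻¹ * (escape A z * greenEscape A i z) := by
          rw [greenEscape, ← Finset.sum_range_reflect, Finset.mul_sum, Finset.mul_sum]
          refine Finset.sum_congr rfl fun j hj => ?_
          have hj := Finset.mem_range.1 hj
          have := statExp_jumpInto_mul_jumpAt hA z (i := i - 1 - j) (k := j) (n := n) (by omega)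
          rwa [show i - 1 - j + 1 + j = i by omega] at this
        have e2 : ∑ j ∈ Finset.Ico (i + 1) n, statExp A n (fun ω => jumpAt i ω * jumpOutOf z j ω)
            = (Fintype.card S : ℝ)⁻¹ * (escape A z * greenEscape A (n - (i + 1)) z) := by
          rw [greenEscape, Finset.sum_Ico_eq_sum_range, Finset.mul_sum, Finset.mul_sum]
          refine Finset.sum_congr rfl fun j hj => ?_
          have hj := Finset.mem_range.1 hj
          exact statExp_jumpAt_mul_jumpOutOf hA z (by omega)
        have e3 := statExp_jumpAt_mul_atSite hA z (i := i) (k := n - 1 - i) (n := n) (by omega)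
        rw [show i + 1 + (n - 1 - i) = n by omega] at e3
        rw [e1, e2, e3, ← mul_add, ← mul_add, ← mul_add]
        refine mul_le_mul_of_nonneg_left ?_ (by positivity)
        have g1 := mul_le_mul_of_nonneg_left (greenEscape_mono hA (by omega : i ≤ n) z) hρ
        have g2 := mul_le_mul_of_nonneg_left
          (greenEscape_mono hA (by omega : n - (i + 1) ≤ n) z) hρ
        linarith

lemma statExp_one_add_numJumps_mul_hits_le (hA : IsSymmStochastic A) (z : S) (n : ℕ) :
    statExp A n (fun ω => (1 + numJumps n ω) * hits z n ω)
      ≤ (Fintype.card S : ℝ)⁻¹ * ((1 + n * escape A z) * (1 + 2 * greenEscape A n z)) := by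
  have e : (fun ω : ℕ → S => (1 + numJumps n ω) * hits z n ω)
      = fun ω => hits z n ω + ∑ i ∈ Finset.range n, jumpAt i ω * hits z n ω := by
    funext ω
    rw [numJumps, add_mul, one_mul, Finset.sum_mul]
  rw [e, statExp_add, statExp_sum]
  have h1 := statExp_hits_le hA z n
  have h2 := Finset.sum_le_sum fun i (hi : i ∈ Finset.range n) =>
    statExp_jumpAt_mul_hits_le hA z (Finset.mem_range.1 hi)
  rw [← Finset.mul_sum, Finset.sum_add_distrib, Finset.sum_add_distrib, Finset.sum_add_distrib,
    Finset.sum_range_reflect (fun k => ((A ^ k).mulVec (escape A)) z)] at h2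
  simp only [Finset.sum_const, Finset.card_range, nsmul_eq_mul] at h2
  rw [← greenEscape] at h2
  refine (add_le_add h1 h2).trans (le_of_eq ?_)
  ring

/-- The Green function is an average over k < n of n (A^k ρ), with ρ the escape probability.
Jensen's inequality is applied to the average over k and then to the rows of A^k; the powers of A
preserve sums over the state space. -/
lemma sum_one_add_greenEscape_pow_le (hA : IsSymmStochastic A) (n p : ℕ) :
    ∑ z, (1 + 2 * greenEscape A n z) ^ p ≤ ∑ z, (1 + 2 * n * escape A z) ^ p := by
  rcases Nat.eq_zero_or_pos n with rfl | hn
  · simp [greenEscape]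
  have hn' : (n : ℝ) ≠ 0 := by positivity
  have hf : ∀ z, 0 ≤ 1 + 2 * n * escape A z := fun z => by
    have := escape_nonneg hA z; positivity
  have key : ∀ z, (1 + 2 * greenEscape A n z) ^ p
      ≤ ∑ k ∈ Finset.range n, (n : ℝ)⁻¹ *
          ((A ^ k).mulVec fun y => (1 + 2 * n * escape A y) ^ p) z := by
    intro z
    have e : ∀ k, ((A ^ k).mulVec fun y => 1 + 2 * n * escape A y) z
        = 1 + 2 * n * ((A ^ k).mulVec (escape A)) z := by
      intro k
      have := (hA.pow k).row_sum z
      simp only [Matrix.mulVec, dotProduct, mul_add, Finset.sum_add_distrib, mul_one, this,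
        Finset.mul_sum]
      congr 1
      exact Finset.sum_congr rfl fun y _ => by ring
    have e2 : 1 + 2 * greenEscape A n z
        = ∑ k ∈ Finset.range n, (n : ℝ)⁻¹ * ((A ^ k).mulVec fun y => 1 + 2 * n * escape A y) z := by
      simp only [e, greenEscape, mul_add, Finset.sum_add_distrib, ← Finset.mul_sum,
        Finset.sum_const, Finset.card_range, nsmul_eq_mul]
      field_simp
    rw [e2]
    refine (Real.pow_arith_mean_le_arith_mean_pow _ _ _ (fun _ _ => by positivity) ?_
      (fun k _ => (hA.pow k).mulVec_nonneg hf z) p).trans ?_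
    · simp [hn']
    · exact Finset.sum_le_sum fun k _ => mul_le_mul_of_nonneg_left
        ((hA.pow k).mulVec_pow_le hf p z) (by positivity)
  refine (Finset.sum_le_sum fun z _ => key z).trans (le_of_eq ?_)
  rw [Finset.sum_comm]
  simp only [← Finset.mul_sum, (hA.pow _).sum_mulVec]
  simp [hn']

/-- The bound at z is a product of one factor in the escape probability and one in the Green
function. The inequality uv ≤ (u² + v²)/2 separates them, which doubles the exponent. -/
lemma sum_statExp_mul_hits_pow_le (hA : IsSymmStochastic A) (n p : ℕ) :
    ∑ z, ((Fintype.card S : ℝ) * statExp A n (fun ω => (1 + numJumps n ω) * hits z n ω)) ^ p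
      ≤ ∑ z, (1 + 2 * n * escape A z) ^ (2 * p) := by
  have hcard : ∀ _z : S, (Fintype.card S : ℝ) ≠ 0 := fun z =>
    have : Nonempty S := ⟨z⟩
    Nat.cast_ne_zero.2 Fintype.card_ne_zero
  calc _ ≤ ∑ z, ((1 + n * escape A z) * (1 + 2 * greenEscape A n z)) ^ p := by
        refine Finset.sum_le_sum fun z _ => pow_le_pow_left₀ ?_ ?_ p
        · exact mul_nonneg (by positivity) (statExp_nonneg hA n fun ω =>
            mul_nonneg (by linarith [numJumps_nonneg n ω]) (hits_nonneg z n ω))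
        · refine (mul_le_mul_of_nonneg_left (statExp_one_add_numJumps_mul_hits_le hA z n)
            (by positivity)).trans (le_of_eq ?_)
          rw [← mul_assoc, mul_inv_cancel₀ (hcard z), one_mul]
    _ ≤ ∑ z, ((1 + 2 * n * escape A z) ^ (2 * p) + (1 + 2 * greenEscape A n z) ^ (2 * p)) / 2 := by
        refine Finset.sum_le_sum fun z _ => ?_
        have h0 := escape_nonneg hA z
        have h1 : (1 + n * escape A z) ^ p ≤ (1 + 2 * n * escape A z) ^ p :=
          pow_le_pow_left₀ (by positivity)
            (by have : 0 ≤ n * escape A z := by positivity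
                linarith) p
        have h2 : 0 ≤ (1 + 2 * greenEscape A n z) ^ p := by
          have := greenEscape_nonneg hA n z
          positivity
        rw [mul_pow, pow_mul', pow_mul']
        nlinarith [sq_nonneg ((1 + 2 * n * escape A z) ^ p - (1 + 2 * greenEscape A n z) ^ p),
          mul_le_mul_of_nonneg_right h1 h2]
    _ ≤ _ := by
        rw [← Finset.sum_div, Finset.sum_add_distrib]
        have := sum_one_add_greenEscape_pow_le hA n (2 * p)
        linarith

end Stationary

/-! ### The Efron–Stein inequality -/

section EfronStein

variable {Ω : Type*} [MeasurableSpace Ω]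

lemma integrable_of_bounded {μ : Measure Ω} [IsFiniteMeasure μ] {f : Ω → ℝ}
    (hf : Measurable f) {C : ℝ} (hC : ∀ x, |f x| ≤ C) : Integrable f μ :=
  Integrable.of_bound hf.aestronglyMeasurable C (Eventually.of_forall hC)

lemma integrable_sq_of_bounded {μ : Measure Ω} [IsFiniteMeasure μ] {f : Ω → ℝ}
    (hf : Measurable f) {C : ℝ} (hC : ∀ x, |f x| ≤ C) : Integrable (fun x => f x ^ 2) μ :=
  integrable_of_bounded (hf.pow_const 2) (C := C ^ 2) fun x => by
    rw [abs_pow]; exact pow_le_pow_left₀ (abs_nonneg _) (hC x) 2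

/-- Bias-variance decomposition: the mean is the constant closest to f in mean square. -/
lemma integral_sub_sq_eq (μ : Measure Ω) [IsProbabilityMeasure μ] {f : Ω → ℝ}
    (hf : Measurable f) {C : ℝ} (hC : ∀ x, |f x| ≤ C) (c : ℝ) :
    ∫ x, (f x - c) ^ 2 ∂μ = ∫ x, (f x - ∫ z, f z ∂μ) ^ 2 ∂μ + ((∫ z, f z ∂μ) - c) ^ 2 := by
  set m := ∫ z, f z ∂μ with hm
  have h1 := integrable_of_bounded (μ := μ) hf hC
  have h2 := integrable_sq_of_bounded (μ := μ) hf hC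
  have key : ∀ d : ℝ, ∫ x, (f x - d) ^ 2 ∂μ = ∫ x, f x ^ 2 ∂μ - 2 * d * m + d ^ 2 := by
    intro d
    have : (fun x => (f x - d) ^ 2) = fun x => f x ^ 2 - 2 * d * f x + d ^ 2 := by
      funext x; ring
    have h3 : Integrable (fun x => f x ^ 2 - 2 * d * f x) μ := h2.sub (h1.const_mul _)
    rw [this, integral_add h3 (integrable_const _),
      integral_sub h2 (h1.const_mul _), integral_const_mul, integral_const]
    simp [hm]
  rw [key c, key m]
  ring

lemma sq_integral_le (μ : Measure Ω) [IsProbabilityMeasure μ] {f : Ω → ℝ}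
    (hf : Measurable f) {C : ℝ} (hC : ∀ x, |f x| ≤ C) :
    (∫ x, f x ∂μ) ^ 2 ≤ ∫ x, f x ^ 2 ∂μ := by
  have h := integral_sub_sq_eq μ hf hC 0
  simp only [sub_zero] at h
  have : 0 ≤ ∫ x, (f x - ∫ z, f z ∂μ) ^ 2 ∂μ := integral_nonneg fun x => sq_nonneg _
  linarith

lemma measurable_fin_cons {n : ℕ} :
    Measurable fun p : Ω × (Fin n → Ω) => (Fin.cons p.1 p.2 : Fin (n + 1) → Ω) := by
  refine measurable_pi_lambda _ fun i => ?_
  refine Fin.cases ?_ (fun i => ?_) i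
  · simpa using measurable_fst
  · simp only [Fin.cons_succ]
    exact (measurable_pi_apply i).comp measurable_snd

lemma integral_pi_fin_succ (μ : Measure Ω) [IsProbabilityMeasure μ] {n : ℕ}
    {f : (Fin (n + 1) → Ω) → ℝ} (hf : Measurable f) {C : ℝ} (hC : ∀ x, |f x| ≤ C) :
    ∫ x, f x ∂(Measure.pi fun _ => μ)
      = ∫ y, ∫ x, f (Fin.cons x y) ∂μ ∂(Measure.pi fun _ : Fin n => μ) := by
  have h := measurePreserving_piFinSuccAbove (fun _ : Fin (n + 1) => μ) 0
  have h2 := (h.symm _).integral_comp (MeasurableEquiv.measurableEmbedding _) f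
  rw [← h2]
  have e : ∀ p : Ω × (Fin n → Ω),
      (MeasurableEquiv.piFinSuccAbove (fun _ : Fin (n + 1) => Ω) 0).symm p
        = Fin.cons p.1 p.2 := by
    intro p
    simp [MeasurableEquiv.piFinSuccAbove, Fin.insertNthEquiv]
  simp only [e]
  exact integral_prod_symm _
    (integrable_of_bounded (hf.comp measurable_fin_cons) fun p => hC _)

/-- Induction on the number of variables: the variance is the mean of the variance in the first
variable, plus the variance of the average F over that variable. The second part is treated by the
induction hypothesis, with each g averaged in the same way. -/
lemma efronStein_fin (μ : Measure Ω) [IsProbabilityMeasure μ] {C : ℝ} : ∀ (n : ℕ)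
    {f : (Fin n → Ω) → ℝ} {g : Fin n → (Fin n → Ω) → ℝ}, Measurable f →
    (∀ i, Measurable (g i)) → (∀ x, |f x| ≤ C) → (∀ i x, |g i x| ≤ C) →
    (∀ i, DependsOn (g i) {i}ᶜ) →
    ∫ x, (f x - ∫ z, f z ∂(Measure.pi fun _ => μ)) ^ 2 ∂(Measure.pi fun _ => μ)
      ≤ ∑ i, ∫ x, (f x - g i x) ^ 2 ∂(Measure.pi fun _ => μ)
  | 0, f, g, hf, hg, hfC, hgC, hd => by
      have h : ∀ x, f x = f default := fun x => by rw [Subsingleton.elim x default]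
      simp [h]
  | n + 1, f, g, hf, hg, hfC, hgC, hd => by
      have : Nonempty Ω := nonempty_of_isProbabilityMeasure μ
      have mcons : ∀ y : Fin n → Ω, Measurable fun x : Ω => (Fin.cons x y : Fin (n + 1) → Ω) :=
        fun y => measurable_fin_cons.comp measurable_prodMk_right
      have slice : ∀ {φ : (Fin (n + 1) → Ω) → ℝ}, Measurable φ → ∀ y : Fin n → Ω,
          Measurable fun x : Ω => φ (Fin.cons x y) := fun {φ} hφ y => hφ.comp (mcons y)
      have mean : ∀ {φ : (Fin (n + 1) → Ω) → ℝ}, Measurable φ →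
          Measurable fun y : Fin n → Ω => ∫ x, φ (Fin.cons x y) ∂μ := fun {φ} hφ =>
        ((hφ.comp measurable_fin_cons).stronglyMeasurable.integral_prod_left').measurable
      have bd : ∀ {φ : (Fin (n + 1) → Ω) → ℝ} {D : ℝ}, (∀ x, |φ x| ≤ D) →
          ∀ y : Fin n → Ω, |∫ x, φ (Fin.cons x y) ∂μ| ≤ D := fun {φ D} hφ y => by
        have := norm_integral_le_of_norm_le_const (μ := μ) (f := fun x => φ (Fin.cons x y))
          (C := D) (Eventually.of_forall fun x => hφ _)
        simpa using this
      have sqbd : ∀ {u v : ℝ}, |u| ≤ C → |v| ≤ C → |(u - v) ^ 2| ≤ (2 * C) ^ 2 := by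
        intro u v hu hv
        rw [abs_pow]
        exact pow_le_pow_left₀ (abs_nonneg _) ((abs_sub _ _).trans (by linarith)) 2
      set F : (Fin n → Ω) → ℝ := fun y => ∫ x, f (Fin.cons x y) ∂μ with hF
      set c := ∫ z, f z ∂(Measure.pi fun _ => μ) with hc
      have hcF : c = ∫ y, F y ∂(Measure.pi fun _ => μ) := integral_pi_fin_succ μ hf hfC
      have hcC : |c| ≤ C := by
        have := norm_integral_le_of_norm_le_const (μ := Measure.pi fun _ : Fin (n + 1) => μ)
          (f := f) (C := C) (Eventually.of_forall hfC)
        simpa using this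
      have IH := efronStein_fin μ (C := C) n (f := F)
        (g := fun i y => ∫ x, g i.succ (Fin.cons x y) ∂μ) (mean hf) (fun i => mean (hg _))
        (bd hfC) (fun i => bd (hgC _)) (fun i y y' h => by
          refine integral_congr_ae (Eventually.of_forall fun x => ?_)
          refine hd i.succ fun j hj => ?_
          induction j using Fin.cases with
          | zero => rfl
          | succ j =>
            simp only [Fin.cons_succ]
            refine h j ?_
            intro hji
            exact hj (by rw [Set.mem_singleton_iff] at hji ⊢; rw [hji]))
      rw [← hcF] at IH
      have split : ∀ {φ : (Fin (n + 1) → Ω) → ℝ}, Measurable φ → (∀ x, |φ x| ≤ C) →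
          ∫ x, (f x - φ x) ^ 2 ∂(Measure.pi fun _ => μ)
            = ∫ y, ∫ x, (f (Fin.cons x y) - φ (Fin.cons x y)) ^ 2 ∂μ
              ∂(Measure.pi fun _ : Fin n => μ) := fun {φ} hφ hφC =>
        integral_pi_fin_succ μ (f := fun x => (f x - φ x) ^ 2) ((hf.sub hφ).pow_const 2)
          (fun x => sqbd (hfC x) (hφC x))
      rw [Fin.sum_univ_succ, split (φ := fun _ => c) measurable_const (fun _ => hcC)]
      have hint : ∀ {φ : (Fin (n + 1) → Ω) → ℝ}, Measurable φ → (∀ x, |φ x| ≤ C) →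
          Integrable (fun y : Fin n → Ω => ∫ x, (f (Fin.cons x y) - φ (Fin.cons x y)) ^ 2 ∂μ)
            (Measure.pi fun _ => μ) := fun {φ} hφ hφC =>
        integrable_of_bounded (mean ((hf.sub hφ).pow_const 2))
          (bd (φ := fun x => (f x - φ x) ^ 2) fun x => sqbd (hfC _) (hφC _))
      have hintF : Integrable (fun y : Fin n → Ω => (F y - c) ^ 2) (Measure.pi fun _ => μ) :=
        integrable_of_bounded (((mean hf).sub measurable_const).pow_const 2)
          (fun y => sqbd (bd hfC y) hcC)
      calc ∫ y, ∫ x, (f (Fin.cons x y) - c) ^ 2 ∂μ ∂(Measure.pi fun _ : Fin n => μ)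
          ≤ ∫ y, ((∫ x, (f (Fin.cons x y) - g 0 (Fin.cons x y)) ^ 2 ∂μ) + (F y - c) ^ 2)
              ∂(Measure.pi fun _ : Fin n => μ) := by
            refine integral_mono (hint measurable_const fun _ => hcC)
              ((hint (hg 0) (hgC 0)).add hintF) fun y => ?_
            simp only
            rw [integral_sub_sq_eq μ (slice hf y) (fun x => hfC _) c]
            -- With y fixed, `g 0` is constant in the first variable, so its squared distance to the
            -- slice of f is at least the variance of that slice.
            have hg0 : ∀ x, g 0 (Fin.cons x y) = g 0 (Fin.cons (Classical.arbitrary Ω) y) := by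
              intro x
              refine hd 0 fun j hj => ?_
              induction j using Fin.cases with
              | zero => exact absurd rfl hj
              | succ j => rfl
            simp only [hg0]
            have := integral_sub_sq_eq μ (slice hf y) (fun x => hfC _)
              (g 0 (Fin.cons (Classical.arbitrary Ω) y))
            rw [this]
            have h0 := sq_nonneg ((∫ z, f (Fin.cons z y) ∂μ)
              - g 0 (Fin.cons (Classical.arbitrary Ω) y))
            simp only [hF]
            linarith
        _ = ∫ x, (f x - g 0 x) ^ 2 ∂(Measure.pi fun _ => μ)
              + ∫ y, (F y - c) ^ 2 ∂(Measure.pi fun _ : Fin n => μ) := by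
            rw [integral_add (hint (hg 0) (hgC 0)) hintF, split (hg 0) (hgC 0)]
        _ ≤ _ := by
            -- By Jensen's inequality, averaging over the first variable can only decrease the mean
            -- square distance between f and `g i.succ`.
            refine add_le_add le_rfl (IH.trans (Finset.sum_le_sum fun i _ => ?_))
            rw [split (hg i.succ) (hgC i.succ)]
            refine integral_mono (integrable_of_bounded
              (((mean hf).sub (mean (hg _))).pow_const 2)
              (fun y => sqbd (bd hfC y) (bd (hgC _) y))) (hint (hg _) (hgC _)) fun y => ?_
            simp only [hF]
            rw [← integral_sub (integrable_of_bounded (slice hf y) fun x => hfC _)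
              (integrable_of_bounded (slice (hg i.succ) y) fun x => hgC _ _)]
            exact sq_integral_le μ ((slice hf y).sub (slice (hg i.succ) y))
              (C := 2 * C) (fun x => (abs_sub _ _).trans (by
                have := hfC (Fin.cons x y); have := hgC i.succ (Fin.cons x y)
                linarith))

/-- The Efron–Stein inequality: the variance of a function `f` of independent variables is at most
the sum over the variables of the mean square distance from `f` to any function that does not
depend on this variable. -/
lemma efronStein {ι : Type*} [Fintype ι] (μ : Measure Ω) [IsProbabilityMeasure μ] {C : ℝ}
    {f : (ι → Ω) → ℝ} {g : ι → (ι → Ω) → ℝ} (hf : Measurable f) (hg : ∀ i, Measurable (g i))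
    (hfC : ∀ x, |f x| ≤ C) (hgC : ∀ i x, |g i x| ≤ C) (hd : ∀ i, DependsOn (g i) {i}ᶜ) :
    ∫ x, (f x - ∫ z, f z ∂(Measure.pi fun _ => μ)) ^ 2 ∂(Measure.pi fun _ => μ)
      ≤ ∑ i, ∫ x, (f x - g i x) ^ 2 ∂(Measure.pi fun _ => μ) := by
  let e : Fin (Fintype.card ι) ≃ ι := (Fintype.equivFin ι).symm
  have mp := measurePreserving_piCongrLeft (fun _ : ι => μ) e
  set T := MeasurableEquiv.piCongrLeft (fun _ : ι => Ω) e with hT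
  have tr : ∀ φ : (ι → Ω) → ℝ, ∫ x, φ x ∂(Measure.pi fun _ => μ)
      = ∫ x, φ (T x) ∂(Measure.pi fun _ => μ) := fun φ =>
    (mp.integral_comp (MeasurableEquiv.measurableEmbedding _) φ).symm
  have hTe : ∀ x i, T x (e i) = x i := fun x i =>
    MeasurableEquiv.piCongrLeft_apply_apply (e := e) (β := fun _ => Ω) x i
  have := efronStein_fin μ (C := C) (Fintype.card ι) (f := fun x => f (T x))
    (g := fun i x => g (e i) (T x)) (hf.comp T.measurable) (fun i => (hg _).comp T.measurable)
    (fun x => hfC _) (fun i x => hgC _ _) (fun i x x' h => by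
      refine hd (e i) fun j hj => ?_
      obtain ⟨k, rfl⟩ := e.surjective j
      rw [hTe, hTe]
      exact h k fun hk => hj (by rw [Set.mem_singleton_iff] at hk ⊢; rw [hk]))
  rw [tr f, tr]
  simp only [tr (fun x => (f x - g _ x) ^ 2)]
  refine this.trans (le_of_eq ?_)
  exact Equiv.sum_comp e fun i => ∫ x, (f (T x) - g i (T x)) ^ 2 ∂(Measure.pi fun _ => μ)

end EfronStein

/-! ### The Poincaré inequality on the hypercube -/

section Poincare

/-- The neighbour of `x` that differs from it in the coordinate `i`. -/
def flip {N : ℕ} (i : Fin N) (x : V N) : V N := Function.update x i (!x i)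

lemma flip_flip {N : ℕ} (i : Fin N) (x : V N) : flip i (flip i x) = x := by
  simp [flip]

lemma eq_or_eq_flip {N : ℕ} {i : Fin N} {x x' : V N} (h : ∀ j ∈ ({i}ᶜ : Set (Fin N)), x j = x' j) :
    x' = x ∨ x' = flip i x := by
  by_cases hi : x' i = x i
  · left
    funext j
    by_cases hj : j = i
    · rw [hj, hi]
    · exact (h j hj).symm
  · right
    funext j
    by_cases hj : j = i
    · subst hj
      simp only [flip, Function.update_self]
      cases h1 : x' j <;> cases h2 : x j <;> simp_all
    · simp only [flip, Function.update_of_ne hj]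
      exact (h j hj).symm

lemma card_V (N : ℕ) : (Fintype.card (V N) : ℝ) = 2 ^ N := by simp

/-- Efron–Stein for N uniform bits, approximating f in the direction i by its mean over the two
values of the i-th bit. The factor 4 is the square of the 1/2 in that mean. -/
lemma poincare {N : ℕ} (f : V N → ℝ) (hf : ∑ x, f x = 0) :
    4 * ∑ x, f x ^ 2 ≤ ∑ x, ∑ i, (f x - f (flip i x)) ^ 2 := by
  let μ : Measure Bool := (PMF.uniformOfFintype Bool).toMeasure
  have hμ : ∀ x : V N, (Measure.pi fun _ : Fin N => μ).real {x} = ((2 : ℝ) ^ N)⁻¹ := by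
    intro x
    rw [Measure.real, Measure.pi_singleton]
    simp [μ]
  have hint : ∀ φ : V N → ℝ, ∫ x, φ x ∂(Measure.pi fun _ : Fin N => μ)
      = ((2 : ℝ) ^ N)⁻¹ * ∑ x, φ x := by
    intro φ
    rw [integral_fintype (Integrable.of_finite)]
    simp only [hμ, smul_eq_mul, Finset.mul_sum]
  have hb : ∀ x, |f x| ≤ ∑ x, |f x| := fun x =>
    Finset.single_le_sum (f := fun x => |f x|) (fun _ _ => abs_nonneg _) (Finset.mem_univ x)
  have h := efronStein μ (C := ∑ x, |f x|) (f := f)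
    (g := fun i x => (f x + f (flip i x)) / 2) (measurable_of_finite f)
    (fun i => measurable_of_finite _) hb
    (fun i x => by
      rw [abs_div, abs_two]
      have := abs_add_le (f x) (f (flip i x))
      have := hb x; have := hb (flip i x)
      linarith)
    (fun i x x' hxx => by
      rcases eq_or_eq_flip hxx with h | h
      · rw [h]
      · simp only [h, flip_flip, add_comm])
  simp only [hint, hf, mul_zero, sub_zero] at h
  rw [← Finset.mul_sum] at h
  have h' := le_of_mul_le_mul_left h (by positivity)
  rw [Finset.sum_comm] at h'
  have e : ∀ x i, (f x - (f x + f (flip i x)) / 2) ^ 2 = (f x - f (flip i x)) ^ 2 / 4 :=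
    fun x i => by ring
  simp only [e, ← Finset.sum_div] at h'
  linarith

end Poincare

/-! ### The discretized walk on the hypercube -/

section Kernel

variable {N : ℕ}

lemma hammingDist_flip (i : Fin N) (x : V N) : hammingDist x (flip i x) = 1 := by
  rw [hammingDist, Finset.card_eq_one]
  refine ⟨i, Finset.ext fun j => ?_⟩
  have key : x j ≠ flip i x j ↔ j = i := by
    by_cases h : j = i
    · subst h; simp [flip]
    · simp [flip, h]
  simpa using key

lemma exists_flip {x y : V N} (h : hammingDist x y = 1) : ∃ i, y = flip i x := by
  rw [hammingDist, Finset.card_eq_one] at h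
  obtain ⟨i, hi⟩ := h
  have key : ∀ j, x j ≠ y j ↔ j = i := fun j => by
    simpa using Finset.ext_iff.1 hi j
  refine ⟨i, ?_⟩
  rcases eq_or_eq_flip (i := i) (x := x) (x' := y) (fun j hj => by
    by_contra hne; exact hj ((key j).1 hne)) with h | h
  · exact absurd (congrFun h i).symm ((key i).2 rfl)
  · exact h

lemma flip_injective (x : V N) : Function.Injective fun i => flip i x := by
  intro i j h
  by_contra hij
  have := congrFun h i
  simp [flip, Function.update_of_ne hij] at this

lemma sum_neighbours (x : V N) (f : V N → ℝ) :
    ∑ y, (if hammingDist x y = 1 then f y else 0) = ∑ i, f (flip i x) := by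
  rw [← Finset.sum_filter]
  refine Finset.sum_bij' (i := fun y hy => (exists_flip (Finset.mem_filter.1 hy).2).choose)
    (j := fun i _ => flip i x) (fun _ _ => Finset.mem_univ _)
    (fun i _ => by simp [hammingDist_flip]) (fun y hy => ?_) (fun i hi => ?_) (fun y hy => ?_)
  · exact (exists_flip (Finset.mem_filter.1 hy).2).choose_spec.symm
  · exact flip_injective x (exists_flip (x := x) (y := flip i x)
      (by simp [hammingDist_flip])).choose_spec.symm
  · rw [← (exists_flip (Finset.mem_filter.1 hy).2).choose_spec]

/-- Probability that the walk with time step `1 / q` jumps from `x` to `y`, capped so as to be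
small in all environments. -/
def stepRate (a : ℝ) (e : V N → ℝ) (q : ℕ) (x y : V N) : ℝ :=
  min (rate a e x y / q) (1 / (2 * N))

/-- Transition matrix of the walk with time step `1 / q`. -/
def stepKernel (a : ℝ) (e : V N → ℝ) (q : ℕ) : Matrix (V N) (V N) ℝ :=
  Matrix.of fun x y => if x = y then 1 - ∑ z, stepRate a e q x z else stepRate a e q x y

lemma rate_nonneg (a : ℝ) (e : V N → ℝ) (x y : V N) : 0 ≤ rate a e x y := by
  unfold rate; split_ifs <;> positivity

lemma rate_symm (a : ℝ) (e : V N → ℝ) (x y : V N) : rate a e x y = rate a e y x := by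
  simp only [rate, hammingDist_comm x y, add_comm (e x)]

lemma rate_self (a : ℝ) (e : V N → ℝ) (x : V N) : rate a e x x = 0 := by
  simp [rate]

lemma stepRate_nonneg (a : ℝ) (e : V N → ℝ) (q : ℕ) (x y : V N) : 0 ≤ stepRate a e q x y :=
  le_min (div_nonneg (rate_nonneg a e x y) (by positivity)) (by positivity)

lemma stepRate_symm (a : ℝ) (e : V N → ℝ) (q : ℕ) (x y : V N) :
    stepRate a e q x y = stepRate a e q y x := by
  simp only [stepRate, rate_symm a e x y]

lemma stepRate_eq_zero (a : ℝ) (e : V N → ℝ) (q : ℕ) {x y : V N} (h : hammingDist x y ≠ 1) :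
    stepRate a e q x y = 0 := by
  simp only [stepRate, rate, h, if_false, zero_div]
  exact min_eq_left (by positivity)

lemma sum_stepRate_le (a : ℝ) (e : V N → ℝ) (q : ℕ) (x : V N) :
    ∑ z, stepRate a e q x z ≤ 1 / 2 := by
  calc ∑ z, stepRate a e q x z
      ≤ ∑ z, (if hammingDist x z = 1 then (1 / (2 * N) : ℝ) else 0) := by
        refine Finset.sum_le_sum fun z _ => ?_
        split_ifs with h
        · exact min_le_right _ _
        · exact (stepRate_eq_zero a e q h).le
    _ = N * (1 / (2 * N)) := by rw [sum_neighbours]; simp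
    _ ≤ 1 / 2 := by
        rcases Nat.eq_zero_or_pos N with rfl | h
        · norm_num
        · have : (0 : ℝ) < N := by exact_mod_cast h
          exact le_of_eq (by field_simp)

lemma stepKernel_self (a : ℝ) (e : V N → ℝ) (q : ℕ) (x : V N) :
    stepKernel a e q x x = 1 - ∑ z, stepRate a e q x z := by simp [stepKernel]

lemma stepKernel_of_ne (a : ℝ) (e : V N → ℝ) (q : ℕ) {x y : V N} (h : x ≠ y) :
    stepKernel a e q x y = stepRate a e q x y := by simp [stepKernel, h]

lemma stepRate_self (a : ℝ) (e : V N → ℝ) (q : ℕ) (x : V N) : stepRate a e q x x = 0 :=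
  stepRate_eq_zero a e q (by simp)

lemma half_le_stepKernel_self (a : ℝ) (e : V N → ℝ) (q : ℕ) (x : V N) :
    1 / 2 ≤ stepKernel a e q x x := by
  rw [stepKernel_self]
  linarith [sum_stepRate_le a e q x]

lemma escape_stepKernel (a : ℝ) (e : V N → ℝ) (q : ℕ) (x : V N) :
    escape (stepKernel a e q) x = ∑ z, stepRate a e q x z := by
  refine Finset.sum_congr rfl fun z _ => ?_
  split_ifs with h
  · rw [← h, stepRate_self]
  · exact stepKernel_of_ne a e q h

lemma isSymmStochastic_stepKernel (a : ℝ) (e : V N → ℝ) (q : ℕ) :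
    IsSymmStochastic (stepKernel a e q) where
  nonneg x y := by
    by_cases h : x = y
    · subst h
      linarith [half_le_stepKernel_self a e q x]
    · rw [stepKernel_of_ne a e q h]
      exact stepRate_nonneg a e q x y
  row_sum x := by
    have h : ∀ y, stepKernel a e q x y
        = stepRate a e q x y + if x = y then 1 - ∑ z, stepRate a e q x z else 0 := by
      intro y
      by_cases h : x = y
      · subst h; simp [stepKernel_self, stepRate_self]
      · simp [stepKernel_of_ne a e q h, h]
    simp [h, Finset.sum_add_distrib]
  symm x y := by
    by_cases h : x = y
    · rw [h]
    · rw [stepKernel_of_ne a e q h, stepKernel_of_ne a e q (Ne.symm h), stepRate_symm]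

lemma escape_stepKernel_le (a : ℝ) (e : V N → ℝ) (q : ℕ) (x : V N) :
    escape (stepKernel a e q) x ≤ (∑ z, rate a e x z) / q := by
  rw [escape_stepKernel, Finset.sum_div]
  exact Finset.sum_le_sum fun z _ => min_le_left _ _

lemma measurable_rate (a : ℝ) (x y : V N) : Measurable fun e : V N → ℝ => rate a e x y := by
  unfold rate
  split_ifs
  · fun_prop
  · exact measurable_const

lemma measurable_stepKernel (a : ℝ) (q : ℕ) (x y : V N) :
    Measurable fun e : V N → ℝ => stepKernel a e q x y := by
  have h : ∀ x y, Measurable fun e : V N → ℝ => stepRate a e q x y := fun x y =>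
    ((measurable_rate a x y).div_const _).min measurable_const
  by_cases hxy : x = y
  · subst hxy
    simp only [stepKernel_self]
    exact measurable_const.sub (Finset.measurable_sum _ fun z _ => h x z)
  · simp only [stepKernel_of_ne a _ q hxy]
    exact h x y

/-- The kernel only feels the environment near its starting point. -/
lemma stepKernel_eq_of_far (a : ℝ) {e e' : V N → ℝ} (q : ℕ) {y : V N}
    (he : ∀ z, z ≠ y → e z = e' z) {x : V N} (hx : ¬ hammingDist x y ≤ 1) (z : V N) :
    stepKernel a e q x z = stepKernel a e' q x z := by
  have hxy : x ≠ y := fun h => hx (by simp [h])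
  have hr : ∀ z, stepRate a e q x z = stepRate a e' q x z := by
    intro z
    by_cases h : hammingDist x z = 1
    · have hzy : z ≠ y := fun h' => hx (by rw [← h', h])
      simp only [stepRate, rate, he x hxy, he z hzy]
    · rw [stepRate_eq_zero a e q h, stepRate_eq_zero a e' q h]
  simp only [stepKernel, hr, Matrix.of_apply]

end Kernel

/-! ### Mixing -/

section Mixing

/-- Laziness makes B = 2A - 1 symmetric stochastic, hence a contraction in mean square. Expanding
|Bf|² ≤ |f|² gives the claim, so a bound on the quadratic form of A suffices for contraction without
looking at negative eigenvalues. -/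
lemma sum_mulVec_sq_le_of_lazy {S : Type*} [Fintype S] [DecidableEq S] {A : Matrix S S ℝ}
    (hA : IsSymmStochastic A) (hlazy : ∀ x, 1 / 2 ≤ A x x) (f : S → ℝ) :
    ∑ x, (A.mulVec f x) ^ 2 ≤ ∑ x, f x * A.mulVec f x := by
  let B : Matrix S S ℝ := fun x y => 2 * A x y - if x = y then 1 else 0
  have hB : IsSymmStochastic B := by
    refine ⟨fun x y => ?_, fun x => ?_, fun x y => ?_⟩
    · simp only [B]
      split_ifs with h
      · subst h; linarith [hlazy x]
      · linarith [hA.nonneg x y]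
    · simp only [B, Finset.sum_sub_distrib, ← Finset.mul_sum, hA.row_sum]
      simp; norm_num
    · simp only [B, hA.symm x y, eq_comm]
  have e : ∀ x, B.mulVec f x = 2 * A.mulVec f x - f x := by
    intro x
    simp only [B, Matrix.mulVec, dotProduct, sub_mul, Finset.sum_sub_distrib, Finset.mul_sum]
    simp [mul_assoc]
  have h1 : ∑ x, (B.mulVec f x) ^ 2 ≤ ∑ x, f x ^ 2 := by
    rw [← hB.sum_mulVec fun x => f x ^ 2]
    exact Finset.sum_le_sum fun x _ => Real.pow_arith_mean_le_arith_mean_pow_of_even _ _ _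
      (fun y _ => hB.nonneg x y) (hB.row_sum x) even_two
  have h2 : ∑ x, (B.mulVec f x) ^ 2
      = 4 * ∑ x, (A.mulVec f x) ^ 2 - 4 * ∑ x, f x * A.mulVec f x + ∑ x, f x ^ 2 := by
    simp only [e, Finset.mul_sum]
    rw [← Finset.sum_sub_distrib, ← Finset.sum_add_distrib]
    exact Finset.sum_congr rfl fun x _ => by ring
  linarith

lemma sum_sq_sub_sum_mul_mulVec {S : Type*} [Fintype S] [DecidableEq S] {A : Matrix S S ℝ}
    (hA : IsSymmStochastic A) (f : S → ℝ) :
    ∑ x, ∑ y, A x y * (f x - f y) ^ 2 = 2 * (∑ x, f x ^ 2 - ∑ x, f x * A.mulVec f x) := by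
  have e : ∀ x, ∑ y, A x y * (f x - f y) ^ 2
      = f x ^ 2 - 2 * (f x * A.mulVec f x) + A.mulVec (fun y => f y ^ 2) x := by
    intro x
    have h1 : f x ^ 2 = ∑ y, A x y * f x ^ 2 := by rw [← Finset.sum_mul, hA.row_sum, one_mul]
    rw [h1]
    simp only [Matrix.mulVec, dotProduct, Finset.mul_sum]
    rw [← Finset.sum_sub_distrib, ← Finset.sum_add_distrib]
    exact Finset.sum_congr rfl fun y _ => by ring
  simp only [e, Finset.sum_add_distrib, Finset.sum_sub_distrib, hA.sum_mulVec, ← Finset.mul_sum]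
  ring

variable {N : ℕ}

/-- The Dirichlet form of the chain dominates 1/q times that of the simple random walk on the cube,
to which the Poincaré inequality applies. -/
lemma sum_stepKernel_mulVec_sq_le {a : ℝ} {e : V N → ℝ} (hN : 1 ≤ N) {q : ℕ} (hq : 2 * N ≤ q)
    (hrate : ∀ x y, hammingDist x y = 1 → 1 ≤ rate a e x y) (f : V N → ℝ) (hf : ∑ x, f x = 0) :
    ∑ x, ((stepKernel a e q).mulVec f x) ^ 2 ≤ (1 - 2 / q) * ∑ x, f x ^ 2 := by
  have hA := isSymmStochastic_stepKernel a e q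
  have hN' : (0 : ℝ) < N := by exact_mod_cast hN
  have hq' : (2 * N : ℝ) ≤ q := by exact_mod_cast hq
  have hq0 : (0 : ℝ) < q := by linarith
  refine (sum_mulVec_sq_le_of_lazy hA (half_le_stepKernel_self a e q) f).trans ?_
  have h1 := sum_sq_sub_sum_mul_mulVec hA f
  have h2 : ∑ x, ∑ i, (f x - f (flip i x)) ^ 2 / q
      ≤ ∑ x, ∑ y, stepKernel a e q x y * (f x - f y) ^ 2 := by
    refine Finset.sum_le_sum fun x _ => ?_
    rw [← sum_neighbours x fun y => (f x - f y) ^ 2 / q]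
    refine Finset.sum_le_sum fun y _ => ?_
    split_ifs with h
    · have hxy : x ≠ y := fun h' => by simp [h'] at h
      rw [stepKernel_of_ne a e q hxy, div_eq_inv_mul]
      -- Both terms of the minimum are at least 1/q: the first because rates are at least 1, the cap
      -- because 2N ≤ q.
      refine mul_le_mul_of_nonneg_right (le_min ?_ ?_) (sq_nonneg _)
      · rw [← one_div]
        exact div_le_div_of_nonneg_right (hrate x y h) hq0.le
      · rw [← one_div]
        exact one_div_le_one_div_of_le (by positivity) hq'
    · exact mul_nonneg (hA.nonneg x y) (sq_nonneg _)
  have h3 := poincare f hf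
  simp only [← Finset.sum_div] at h2
  have h4 : 4 * (∑ x, f x ^ 2) / q ≤ (∑ x, ∑ i, (f x - f (flip i x)) ^ 2) / q :=
    div_le_div_of_nonneg_right h3 hq0.le
  have e5 : 4 * (∑ x, f x ^ 2) / q = 2 * (2 / q * ∑ x, f x ^ 2) := by ring
  linarith

lemma sum_stepKernel_pow_mulVec_sq_le {a : ℝ} {e : V N → ℝ} (hN : 1 ≤ N) {q : ℕ}
    (hq : 2 * N ≤ q) (hrate : ∀ x y, hammingDist x y = 1 → 1 ≤ rate a e x y) (f : V N → ℝ)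
    (hf : ∑ x, f x = 0) (m : ℕ) :
    ∑ x, ((stepKernel a e q ^ m).mulVec f x) ^ 2 ≤ (1 - 2 / q) ^ m * ∑ x, f x ^ 2 := by
  have hA := isSymmStochastic_stepKernel a e q
  have hN' : (1 : ℝ) ≤ N := by exact_mod_cast hN
  have hq' : (2 * N : ℝ) ≤ q := by exact_mod_cast hq
  have h0 : (0 : ℝ) ≤ 1 - 2 / q := by
    rw [sub_nonneg, div_le_one (by linarith)]
    linarith
  induction m with
  | zero => simp
  | succ m ih =>
    simp only [pow_succ' (stepKernel a e q), ← Matrix.mulVec_mulVec]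
    refine (sum_stepKernel_mulVec_sq_le hN hq hrate _ (by rw [(hA.pow m).sum_mulVec, hf])).trans ?_
    refine (mul_le_mul_of_nonneg_left ih h0).trans (le_of_eq ?_)
    ring

/-- After a time `2 N` the law of the walk is uniform, up to a factor `1 + 2 ^ (-N)`. -/
lemma stepKernel_pow_le {a : ℝ} {e : V N → ℝ} (hN : 1 ≤ N) {q : ℕ} (hq : 2 * N ≤ q)
    (hrate : ∀ x y, hammingDist x y = 1 → 1 ≤ rate a e x y) {m : ℕ} (hm : 2 * N * q ≤ m)
    (x y : V N) : (stepKernel a e q ^ m) x y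
      ≤ (Fintype.card (V N) : ℝ)⁻¹ * (1 + ((2 : ℝ) ^ N)⁻¹) := by
  have hA := isSymmStochastic_stepKernel a e q
  have hN' : (1 : ℝ) ≤ N := by exact_mod_cast hN
  have hq' : (2 * N : ℝ) ≤ q := by exact_mod_cast hq
  have hq0 : (0 : ℝ) < q := by linarith
  have hm' : (2 * N * q : ℝ) ≤ m := by exact_mod_cast hm
  rw [card_V]
  set c : ℝ := (2 : ℝ) ^ N with hc
  have hc0 : 0 < c := by positivity
  have hc1 : 1 ≤ c := one_le_pow₀ (by norm_num)
  -- The point mass at y, centred so that the contraction applies; `A ^ m` maps it to the deviation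
  -- of the entries in column y from uniformity.
  let f : V N → ℝ := fun z => (if z = y then 1 else 0) - c⁻¹
  have hf : ∑ z, f z = 0 := by
    simp only [f, Finset.sum_sub_distrib]
    simp [hc]
  have hf2 : ∑ z, f z ^ 2 ≤ 1 := by
    have : ∀ z, f z ^ 2 = (if z = y then 1 - 2 * c⁻¹ else 0) + (c⁻¹) ^ 2 := fun z => by
      simp only [f]; split_ifs <;> ring
    simp only [this, Finset.sum_add_distrib]
    simp only [Finset.sum_ite_eq', Finset.mem_univ, if_true, Finset.sum_const, Finset.card_univ,
      nsmul_eq_mul, card_V]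
    rw [← hc, pow_two, ← mul_assoc, mul_inv_cancel₀ hc0.ne']
    have : 0 < c⁻¹ := by positivity
    linarith
  have hent : (stepKernel a e q ^ m).mulVec f x = (stepKernel a e q ^ m) x y - c⁻¹ := by
    simp only [Matrix.mulVec, dotProduct, f, mul_sub, Finset.sum_sub_distrib, ← Finset.sum_mul,
      (hA.pow m).row_sum, one_mul]
    simp
  have h1 := sum_stepKernel_pow_mulVec_sq_le hN hq hrate f hf m
  have h2 := Finset.single_le_sum (f := fun x => ((stepKernel a e q ^ m).mulVec f x) ^ 2)
    (fun x _ => sq_nonneg _) (Finset.mem_univ x)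
  simp only [hent] at h2
  have h0 : (0 : ℝ) ≤ 1 - 2 / q := by
    rw [sub_nonneg, div_le_one hq0]
    linarith
  -- For m ≥ 2Nq the squared norm has shrunk by e^(-4N) ≤ 2^(-4N). Its square root is 2^(-2N), which
  -- is 2^(-N) relative to the uniform weight.
  have h3 : (1 - 2 / q : ℝ) ^ m ≤ (c⁻¹ * c⁻¹) ^ 2 := by
    calc (1 - 2 / q : ℝ) ^ m ≤ (Real.exp (-(2 / q))) ^ m :=
          pow_le_pow_left₀ h0 (by linarith [Real.add_one_le_exp (-(2 / q : ℝ))]) m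
      _ = Real.exp (-(2 * m / q)) := by rw [← Real.exp_nat_mul]; congr 1; ring
      _ ≤ Real.exp (-(4 * N)) := by
          refine Real.exp_le_exp.2 (neg_le_neg ?_)
          rw [le_div_iff₀ hq0]
          linarith
      _ = (Real.exp (-1) ^ N) ^ 4 := by rw [← Real.exp_nat_mul, ← Real.exp_nat_mul]; ring_nf
      _ ≤ ((2⁻¹ : ℝ) ^ N) ^ 4 := by
          refine pow_le_pow_left₀ (by positivity) (pow_le_pow_left₀ (by positivity) ?_ N) 4
          rw [Real.exp_neg]
          exact inv_anti₀ (by norm_num) (by linarith [Real.add_one_le_exp (1 : ℝ)])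
      _ = (c⁻¹ * c⁻¹) ^ 2 := by rw [inv_pow]; ring
  have h4 : ((stepKernel a e q ^ m) x y - c⁻¹) ^ 2 ≤ (c⁻¹ * c⁻¹) ^ 2 := by
    refine h2.trans (h1.trans (le_trans ?_ h3))
    exact mul_le_of_le_one_right (pow_nonneg h0 m) hf2
  have h5 := abs_le_of_sq_le_sq h4 (by positivity)
  have := (abs_le.1 h5).2
  rw [mul_add, mul_one]
  linarith

end Mixing

/-! ### The number of discovered sites along a discrete path -/

section Discovery

variable {N : ℕ}

/-- The sites at distance at most `1` from `y`. -/
def ball (y : V N) : Finset (V N) := Finset.univ.filter fun z => hammingDist z y ≤ 1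

open Classical in
/-- Indicator of the discovery of `x` in the first `n` steps. -/
def seen (x : V N) (n : ℕ) (ω : ℕ → V N) : ℝ := if ∃ i ≤ n, hammingDist (ω i) x ≤ 1 then 1 else 0

/-- The number of sites discovered in the first `n` steps. -/
def discCount (n : ℕ) (ω : ℕ → V N) : ℝ := ∑ x, seen x n ω

lemma mem_ball {y z : V N} : z ∈ ball y ↔ hammingDist z y ≤ 1 := by simp [ball]

lemma mem_ball_comm {y z : V N} : z ∈ ball y ↔ y ∈ ball z := by
  rw [mem_ball, mem_ball, hammingDist_comm]

lemma card_ball (y : V N) : ((ball y).card : ℝ) = N + 1 := by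
  have h : ((ball y).card : ℝ)
      = ∑ z, ((if hammingDist y z = 1 then (1 : ℝ) else 0) + if z = y then 1 else 0) := by
    rw [Finset.card_eq_sum_ones, ball, Finset.sum_filter]
    push_cast
    refine Finset.sum_congr rfl fun z _ => ?_
    rw [hammingDist_comm z y]
    by_cases hz : z = y
    · subst hz; simp
    · have : hammingDist y z ≠ 0 := by rw [hammingDist_ne_zero]; exact Ne.symm hz
      have e : hammingDist y z ≤ 1 ↔ hammingDist y z = 1 := by omega
      simp [hz, e]
  rw [h, Finset.sum_add_distrib, sum_neighbours]
  simp

lemma sum_sum_ball (f : V N → ℝ) : ∑ y, ∑ z ∈ ball y, f z = (N + 1) * ∑ z, f z := by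
  have : ∀ y, ∑ z ∈ ball y, f z = ∑ z, if y ∈ ball z then f z else 0 := fun y => by
    rw [← Finset.sum_filter]
    refine Finset.sum_congr (Finset.ext fun z => ?_) fun _ _ => rfl
    rw [mem_ball_comm]; simp
  simp only [this]
  rw [Finset.sum_comm, Finset.mul_sum]
  refine Finset.sum_congr rfl fun z _ => ?_
  rw [← Finset.sum_filter, Finset.filter_mem_eq_inter, Finset.univ_inter, Finset.sum_const,
    nsmul_eq_mul, card_ball]

lemma sum_sq_sum_ball_le (f : V N → ℝ) :
    ∑ y, (∑ z ∈ ball y, f z) ^ 2 ≤ (N + 1) ^ 2 * ∑ z, f z ^ 2 := by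
  calc ∑ y, (∑ z ∈ ball y, f z) ^ 2 ≤ ∑ y, (N + 1) * ∑ z ∈ ball y, f z ^ 2 :=
        Finset.sum_le_sum fun y _ => by
          rw [← card_ball y]; exact sq_sum_le_card_mul_sum_sq
    _ = _ := by rw [← Finset.mul_sum, sum_sum_ball]; ring

lemma seen_nonneg (x : V N) (n : ℕ) (ω : ℕ → V N) : 0 ≤ seen x n ω := by
  unfold seen; split_ifs <;> norm_num

lemma seen_le_one (x : V N) (n : ℕ) (ω : ℕ → V N) : seen x n ω ≤ 1 := by
  unfold seen; split_ifs <;> norm_num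

lemma seen_eq_zero_or_one (x : V N) (n : ℕ) (ω : ℕ → V N) : seen x n ω = 0 ∨ seen x n ω = 1 := by
  unfold seen; split_ifs <;> simp

lemma seen_of_mem {x : V N} {n i : ℕ} {ω : ℕ → V N} (hi : i ≤ n) (h : hammingDist (ω i) x ≤ 1) :
    seen x n ω = 1 := if_pos ⟨i, hi, h⟩

lemma dependsOn_seen (x : V N) (n : ℕ) : DependsOn (seen x n) (Set.Iic n) := by
  intro ω ω' h
  have : (∃ i ≤ n, hammingDist (ω i) x ≤ 1) ↔ ∃ i ≤ n, hammingDist (ω' i) x ≤ 1 :=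
    exists_congr fun i => and_congr_right fun hi => by rw [h i hi]
  simp only [seen, this]

lemma dependsOn_discCount (n : ℕ) : DependsOn (discCount (N := N) n) (Set.Iic n) :=
  fun _ _ h => Finset.sum_congr rfl fun x _ => dependsOn_seen x n h

lemma discCount_nonneg (n : ℕ) (ω : ℕ → V N) : 0 ≤ discCount n ω :=
  Finset.sum_nonneg fun x _ => seen_nonneg x n ω

lemma discCount_le (n : ℕ) (ω : ℕ → V N) : discCount n ω ≤ 2 ^ N := by
  rw [← card_V]
  refine (Finset.sum_le_sum fun x _ => seen_le_one x n ω).trans ?_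
  simp

lemma seen_le_sum_hits (x : V N) (n : ℕ) (ω : ℕ → V N) :
    seen x n ω ≤ ∑ z ∈ ball x, hits z n ω := by
  have h0 : ∀ z ∈ ball x, 0 ≤ hits z n ω := fun z _ => hits_nonneg z n ω
  unfold seen
  split_ifs with h
  · obtain ⟨i, hi, h⟩ := h
    refine le_trans ?_ (Finset.single_le_sum h0 (mem_ball.2 h))
    unfold hits
    rw [if_pos ⟨i, hi, rfl⟩]
  · exact Finset.sum_nonneg h0

/-- Only the initial position and the endpoints of jumps can discover sites, at most N + 1 each. -/
lemma discCount_le_numJumps (n : ℕ) (ω : ℕ → V N) :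
    discCount n ω ≤ (N + 1) * (1 + numJumps n ω) := by
  have hb : ∀ i, ∑ x, (if x ∈ ball (ω i) then (1 : ℝ) else 0) = N + 1 := fun i => by
    rw [← card_ball (ω i), ← Finset.sum_filter]
    simp
  induction n with
  | zero =>
    simp only [numJumps, Finset.range_zero, Finset.sum_empty, add_zero, mul_one]
    rw [← hb 0]
    refine Finset.sum_le_sum fun x _ => ?_
    unfold seen
    split_ifs with h1 h2
    · exact le_rfl
    · obtain ⟨i, hi, h⟩ := h1
      obtain rfl : i = 0 := by omega
      exact absurd (mem_ball_comm.1 (mem_ball.2 h)) h2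
    · exact zero_le_one
    · exact le_rfl
  | succ n ih =>
    have h : discCount (n + 1) ω ≤ discCount n ω + jumpAt n ω * (N + 1) := by
      rw [← hb (n + 1), discCount, discCount, Finset.mul_sum, ← Finset.sum_add_distrib]
      refine Finset.sum_le_sum fun x _ => ?_
      have h0 := seen_nonneg x n ω
      have hj := jumpAt_nonneg n ω
      by_cases h1 : ∃ i ≤ n, hammingDist (ω i) x ≤ 1
      · have e : seen x n ω = 1 := if_pos h1
        have := seen_le_one x (n + 1) ω
        have : 0 ≤ jumpAt n ω * if x ∈ ball (ω (n + 1)) then (1 : ℝ) else 0 :=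
          mul_nonneg hj (by split_ifs <;> norm_num)
        linarith
      · by_cases h2 : hammingDist (ω (n + 1)) x ≤ 1
        · have hne : ω n ≠ ω (n + 1) := fun h => h1 ⟨n, le_rfl, by rw [h]; exact h2⟩
          have e : jumpAt n ω = 1 := if_neg hne
          rw [e, if_pos (mem_ball_comm.1 (mem_ball.2 h2))]
          linarith [seen_le_one x (n + 1) ω]
        · have e : seen x (n + 1) ω = 0 := if_neg fun ⟨i, hi, h⟩ => by
            rcases Nat.lt_or_ge n i with h' | h'
            · obtain rfl : i = n + 1 := by omega
              exact h2 h
            · exact h1 ⟨i, h', h⟩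
          have : 0 ≤ jumpAt n ω * if x ∈ ball (ω (n + 1)) then (1 : ℝ) else 0 :=
            mul_nonneg hj (by split_ifs <;> norm_num)
          linarith
    have e : numJumps (n + 1) ω = numJumps n ω + jumpAt n ω := Finset.sum_range_succ _ _
    rw [e]
    linarith

/-- The mean over the starting point of `(1 + 2 n ρ)^4`, for `ρ` the escape probability. -/
def escapeMoment (A : Matrix (V N) (V N) ℝ) (n : ℕ) : ℝ :=
  ((2 : ℝ) ^ N)⁻¹ * ∑ z, (1 + 2 * n * escape A z) ^ 4

/-- The mean of `1 + numJumps` on the event that `z` is visited. -/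
def jumpsAndHits (A : Matrix (V N) (V N) ℝ) (n : ℕ) (z : V N) : ℝ :=
  statExp A n fun ω => (1 + numJumps n ω) * hits z n ω

variable {A : Matrix (V N) (V N) ℝ}

lemma sum_jumpsAndHits_le (hA : IsSymmStochastic A) (n : ℕ) :
    ∑ z, jumpsAndHits A n z ≤ escapeMoment A n := by
  have h := sum_statExp_mul_hits_pow_le hA n 1
  simp only [pow_one, mul_one, ← Finset.mul_sum, card_V] at h
  have h2 : ∑ z, (1 + 2 * n * escape A z) ^ 2 ≤ ∑ z, (1 + 2 * n * escape A z) ^ 4 :=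
    Finset.sum_le_sum fun z _ => pow_le_pow_right₀
      (by have := escape_nonneg hA z
          have : 0 ≤ 2 * n * escape A z := by positivity
          linarith) (by norm_num)
  rw [escapeMoment, ← div_eq_inv_mul, le_div_iff₀ (by positivity), mul_comm]
  exact h.trans h2

/-- The prefactor 2^(-N) is essential: it makes both the overlap of two windows and the influence of
single energies on the mean negligible. -/
lemma sum_jumpsAndHits_sq_le (hA : IsSymmStochastic A) (n : ℕ) :
    ∑ z, jumpsAndHits A n z ^ 2 ≤ ((2 : ℝ) ^ N)⁻¹ * escapeMoment A n := by
  have h := sum_statExp_mul_hits_pow_le hA n 2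
  simp only [mul_pow, ← Finset.mul_sum, card_V] at h
  rw [escapeMoment, ← mul_assoc, ← mul_inv, ← pow_two, ← div_eq_inv_mul,
    le_div_iff₀ (by positivity), mul_comm]
  exact h

lemma statExp_seen_le (hA : IsSymmStochastic A) (n : ℕ) (x : V N) :
    statExp A n (seen x n) ≤ ∑ z ∈ ball x, jumpsAndHits A n z := by
  simp only [jumpsAndHits]
  rw [← statExp_sum]
  refine statExp_mono hA n fun ω => (seen_le_sum_hits x n ω).trans
    (Finset.sum_le_sum fun z _ => ?_)
  nlinarith [numJumps_nonneg n ω, hits_nonneg z n ω]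

lemma statExp_discCount_mul_seen_le (hA : IsSymmStochastic A) (n : ℕ) (x : V N) :
    statExp A n (fun ω => discCount n ω * seen x n ω)
      ≤ (N + 1) * ∑ z ∈ ball x, jumpsAndHits A n z := by
  simp only [jumpsAndHits]
  rw [← statExp_sum, ← statExp_const_mul]
  refine statExp_mono hA n fun ω => ?_
  calc discCount n ω * seen x n ω
      ≤ ((N + 1) * (1 + numJumps n ω)) * ∑ z ∈ ball x, hits z n ω :=
        mul_le_mul (discCount_le_numJumps n ω) (seen_le_sum_hits x n ω) (seen_nonneg x n ω)
          (mul_nonneg (by positivity) (by linarith [numJumps_nonneg n ω]))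
    _ = _ := by rw [mul_assoc, ← Finset.mul_sum]

lemma statExp_discCount_le (hA : IsSymmStochastic A) (n : ℕ) :
    statExp A n (discCount n) ≤ (N + 1) * escapeMoment A n := by
  unfold discCount
  rw [statExp_sum]
  refine (Finset.sum_le_sum fun x _ => statExp_seen_le hA n x).trans ?_
  rw [sum_sum_ball]
  exact mul_le_mul_of_nonneg_left (sum_jumpsAndHits_le hA n) (by positivity)

/-- One of the two factors is expanded as a sum over discovered sites, the other is bounded by the
number of jumps; this is the quantity `jumpsAndHits`. -/
lemma statExp_discCount_sq_le (hA : IsSymmStochastic A) (n : ℕ) :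
    statExp A n (fun ω => discCount n ω ^ 2) ≤ (N + 1) ^ 2 * escapeMoment A n := by
  have e : (fun ω : ℕ → V N => discCount n ω ^ 2)
      = fun ω => ∑ x, discCount n ω * seen x n ω := by
    funext ω
    rw [← Finset.mul_sum, pow_two]
    rfl
  rw [e, statExp_sum]
  refine (Finset.sum_le_sum fun x _ => statExp_discCount_mul_seen_le hA n x).trans ?_
  rw [← Finset.mul_sum, sum_sum_ball, pow_two, mul_assoc]
  gcongr
  exact sum_jumpsAndHits_le hA n

lemma sum_statExp_seen_sq_le (hA : IsSymmStochastic A) (n : ℕ) :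
    ∑ x, statExp A n (seen x n) ^ 2 ≤ (N + 1) ^ 2 * (((2 : ℝ) ^ N)⁻¹ * escapeMoment A n) := by
  calc ∑ x, statExp A n (seen x n) ^ 2
      ≤ ∑ x, (∑ z ∈ ball x, jumpsAndHits A n z) ^ 2 :=
        Finset.sum_le_sum fun x _ => pow_le_pow_left₀
          (statExp_nonneg hA n (seen_nonneg x n)) (statExp_seen_le hA n x) 2
    _ ≤ (N + 1) ^ 2 * ∑ z, jumpsAndHits A n z ^ 2 := sum_sq_sum_ball_le _
    _ ≤ _ := mul_le_mul_of_nonneg_left (sum_jumpsAndHits_sq_le hA n) (by positivity)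

lemma sum_statExp_discCount_mul_seen_sq_le (hA : IsSymmStochastic A) (n : ℕ) :
    ∑ x, statExp A n (fun ω => discCount n ω * seen x n ω) ^ 2
      ≤ (N + 1) ^ 4 * (((2 : ℝ) ^ N)⁻¹ * escapeMoment A n) := by
  calc ∑ x, statExp A n (fun ω => discCount n ω * seen x n ω) ^ 2
      ≤ ∑ x, ((N + 1) * ∑ z ∈ ball x, jumpsAndHits A n z) ^ 2 :=
        Finset.sum_le_sum fun x _ => pow_le_pow_left₀
          (statExp_nonneg hA n fun ω => mul_nonneg (discCount_nonneg n ω) (seen_nonneg x n ω))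
          (statExp_discCount_mul_seen_le hA n x) 2
    _ = (N + 1) ^ 2 * ∑ x, (∑ z ∈ ball x, jumpsAndHits A n z) ^ 2 := by
        rw [Finset.mul_sum]; exact Finset.sum_congr rfl fun x _ => by ring
    _ ≤ (N + 1) ^ 2 * ((N + 1) ^ 2 * (((2 : ℝ) ^ N)⁻¹ * escapeMoment A n)) := by
        gcongr
        exact (sum_sq_sum_ball_le _).trans
          (mul_le_mul_of_nonneg_left (sum_jumpsAndHits_sq_le hA n) (by positivity))
    _ = _ := by ring

/-! ### Decomposition into blocks -/

/-- The second Bonferroni inequality for indicators. -/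
lemma sum_sub_sum_pairs_le {s : ℕ → ℝ} (hs : ∀ k, s k = 0 ∨ s k = 1) {U : ℝ} (hU : 0 ≤ U) :
    ∀ K : ℕ, (∀ k < K, s k ≤ U) →
      ∑ k ∈ Finset.range K, (s k - ∑ l ∈ Finset.range k, s l * s k) ≤ U
  | 0, _ => by simpa using hU
  | K + 1, h => by
      have ih := sum_sub_sum_pairs_le hs hU K fun k hk => h k (by omega)
      have hs0 : ∀ k, 0 ≤ s k := fun k => by rcases hs k with h | h <;> simp [h]
      rw [Finset.sum_range_succ, ← Finset.sum_mul]
      -- If an earlier indicator is 1, the new term minus its pairs is nonpositive; otherwise all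
      -- earlier terms vanish and the new one is at most U.
      by_cases h1 : ∃ l < K, s l = 1
      · obtain ⟨l, hl, hl1⟩ := h1
        have := Finset.single_le_sum (f := s) (fun k _ => hs0 k) (Finset.mem_range.2 hl)
        nlinarith [hs0 K]
      · have h0 : ∀ l ∈ Finset.range K, s l = 0 := fun l hl =>
          (hs l).resolve_right fun h' => h1 ⟨l, Finset.mem_range.1 hl, h'⟩
        have e1 : ∑ l ∈ Finset.range K, s l = 0 := Finset.sum_eq_zero h0
        have e2 : ∑ k ∈ Finset.range K, (s k - ∑ l ∈ Finset.range k, s l * s k) = 0 :=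
          Finset.sum_eq_zero fun k hk => by
            rw [h0 k hk]; simp
        rw [e1, e2]
        simpa using h K (by omega)

/-- The number of sites discovered both by `ω` and by `ω'` in the first `n` steps. -/
def commonCount (n : ℕ) (ω ω' : ℕ → V N) : ℝ := ∑ x, seen x n ω * seen x n ω'

lemma discCount_le_blocks (W G : ℕ) {K : ℕ} (hK : 1 ≤ K) (hB : 1 ≤ W + G) (ω : ℕ → V N) :
    discCount (K * (W + G)) ω
      ≤ ∑ k ∈ Finset.range K, discCount W (shiftPath (k * (W + G)) ω)
        + ∑ k ∈ Finset.range K, discCount G (shiftPath (k * (W + G) + W) ω) := by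
  simp only [discCount]
  rw [Finset.sum_comm, Finset.sum_comm (s := Finset.range K) (t := Finset.univ),
    ← Finset.sum_add_distrib]
  refine Finset.sum_le_sum fun x _ => ?_
  have h1 : ∀ k ∈ Finset.range K, 0 ≤ seen x W (shiftPath (k * (W + G)) ω) :=
    fun k _ => seen_nonneg _ _ _
  have h2 : ∀ k ∈ Finset.range K, 0 ≤ seen x G (shiftPath (k * (W + G) + W) ω) :=
    fun k _ => seen_nonneg _ _ _
  have h1' := Finset.sum_nonneg h1
  have h2' := Finset.sum_nonneg h2
  by_cases h : ∃ i ≤ K * (W + G), hammingDist (ω i) x ≤ 1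
  · have e : seen x (K * (W + G)) ω = 1 := if_pos h
    obtain ⟨i, hi, h⟩ := h
    -- The final time K (W + G) has no block of its own; it is the endpoint r = W + G of the last
    -- one.
    obtain ⟨k, hk, r, hr, rfl⟩ : ∃ k < K, ∃ r ≤ W + G, i = k * (W + G) + r := by
      rcases Nat.lt_or_ge i (K * (W + G)) with hlt | hge
      · refine ⟨i / (W + G), (Nat.div_lt_iff_lt_mul (by omega)).2 hlt, i % (W + G),
          (Nat.mod_lt _ (by omega)).le, ?_⟩
        rw [mul_comm]; exact (Nat.div_add_mod _ _).symm
      · obtain ⟨k, rfl⟩ : ∃ k, K = k + 1 := ⟨K - 1, by omega⟩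
        exact ⟨k, by omega, W + G, le_rfl, by rw [le_antisymm hi hge]; ring⟩
    rcases Nat.le_total r W with hrW | hrW
    · have := Finset.single_le_sum h1 (Finset.mem_range.2 hk)
      rw [seen_of_mem hrW (by simpa [shiftPath] using h)] at this
      linarith
    · have := Finset.single_le_sum h2 (Finset.mem_range.2 hk)
      rw [seen_of_mem (i := r - W) (by omega) (by
        rw [shiftPath_apply, show k * (W + G) + W + (r - W) = k * (W + G) + r by omega]
        exact h)] at this
      linarith
  · have e : seen x (K * (W + G)) ω = 0 := if_neg h
    linarith

/-- Bonferroni at each site: a site seen in several windows is overcounted by at most the number of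
pairs of windows that both see it. -/
lemma blocks_le_discCount (W G K : ℕ) (ω : ℕ → V N) :
    ∑ k ∈ Finset.range K, discCount W (shiftPath (k * (W + G)) ω)
      ≤ discCount (K * (W + G)) ω + ∑ k ∈ Finset.range K, ∑ l ∈ Finset.range k,
        commonCount W (shiftPath (l * (W + G)) ω) (shiftPath (k * (W + G)) ω) := by
  have key : ∑ x, ∑ k ∈ Finset.range K, (seen x W (shiftPath (k * (W + G)) ω)
      - ∑ l ∈ Finset.range k, seen x W (shiftPath (l * (W + G)) ω)
          * seen x W (shiftPath (k * (W + G)) ω)) ≤ discCount (K * (W + G)) ω := by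
    refine Finset.sum_le_sum fun x _ => ?_
    refine sum_sub_sum_pairs_le (fun k => seen_eq_zero_or_one _ _ _) (seen_nonneg _ _ _) K
      fun k hk => ?_
    by_cases h : ∃ i ≤ W, hammingDist (shiftPath (k * (W + G)) ω i) x ≤ 1
    · obtain ⟨i, hi, h⟩ := h
      rw [seen_of_mem (i := k * (W + G) + i) (n := K * (W + G)) (ω := ω) ?_ h]
      · exact seen_le_one _ _ _
      · have : (k + 1) * (W + G) ≤ K * (W + G) := Nat.mul_le_mul_right _ hk
        rw [add_mul, one_mul] at this
        omega
    · have e : seen x W (shiftPath (k * (W + G)) ω) = 0 := if_neg h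
      rw [e]
      exact seen_nonneg _ _ _
  rw [Finset.sum_comm] at key
  simp only [Finset.sum_sub_distrib] at key
  have e : ∀ k, ∑ x, ∑ l ∈ Finset.range k, seen x W (shiftPath (l * (W + G)) ω)
          * seen x W (shiftPath (k * (W + G)) ω)
      = ∑ l ∈ Finset.range k,
        commonCount W (shiftPath (l * (W + G)) ω) (shiftPath (k * (W + G)) ω) := fun k => by
    rw [Finset.sum_comm]; rfl
  simp only [e] at key
  simp only [discCount] at key ⊢
  linarith

section Blocks

variable {W G : ℕ} {η : ℝ}

lemma statExp_mul_blocks_le (hA : IsSymmStochastic A)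
    (hη : ∀ m, G ≤ m → ∀ x y, (A ^ m) x y ≤ (Fintype.card (V N) : ℝ)⁻¹ * (1 + η))
    {F H : (ℕ → V N) → ℝ} (hF : DependsOn F (Set.Iic W))
    (hH : DependsOn H (Set.Iic W)) (hF0 : ∀ ω, 0 ≤ F ω) (hH0 : ∀ ω, 0 ≤ H ω) {l k K : ℕ}
    (hlk : l < k) (hk : k < K) :
    statExp A (K * (W + G))
      (fun ω => F (shiftPath (l * (W + G)) ω) * H (shiftPath (k * (W + G)) ω))
      ≤ (1 + η) * (statExp A W F * statExp A W H) := by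
  have h1 : (l + 1) * (W + G) ≤ k * (W + G) := Nat.mul_le_mul_right _ hlk
  have h2 : (k + 1) * (W + G) ≤ K * (W + G) := Nat.mul_le_mul_right _ hk
  rw [add_mul, one_mul] at h1 h2
  have := statExp_mul_shiftPath_le hA (i := l * (W + G)) (m := W)
    (j := k * (W + G) - l * (W + G) - W) (k := W) (n := K * (W + G)) hF hH hF0 hH0
    (hη _ (by omega)) (by omega)
  rwa [show l * (W + G) + W + (k * (W + G) - l * (W + G) - W) = k * (W + G) by omega] at this

lemma statExp_abs_discCount_sub_blocks_le (hA : IsSymmStochastic A)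
    (hη : ∀ m, G ≤ m → ∀ x y, (A ^ m) x y ≤ (Fintype.card (V N) : ℝ)⁻¹ * (1 + η))
    {K : ℕ} (hK : 1 ≤ K) (hB : 1 ≤ W + G) (hη1 : η ≤ 1) :
    statExp A (K * (W + G)) (fun ω => |discCount (K * (W + G)) ω
      - ∑ k ∈ Finset.range K, discCount W (shiftPath (k * (W + G)) ω)|)
      ≤ K * ((N + 1) * escapeMoment A G)
        + K ^ 2 * (2 * ((N + 1) ^ 2 * (((2 : ℝ) ^ N)⁻¹ * escapeMoment A W))) := by
  have hcc : ∀ ω ω' : ℕ → V N, 0 ≤ commonCount W ω ω' := fun ω ω' =>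
    Finset.sum_nonneg fun x _ => mul_nonneg (seen_nonneg _ _ _) (seen_nonneg _ _ _)
  -- Gap discoveries bound the excess of the total over the windows, and pairwise overlaps bound the
  -- deficit; their sum controls the absolute value.
  calc _ ≤ statExp A (K * (W + G)) (fun ω =>
          ∑ k ∈ Finset.range K, discCount G (shiftPath (k * (W + G) + W) ω)
          + ∑ k ∈ Finset.range K, ∑ l ∈ Finset.range k,
            commonCount W (shiftPath (l * (W + G)) ω) (shiftPath (k * (W + G)) ω)) := by
        refine statExp_mono hA _ fun ω => ?_
        have h1 := discCount_le_blocks W G hK hB ω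
        have h2 := blocks_le_discCount W G K ω
        have h3 : 0 ≤ ∑ k ∈ Finset.range K, discCount G (shiftPath (k * (W + G) + W) ω) :=
          Finset.sum_nonneg fun k _ => discCount_nonneg _ _
        have h4 : 0 ≤ ∑ k ∈ Finset.range K, ∑ l ∈ Finset.range k,
            commonCount W (shiftPath (l * (W + G)) ω) (shiftPath (k * (W + G)) ω) :=
          Finset.sum_nonneg fun k _ => Finset.sum_nonneg fun l _ => hcc _ _
        rw [abs_le]
        constructor <;> linarith
    _ ≤ _ := by
        rw [statExp_add]
        simp only [statExp_sum]
        refine add_le_add ?_ ?_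
        · calc _ ≤ ∑ k ∈ Finset.range K, (N + 1) * escapeMoment A G := by
                refine Finset.sum_le_sum fun k hk => ?_
                have hk := Finset.mem_range.1 hk
                have h2 : (k + 1) * (W + G) ≤ K * (W + G) := Nat.mul_le_mul_right _ hk
                rw [add_mul, one_mul] at h2
                rw [statExp_shiftPath hA (dependsOn_discCount G) (by omega)]
                exact statExp_discCount_le hA G
            _ = _ := by simp
        · have hp : ∀ k ∈ Finset.range K, ∀ l ∈ Finset.range k, statExp A (K * (W + G)) (fun ω =>
              commonCount W (shiftPath (l * (W + G)) ω) (shiftPath (k * (W + G)) ω))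
              ≤ 2 * ((N + 1) ^ 2 * (((2 : ℝ) ^ N)⁻¹ * escapeMoment A W)) := by
            intro k hk l hl
            simp only [commonCount, statExp_sum]
            calc _ ≤ ∑ x, 2 * statExp A W (seen x W) ^ 2 := by
                  refine Finset.sum_le_sum fun x _ => ?_
                  refine (statExp_mul_blocks_le hA hη (dependsOn_seen x W) (dependsOn_seen x W)
                    (seen_nonneg x W) (seen_nonneg x W) (Finset.mem_range.1 hl)
                    (Finset.mem_range.1 hk)).trans ?_
                  rw [← pow_two]
                  exact mul_le_mul_of_nonneg_right (by linarith) (sq_nonneg _)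
              _ ≤ _ := by
                  rw [← Finset.mul_sum]
                  exact mul_le_mul_of_nonneg_left (sum_statExp_seen_sq_le hA W) (by norm_num)
          have hc0 : 0 ≤ 2 * ((N + 1) ^ 2 * (((2 : ℝ) ^ N)⁻¹ * escapeMoment A W)) :=
            mul_nonneg (by norm_num) (le_trans (Finset.sum_nonneg fun x _ => sq_nonneg _)
              (sum_statExp_seen_sq_le hA W))
          calc _ ≤ ∑ k ∈ Finset.range K, ∑ l ∈ Finset.range K,
                  2 * ((N + 1) ^ 2 * (((2 : ℝ) ^ N)⁻¹ * escapeMoment A W)) := by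
                refine Finset.sum_le_sum fun k hk => (Finset.sum_le_sum (hp k hk)).trans ?_
                exact Finset.sum_le_sum_of_subset_of_nonneg
                  (Finset.range_mono (Finset.mem_range.1 hk).le) fun _ _ _ => hc0
            _ = _ := by simp; ring

/-- Expanding the square, the K diagonal terms contribute second moments of one window. The
off-diagonal covariances are at most η m² by mixing, and m² is bounded by the same second moment. -/
lemma statExp_sq_blocks_sub_le (hA : IsSymmStochastic A)
    (hη : ∀ m, G ≤ m → ∀ x y, (A ^ m) x y ≤ (Fintype.card (V N) : ℝ)⁻¹ * (1 + η))
    (K : ℕ) (hη0 : 0 ≤ η) :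
    statExp A (K * (W + G)) (fun ω =>
      (∑ k ∈ Finset.range K, discCount W (shiftPath (k * (W + G)) ω)
        - K * statExp A W (discCount W)) ^ 2)
      ≤ (K + K ^ 2 * η) * ((N + 1) ^ 2 * escapeMoment A W) := by
  set n := K * (W + G) with hn
  set m := statExp A W (discCount W) with hm
  set D : ℕ → (ℕ → V N) → ℝ := fun k ω => discCount W (shiftPath (k * (W + G)) ω) with hD
  set Q := statExp A W (fun ω => discCount W ω ^ 2) with hQ
  have hm0 : 0 ≤ m := statExp_nonneg hA W (discCount_nonneg W)
  have hend : ∀ k < K, k * (W + G) + W ≤ n := fun k hk => by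
    have h2 : (k + 1) * (W + G) ≤ K * (W + G) := Nat.mul_le_mul_right _ hk
    rw [add_mul, one_mul] at h2
    omega
  have hmean : ∀ k < K, statExp A n (D k) = m := fun k hk =>
    statExp_shiftPath hA (dependsOn_discCount W) (hend k hk)
  have hsq : ∀ k < K, statExp A n (fun ω => D k ω * D k ω) = Q := fun k hk => by
    have hd : DependsOn (fun ω : ℕ → V N => discCount W ω ^ 2) (Set.Iic W) := fun ω ω' h => by
      simp only [dependsOn_discCount W h]
    rw [hQ, ← statExp_shiftPath hA hd (hend k hk)]
    simp only [hD, pow_two]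
  have hoff : ∀ k < K, ∀ l < K, l ≠ k → statExp A n (fun ω => D l ω * D k ω) ≤ (1 + η) * m ^ 2 := by
    intro k hk l hl hlk
    rw [pow_two]
    rcases Nat.lt_or_gt_of_ne hlk with h | h
    · exact statExp_mul_blocks_le hA hη (dependsOn_discCount W) (dependsOn_discCount W)
        (discCount_nonneg W) (discCount_nonneg W) h hk
    · have := statExp_mul_blocks_le hA hη (dependsOn_discCount W) (dependsOn_discCount W)
        (discCount_nonneg W) (discCount_nonneg W) h hl
      simp only [hD, mul_comm] at this ⊢
      exact this
  have hmQ : m ^ 2 ≤ Q := by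
    have h0 : 0 ≤ statExp A W (fun ω => (discCount W ω ^ 2 + (-2 * m) * discCount W ω) + m ^ 2) :=
      statExp_nonneg hA W fun ω => by nlinarith [sq_nonneg (discCount W ω - m)]
    rw [statExp_add, statExp_add, statExp_const_mul, statExp_const hA, ← hm, ← hQ] at h0
    linarith
  have hQ' : Q ≤ (N + 1) ^ 2 * escapeMoment A W := statExp_discCount_sq_le hA W
  have e : (fun ω => (∑ k ∈ Finset.range K, D k ω - K * m) ^ 2) = fun ω =>
      (∑ k ∈ Finset.range K, ∑ l ∈ Finset.range K, D l ω * D k ω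
        + (-2 * (K * m)) * ∑ k ∈ Finset.range K, D k ω) + (K * m) ^ 2 := by
    funext ω
    have : ∑ k ∈ Finset.range K, ∑ l ∈ Finset.range K, D l ω * D k ω
        = (∑ k ∈ Finset.range K, D k ω) ^ 2 := by
      rw [pow_two, Finset.sum_mul_sum, Finset.sum_comm]
    rw [this]; ring
  have hsum : ∑ k ∈ Finset.range K, statExp A n (D k) = K * m := by
    rw [Finset.sum_congr rfl fun k hk => hmean k (Finset.mem_range.1 hk)]
    simp
  have hdouble : ∑ k ∈ Finset.range K, ∑ l ∈ Finset.range K, statExp A n (fun ω => D l ω * D k ω)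
      ≤ K * Q + K ^ 2 * ((1 + η) * m ^ 2) := by
    have hnn : 0 ≤ (1 + η) * m ^ 2 := by positivity
    have hQ0 : 0 ≤ Q := le_trans (sq_nonneg m) hmQ
    calc _ ≤ ∑ k ∈ Finset.range K, ∑ l ∈ Finset.range K,
            ((if l = k then Q else 0) + (1 + η) * m ^ 2) := by
          refine Finset.sum_le_sum fun k hk => Finset.sum_le_sum fun l hl => ?_
          have hk := Finset.mem_range.1 hk
          have hl := Finset.mem_range.1 hl
          split_ifs with h
          · subst h; rw [hsq l hk]; linarith
          · linarith [hoff k hk l hl h]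
      _ = _ := by
          simp only [Finset.sum_add_distrib, Finset.sum_ite_eq', Finset.mem_range, Finset.sum_const,
            Finset.card_range, nsmul_eq_mul]
          rw [Finset.sum_congr rfl fun k hk => if_pos (Finset.mem_range.1 hk)]
          simp
          ring
  rw [e, statExp_add, statExp_add, statExp_const_mul, statExp_const hA]
  simp only [statExp_sum]
  rw [hsum]
  have h1 : K ^ 2 * (η * m ^ 2) ≤ K ^ 2 * (η * Q) := by gcongr
  have h2 : (K + K ^ 2 * η) * Q ≤ (K + K ^ 2 * η) * ((N + 1) ^ 2 * escapeMoment A W) :=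
    mul_le_mul_of_nonneg_left hQ' (by positivity)
  nlinarith

/-- Quenched law of large numbers. -/
lemma statExp_abs_discCount_sub_le (hA : IsSymmStochastic A)
    (hη : ∀ m, G ≤ m → ∀ x y, (A ^ m) x y ≤ (Fintype.card (V N) : ℝ)⁻¹ * (1 + η))
    {K : ℕ} (hK : 1 ≤ K) (hB : 1 ≤ W + G) (hη1 : η ≤ 1)
    (hη0 : 0 ≤ η) :
    statExp A (K * (W + G)) (fun ω => |discCount (K * (W + G)) ω
      - K * statExp A W (discCount W)|)
      ≤ K * ((N + 1) * escapeMoment A G)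
        + K ^ 2 * (2 * ((N + 1) ^ 2 * (((2 : ℝ) ^ N)⁻¹ * escapeMoment A W)))
        + (K + (1 + K * η) * ((N + 1) ^ 2 * escapeMoment A W)) := by
  have hK' : (0 : ℝ) < K := by exact_mod_cast hK
  have h1 := statExp_abs_discCount_sub_blocks_le hA hη hK hB hη1
  have h2 := statExp_sq_blocks_sub_le (W := W) hA hη K hη0
  have h3 : statExp A (K * (W + G)) (fun ω => |∑ k ∈ Finset.range K,
        discCount W (shiftPath (k * (W + G)) ω) - K * statExp A W (discCount W)|)
      ≤ K + (1 + K * η) * ((N + 1) ^ 2 * escapeMoment A W) := by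
    calc _ ≤ statExp A (K * (W + G)) (fun ω => K + (K : ℝ)⁻¹ * (∑ k ∈ Finset.range K,
            discCount W (shiftPath (k * (W + G)) ω) - K * statExp A W (discCount W)) ^ 2) := by
          refine statExp_mono hA _ fun ω => ?_
          set u := ∑ k ∈ Finset.range K,
            discCount W (shiftPath (k * (W + G)) ω) - K * statExp A W (discCount W)
          have : |u| * K ≤ (K + (K : ℝ)⁻¹ * u ^ 2) * K := by
            rw [add_mul, mul_assoc, mul_comm (u ^ 2), ← mul_assoc, inv_mul_cancel₀ hK'.ne', one_mul,
              ← sq_abs u]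
            nlinarith [sq_nonneg (|u| - K), abs_nonneg u]
          exact le_of_mul_le_mul_right this hK'
      _ ≤ _ := by
          rw [statExp_add, statExp_const hA, statExp_const_mul]
          refine add_le_add le_rfl ((mul_le_mul_of_nonneg_left h2 (by positivity)).trans
            (le_of_eq ?_))
          field_simp
  refine (statExp_mono hA _ fun ω => abs_sub_le _
    (∑ k ∈ Finset.range K, discCount W (shiftPath (k * (W + G)) ω)) _).trans ?_
  rw [statExp_add]
  exact add_le_add h1 h3

/-- A lower bound for the mean number of discovered sites, from the positions at times that are
multiples of the mixing time. -/
lemma le_statExp_discCount (hA : IsSymmStochastic A)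
    (hη : ∀ m, G ≤ m → ∀ x y, (A ^ m) x y ≤ (Fintype.card (V N) : ℝ)⁻¹ * (1 + η))
    {v : ℕ} (hW : W = v * G) (hη1 : η ≤ 1) :
    (v + 1 : ℝ) - 2 * (v + 1) ^ 2 * ((2 : ℝ) ^ N)⁻¹ ≤ statExp A W (discCount W) := by
  set c := ((2 : ℝ) ^ N)⁻¹ with hc
  have hc0 : 0 ≤ c := by positivity
  have hle : ∀ k < v + 1, k * G ≤ W := fun k hk => by
    rw [hW]; exact Nat.mul_le_mul_right _ (by omega)
  have key : ∀ ω : ℕ → V N, ∑ x, ∑ k ∈ Finset.range (v + 1), (atSite x (k * G) ω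
      - ∑ l ∈ Finset.range k, atSite x (l * G) ω * atSite x (k * G) ω) ≤ discCount W ω := by
    intro ω
    refine Finset.sum_le_sum fun x _ => ?_
    refine sum_sub_sum_pairs_le (s := fun k => atSite x (k * G) ω)
      (fun k => by simp only [atSite]; split_ifs <;> simp) (seen_nonneg _ _ _) _ fun k hk => ?_
    simp only [atSite]
    split_ifs with h
    · rw [seen_of_mem (hle k hk) (by rw [h]; simp)]
    · exact seen_nonneg _ _ _
  have h1 := statExp_mono hA W key
  simp only [statExp_sum, statExp_sub] at h1
  refine le_trans ?_ h1
  have hat : ∀ x : V N, ∀ k ∈ Finset.range (v + 1), statExp A W (atSite x (k * G)) = c := by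
    intro x k hk
    rw [statExp_atSite hA x (hle k (Finset.mem_range.1 hk)), card_V]
  have hpair : ∀ x : V N, ∀ k ∈ Finset.range (v + 1), ∀ l ∈ Finset.range k,
      statExp A W (fun ω => atSite x (l * G) ω * atSite x (k * G) ω) ≤ 2 * (c * c) := by
    intro x k hk l hl
    have hl := Finset.mem_range.1 hl
    have hk := hle k (Finset.mem_range.1 hk)
    have h1 : (l + 1) * G ≤ k * G := Nat.mul_le_mul_right _ hl
    rw [add_mul, one_mul] at h1
    have := statExp_mul_shiftPath_le hA (i := l * G) (m := 0) (j := k * G - l * G) (k := 0)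
      (n := W) (dependsOn_atSite_zero x) (dependsOn_atSite_zero x) (atSite_nonneg x 0)
      (atSite_nonneg x 0) (hη _ (by omega)) (by omega)
    simp only [atSite_shiftPath, add_zero] at this
    rw [show l * G + (k * G - l * G) = k * G by omega, statExp_atSite hA x le_rfl, card_V, ← hc]
      at this
    exact this.trans (mul_le_mul_of_nonneg_right (by linarith) (by positivity))
  calc (v + 1 : ℝ) - 2 * (v + 1) ^ 2 * c
      = ∑ x : V N, ∑ k ∈ Finset.range (v + 1), (c - ∑ l ∈ Finset.range (v + 1), 2 * (c * c)) := by
        simp only [Finset.sum_const, Finset.card_range, nsmul_eq_mul, Finset.card_univ, card_V]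
        have : (2 : ℝ) ^ N * c = 1 := mul_inv_cancel₀ (by positivity)
        push_cast
        linear_combination (-(v + 1 : ℝ) + 2 * (v + 1) ^ 2 * c) * this
    _ ≤ _ := by
        refine Finset.sum_le_sum fun x _ => ?_
        refine Finset.sum_le_sum fun k hk => ?_
        rw [hat x k hk]
        refine sub_le_sub_left ((Finset.sum_le_sum (hpair x k hk)).trans ?_) _
        exact Finset.sum_le_sum_of_subset_of_nonneg
          (Finset.range_mono (Finset.mem_range.1 hk).le) fun _ _ _ => by positivity

end Blocks

end Discovery

/-! ### Averaging over the environment -/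

section Annealed

instance isProbabilityMeasure_posGaussian : IsProbabilityMeasure posGaussian :=
  Measure.isProbabilityMeasure_map (by fun_prop)

instance isProbabilityMeasure_envLaw (N : ℕ) : IsProbabilityMeasure (envLaw N) := by
  unfold envLaw; infer_instance

/-- The exponential of b times the positive part is at most 1 + exp(bu), whose Gaussian mean is
explicit. -/
lemma integrable_exp_posGaussian_and_le (b : ℝ) :
    Integrable (fun u => Real.exp (b * u)) posGaussian ∧
      ∫ u, Real.exp (b * u) ∂posGaussian ≤ 1 + Real.exp (b ^ 2 / 2) := by
  have hm : AEMeasurable (fun u : ℝ => max u 0) (gaussianReal 0 1) := by fun_prop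
  have hle : ∀ u : ℝ, Real.exp (b * max u 0) ≤ 1 + Real.exp (b * u) := by
    intro u
    rcases le_total u 0 with h | h
    · rw [max_eq_right h, mul_zero, Real.exp_zero]
      linarith [Real.exp_pos (b * u)]
    · rw [max_eq_left h]; linarith
  have hint : Integrable (fun u : ℝ => 1 + Real.exp (b * u)) (gaussianReal 0 1) :=
    (integrable_const _).add (integrable_exp_mul_gaussianReal b)
  have hint2 : Integrable (fun u : ℝ => Real.exp (b * max u 0)) (gaussianReal 0 1) := by
    refine hint.mono' (by fun_prop) (Eventually.of_forall fun u => ?_)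
    rw [Real.norm_eq_abs, abs_of_pos (Real.exp_pos _)]
    exact hle u
  constructor
  · rw [posGaussian, integrable_map_measure (by fun_prop) hm]
    exact hint2
  · rw [posGaussian, integral_map hm (by fun_prop)]
    refine (integral_mono hint2 hint hle).trans ?_
    rw [integral_add (integrable_const _) (integrable_exp_mul_gaussianReal b)]
    have := congrFun (mgf_id_gaussianReal (μ := 0) (v := 1)) b
    simp only [mgf, id] at this
    rw [this]
    simp

variable {N : ℕ}

lemma measurePreserving_eval_envLaw (x : V N) :
    MeasurePreserving (fun e : V N → ℝ => e x) (envLaw N) posGaussian :=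
  measurePreserving_eval (fun _ : V N => posGaussian) x

lemma ae_nonneg_envLaw (N : ℕ) : ∀ᵐ e ∂(envLaw N), ∀ x, 0 ≤ e x := by
  rw [ae_all_iff]
  intro x
  have h : ∀ᵐ u ∂posGaussian, 0 ≤ u := by
    rw [posGaussian, ae_map_iff (by fun_prop) measurableSet_Ici]
    exact Eventually.of_forall fun u => le_max_right _ _
  exact (measurePreserving_eval_envLaw x).quasiMeasurePreserving.ae h

/-- The mean over the sites of `exp (8 a e)`. -/
def expMean (a : ℝ) (e : V N → ℝ) : ℝ := ((2 : ℝ) ^ N)⁻¹ * ∑ x, Real.exp (8 * a * e x)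

lemma integrable_expMean_and_le (a : ℝ) :
    Integrable (expMean (N := N) a) (envLaw N) ∧
      ∫ e, expMean (N := N) a e ∂(envLaw N) ≤ 1 + Real.exp (32 * a ^ 2) := by
  obtain ⟨h1, h2⟩ := integrable_exp_posGaussian_and_le (8 * a)
  have hx : ∀ x : V N, Integrable (fun e : V N → ℝ => Real.exp (8 * a * e x)) (envLaw N) :=
    fun x => (measurePreserving_eval_envLaw x).integrable_comp_of_integrable h1
  have hx2 : ∀ x : V N, ∫ e, Real.exp (8 * a * e x) ∂(envLaw N) ≤ 1 + Real.exp (32 * a ^ 2) := by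
    intro x
    have e1 : ∫ e, Real.exp (8 * a * e x) ∂(envLaw N)
        = ∫ u, Real.exp (8 * a * u) ∂posGaussian := by
      rw [← (measurePreserving_eval_envLaw x).map_eq,
        integral_map (measurable_pi_apply x).aemeasurable (by fun_prop)]
    rw [e1]
    refine h2.trans (le_of_eq ?_)
    ring_nf
  constructor
  · exact (integrable_finsetSum _ fun x _ => hx x).const_mul _
  · simp only [expMean]
    rw [integral_const_mul, integral_finsetSum _ fun x _ => hx x]
    calc _ ≤ ((2 : ℝ) ^ N)⁻¹ * ∑ _x : V N, (1 + Real.exp (32 * a ^ 2)) := by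
          gcongr with x; exact hx2 x
      _ = _ := by
          rw [Finset.sum_const, nsmul_eq_mul, Finset.card_univ, card_V, ← mul_assoc,
            inv_mul_cancel₀ (by positivity), one_mul]

lemma sum_rate_eq (a : ℝ) (e : V N → ℝ) (x : V N) :
    ∑ z, rate a e x z = ∑ i, Real.exp (a * (e x + e (flip i x))) :=
  sum_neighbours x fun z => Real.exp (a * (e x + e z))

lemma sum_flip (f : V N → ℝ) (i : Fin N) : ∑ x, f (flip i x) = ∑ x, f x :=
  Equiv.sum_comp (Function.Involutive.toPerm (flip i) (flip_flip i)) f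

/-- Over τq steps the factors q cancel, leaving the total exit rate r(x), a sum of N exponentials.
Convexity bounds r⁴ by N³ times a sum of fourth powers; then exp(4a(e_x + e_y)) is at most half the
sum of exp(8a e_x) and exp(8a e_y), and each flip is a bijection of the cube. -/
lemma escapeMoment_stepKernel_le (a : ℝ) (e : V N → ℝ) {q : ℕ} (hq : 1 ≤ q) (τ : ℕ) :
    escapeMoment (stepKernel a e q) (τ * q) ≤ 8 + 128 * τ ^ 4 * N ^ 4 * expMean a e := by
  have hq0 : (0 : ℝ) < q := by exact_mod_cast hq
  set r : V N → ℝ := fun x => ∑ z, rate a e x z with hr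
  have hr0 : ∀ x, 0 ≤ r x := fun x => Finset.sum_nonneg fun z _ => rate_nonneg a e x z
  have h1 : ∀ z, (1 + 2 * ((τ * q : ℕ) : ℝ) * escape (stepKernel a e q) z) ^ 4
      ≤ 8 + 128 * τ ^ 4 * r z ^ 4 := by
    intro z
    have h0 := escape_nonneg (isSymmStochastic_stepKernel a e q) z
    have hle : 2 * ((τ * q : ℕ) : ℝ) * escape (stepKernel a e q) z ≤ 2 * τ * r z := by
      push_cast
      calc 2 * (τ * q : ℝ) * escape (stepKernel a e q) z
          ≤ 2 * (τ * q : ℝ) * (r z / q) := by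
            gcongr; exact escape_stepKernel_le a e q z
        _ = 2 * τ * r z := by field_simp
    set u := 2 * τ * r z with hu
    have hu0 : 0 ≤ u := by have := hr0 z; positivity
    calc _ ≤ (1 + u) ^ 4 := by gcongr
      _ ≤ 2 ^ 3 * (1 ^ 4 + u ^ 4) := add_pow_le (by norm_num) hu0 4
      _ = _ := by rw [hu]; ring
  have h2 : ∀ x, r x ^ 4 ≤ N ^ 3 * ∑ i, (Real.exp (8 * a * e x)
      + Real.exp (8 * a * e (flip i x))) / 2 := by
    intro x
    simp only [hr]
    rw [sum_rate_eq]
    calc _ ≤ ((Finset.univ : Finset (Fin N)).card : ℝ) ^ 3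
            * ∑ i, Real.exp (a * (e x + e (flip i x))) ^ 4 :=
          pow_sum_le_card_mul_sum_pow (fun i _ => (Real.exp_pos _).le) 3
      _ ≤ _ := by
          rw [Finset.card_univ, Fintype.card_fin]
          gcongr with i
          rw [← Real.exp_nat_mul]
          have e1 : Real.exp (8 * a * e x) = Real.exp (4 * a * e x) ^ 2 := by
            rw [← Real.exp_nat_mul]; congr 1; push_cast; ring
          have e2 : Real.exp (8 * a * e (flip i x)) = Real.exp (4 * a * e (flip i x)) ^ 2 := by
            rw [← Real.exp_nat_mul]; congr 1; push_cast; ring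
          have e3 : Real.exp ((4 : ℕ) * (a * (e x + e (flip i x))))
              = Real.exp (4 * a * e x) * Real.exp (4 * a * e (flip i x)) := by
            rw [← Real.exp_add]; congr 1; push_cast; ring
          rw [e1, e2, e3]
          nlinarith [sq_nonneg (Real.exp (4 * a * e x) - Real.exp (4 * a * e (flip i x)))]
  have h3 : ∑ x, r x ^ 4 ≤ N ^ 4 * ∑ x, Real.exp (8 * a * e x) := by
    refine (Finset.sum_le_sum fun x _ => h2 x).trans (le_of_eq ?_)
    rw [← Finset.mul_sum, Finset.sum_comm]
    have hi : ∀ i : Fin N, ∑ x, (Real.exp (8 * a * e x) + Real.exp (8 * a * e (flip i x))) / 2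
        = ∑ x, Real.exp (8 * a * e x) := fun i => by
      rw [← Finset.sum_div, Finset.sum_add_distrib, sum_flip (fun x => Real.exp (8 * a * e x)) i]
      ring
    simp only [hi, Finset.sum_const, Finset.card_univ, Fintype.card_fin, nsmul_eq_mul]
    ring
  calc escapeMoment (stepKernel a e q) (τ * q)
      ≤ ((2 : ℝ) ^ N)⁻¹ * ∑ z, (8 + 128 * τ ^ 4 * r z ^ 4) := by
        unfold escapeMoment
        gcongr with z
        exact h1 z
    _ = 8 + 128 * τ ^ 4 * (((2 : ℝ) ^ N)⁻¹ * ∑ z, r z ^ 4) := by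
        rw [Finset.sum_add_distrib, ← Finset.mul_sum, Finset.sum_const, nsmul_eq_mul,
          Finset.card_univ, card_V]
        have : ((2 : ℝ) ^ N)⁻¹ * 2 ^ N = 1 := inv_mul_cancel₀ (by positivity)
        linear_combination 8 * this
    _ ≤ 8 + 128 * τ ^ 4 * (((2 : ℝ) ^ N)⁻¹ * (N ^ 4 * ∑ x, Real.exp (8 * a * e x))) := by
        gcongr
    _ = _ := by unfold expMean; ring

/-- A bound for the environment average of `escapeMoment` over a time `τ`. -/
def momentBound (N : ℕ) (a : ℝ) (τ : ℕ) : ℝ :=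
  8 + 128 * τ ^ 4 * N ^ 4 * (1 + Real.exp (32 * a ^ 2))

lemma momentBound_nonneg (N : ℕ) (a : ℝ) (τ : ℕ) : 0 ≤ momentBound N a τ := by
  unfold momentBound; positivity

lemma escapeMoment_nonneg {A : Matrix (V N) (V N) ℝ} (n : ℕ) : 0 ≤ escapeMoment A n :=
  mul_nonneg (by positivity) (Finset.sum_nonneg fun z _ => Even.pow_nonneg (by decide) _)

lemma measurable_escapeMoment (a : ℝ) (q n : ℕ) :
    Measurable fun e : V N → ℝ => escapeMoment (stepKernel a e q) n := by
  unfold escapeMoment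
  simp only [escape]
  refine (Finset.measurable_sum _ fun z _ => ?_).const_mul _
  refine ((Measurable.const_mul (Finset.measurable_sum _ fun y _ => ?_) _).const_add _).pow_const _
  split_ifs
  · exact measurable_const
  · exact measurable_stepKernel a q z y

lemma integrable_escapeMoment_and_le (a : ℝ) {q : ℕ} (hq : 1 ≤ q) (τ : ℕ) :
    Integrable (fun e : V N → ℝ => escapeMoment (stepKernel a e q) (τ * q)) (envLaw N) ∧
      ∫ e : V N → ℝ, escapeMoment (stepKernel a e q) (τ * q) ∂(envLaw N) ≤ momentBound N a τ := by
  obtain ⟨h1, h2⟩ := integrable_expMean_and_le (N := N) a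
  have hint : Integrable (fun e : V N → ℝ => 8 + 128 * τ ^ 4 * N ^ 4 * expMean a e) (envLaw N) :=
    (integrable_const _).add (h1.const_mul _)
  have hle := fun e : V N → ℝ => escapeMoment_stepKernel_le a e hq τ
  have hint2 : Integrable (fun e : V N → ℝ => escapeMoment (stepKernel a e q) (τ * q))
      (envLaw N) := by
    refine hint.mono' (measurable_escapeMoment a q _).aestronglyMeasurable
      (Eventually.of_forall fun e => ?_)
    rw [Real.norm_eq_abs, abs_of_nonneg (escapeMoment_nonneg _)]
    exact hle e
  refine ⟨hint2, (integral_mono hint2 hint hle).trans ?_⟩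
  rw [integral_add (integrable_const _) (h1.const_mul _), integral_const_mul]
  simp only [integral_const, probReal_univ, smul_eq_mul, one_mul]
  unfold momentBound
  gcongr

/-- The mean of a path functional for the discretized walk, averaged over the environment. -/
def annealedExp (N : ℕ) (a : ℝ) (q n : ℕ) (G : (ℕ → V N) → ℝ) : ℝ :=
  ∫ e, statExp (stepKernel a e q) n G ∂(envLaw N)

lemma measurable_statExp_stepKernel (a : ℝ) (q n : ℕ) (G : (ℕ → V N) → ℝ) :
    Measurable fun e : V N → ℝ => statExp (stepKernel a e q) n G :=
  measurable_statExp (measurable_stepKernel a q) n G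

lemma abs_statExp_stepKernel_le (a : ℝ) (e : V N → ℝ) (q n : ℕ) {G : (ℕ → V N) → ℝ} {C : ℝ}
    (hG : ∀ ω, |G ω| ≤ C) : |statExp (stepKernel a e q) n G| ≤ C :=
  abs_statExp_le (isSymmStochastic_stepKernel a e q).nonneg
    (isSymmStochastic_stepKernel a e q).row_sum n hG

lemma integrable_statExp_stepKernel (a : ℝ) (q n : ℕ) {G : (ℕ → V N) → ℝ} {C : ℝ}
    (hG : ∀ ω, |G ω| ≤ C) :
    Integrable (fun e : V N → ℝ => statExp (stepKernel a e q) n G) (envLaw N) :=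
  integrable_of_bounded (measurable_statExp_stepKernel a q n G)
    fun e => abs_statExp_stepKernel_le a e q n hG

lemma abs_discCount_le (n : ℕ) (ω : ℕ → V N) : |discCount n ω| ≤ 2 ^ N := by
  rw [abs_of_nonneg (discCount_nonneg n ω)]
  exact discCount_le n ω

lemma annealedExp_discCount_le (a : ℝ) {q : ℕ} (hq : 1 ≤ q) (τ : ℕ) :
    annealedExp N a q (τ * q) (discCount (τ * q)) ≤ (N + 1) * momentBound N a τ := by
  obtain ⟨h1, h2⟩ := integrable_escapeMoment_and_le (N := N) a hq τ
  calc annealedExp N a q (τ * q) (discCount (τ * q))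
      ≤ ∫ e : V N → ℝ, (N + 1) * escapeMoment (stepKernel a e q) (τ * q) ∂(envLaw N) :=
        integral_mono (integrable_statExp_stepKernel a q _ (abs_discCount_le _)) (h1.const_mul _)
          fun e => statExp_discCount_le (isSymmStochastic_stepKernel a e q) _
    _ ≤ _ := by
        rw [integral_const_mul]
        gcongr

/-- The mean number of discovered sites hardly depends on the environment. -/
lemma integral_sq_statExp_sub_annealedExp_le (a : ℝ) {q : ℕ} (hq : 1 ≤ q) (τ : ℕ) :
    ∫ e : V N → ℝ, (statExp (stepKernel a e q) (τ * q) (discCount (τ * q))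
      - annealedExp N a q (τ * q) (discCount (τ * q))) ^ 2 ∂(envLaw N)
      ≤ (N + 1) ^ 4 * (((2 : ℝ) ^ N)⁻¹ * momentBound N a τ) := by
  set n := τ * q with hn
  have hbd : ∀ (y : V N) (ω : ℕ → V N), |discCount n ω - discCount n ω * seen y n ω| ≤ 2 ^ N := by
    intro y ω
    have h1 := discCount_nonneg n ω
    have h2 := discCount_le n ω
    have h3 := seen_nonneg y n ω
    have h4 := seen_le_one y n ω
    rw [abs_le]
    constructor <;> nlinarith
  -- The comparison function keeps only paths that do not discover y. Outside the ball around y the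
  -- kernel ignores the energy at y, so this mean does not depend on it; the difference from f is
  -- the mean of the count on discovery of y.
  have hES := efronStein posGaussian (C := (2 : ℝ) ^ N)
    (f := fun e : V N → ℝ => statExp (stepKernel a e q) n (discCount n))
    (g := fun y e => statExp (stepKernel a e q) n
      fun ω => discCount n ω - discCount n ω * seen y n ω)
    (measurable_statExp_stepKernel a q n _) (fun y => measurable_statExp_stepKernel a q n _)
    (fun e => abs_statExp_stepKernel_le a e q n (abs_discCount_le n))
    (fun y e => abs_statExp_stepKernel_le a e q n (hbd y))
    (fun y e e' h => by
      simp only [statExp]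
      congr 1
      refine Finset.sum_congr rfl fun z _ => ?_
      refine pathExp_eq_of_avoid (B := {x | hammingDist x y ≤ 1})
        (fun x hx z => stepKernel_eq_of_far a q (fun z hz => h z hz) hx z) n (fun ω hω => ?_) z
      -- Only positions strictly before time n matter, since the transition row at the final
      -- position is never used.
      obtain ⟨i, hi, hB⟩ := hω
      rw [seen_of_mem hi.le hB]
      ring)
  have e1 : ∀ (y : V N) (e : V N → ℝ), statExp (stepKernel a e q) n (discCount n)
      - statExp (stepKernel a e q) n (fun ω => discCount n ω - discCount n ω * seen y n ω)
      = statExp (stepKernel a e q) n (fun ω => discCount n ω * seen y n ω) := fun y e => by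
    rw [statExp_sub]; ring
  simp only [e1] at hES
  have hbd2 : ∀ (y : V N) (ω : ℕ → V N), |discCount n ω * seen y n ω| ≤ 2 ^ N := by
    intro y ω
    have h1 := discCount_nonneg n ω
    have h2 := discCount_le n ω
    have h3 := seen_nonneg y n ω
    have h4 := seen_le_one y n ω
    rw [abs_le]
    constructor <;> nlinarith
  obtain ⟨h1, h2⟩ := integrable_escapeMoment_and_le (N := N) a hq τ
  refine hES.trans ?_
  have hi : ∀ y ∈ (Finset.univ : Finset (V N)), Integrable (fun e : V N → ℝ =>
      statExp (stepKernel a e q) n (fun ω => discCount n ω * seen y n ω) ^ 2)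
      (Measure.pi fun _ => posGaussian) := fun y _ =>
    integrable_sq_of_bounded (measurable_statExp_stepKernel a q n _)
      (fun e => abs_statExp_stepKernel_le a e q n (hbd2 y))
  rw [← integral_finsetSum _ hi]
  calc _ ≤ ∫ e : V N → ℝ, (N + 1) ^ 4 * (((2 : ℝ) ^ N)⁻¹
          * escapeMoment (stepKernel a e q) (τ * q)) ∂(envLaw N) :=
        integral_mono (integrable_finsetSum _ hi) ((h1.const_mul _).const_mul _) fun e =>
          sum_statExp_discCount_mul_seen_sq_le (isSymmStochastic_stepKernel a e q) n
    _ ≤ _ := by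
        rw [integral_const_mul, integral_const_mul]
        gcongr

lemma one_le_rate {a : ℝ} (ha : 0 ≤ a) {e : V N → ℝ} (he : ∀ x, 0 ≤ e x) (x y : V N)
    (h : hammingDist x y = 1) : 1 ≤ rate a e x y := by
  rw [rate, if_pos h]
  exact Real.one_le_exp (mul_nonneg ha (add_nonneg (he x) (he y)))

/-- The error in the law of large numbers for `K` blocks, each made of an active time `w` and of
a gap `g`. -/
def blockError (N : ℕ) (a : ℝ) (w g K : ℕ) : ℝ :=
  K * ((N + 1) * momentBound N a g)
    + K ^ 2 * (2 * ((N + 1) ^ 2 * (((2 : ℝ) ^ N)⁻¹ * momentBound N a w)))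
    + (K + (1 + K * ((2 : ℝ) ^ N)⁻¹) * ((N + 1) ^ 2 * momentBound N a w))
    + K * (1 + (N + 1) ^ 4 * (((2 : ℝ) ^ N)⁻¹ * momentBound N a w))

lemma inv_two_pow_le_one (N : ℕ) : ((2 : ℝ) ^ N)⁻¹ ≤ 1 :=
  inv_le_one_of_one_le₀ (one_le_pow₀ (by norm_num))

/-- The quenched law of large numbers averaged over the environment, plus the cost of replacing the
quenched window mean by its average. Nonnegativity of the energies supplies the mixing, with gap g ≥
2N and η = 2^(-N). -/
lemma annealedExp_abs_discCount_sub_le {a : ℝ} (ha : 0 ≤ a) (hN : 1 ≤ N) {q : ℕ}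
    (hq : 2 * N ≤ q) (w : ℕ) {g : ℕ} (hg : 2 * N ≤ g) {K : ℕ} (hK : 1 ≤ K) :
    annealedExp N a q (K * (w + g) * q) (fun ω => |discCount (K * (w + g) * q) ω
      - K * annealedExp N a q (w * q) (discCount (w * q))|) ≤ blockError N a w g K := by
  have hq1 : 1 ≤ q := by omega
  rw [show K * (w + g) * q = K * (w * q + g * q) by ring]
  set n := K * (w * q + g * q) with hn
  set mbar := annealedExp N a q (w * q) (discCount (w * q)) with hmbar
  set m : (V N → ℝ) → ℝ := fun e => statExp (stepKernel a e q) (w * q) (discCount (w * q)) with hm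
  have hmm : Measurable m := measurable_statExp_stepKernel a q _ _
  have hmb : ∀ e, |m e| ≤ 2 ^ N := fun e => abs_statExp_stepKernel_le a e q _ (abs_discCount_le _)
  obtain ⟨hgi, hgle⟩ := integrable_escapeMoment_and_le (N := N) a hq1 g
  obtain ⟨hwi, hwle⟩ := integrable_escapeMoment_and_le (N := N) a hq1 w
  have hvar := integral_sq_statExp_sub_annealedExp_le (N := N) a hq1 w
  have hvi : Integrable (fun e => (m e - mbar) ^ 2) (envLaw N) :=
    integrable_sq_of_bounded (hmm.sub measurable_const) (C := 2 ^ N + |mbar|)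
      fun e => (abs_sub _ _).trans (add_le_add (hmb e) le_rfl)
  have hpt : ∀ᵐ e ∂(envLaw N), statExp (stepKernel a e q) n (fun ω => |discCount n ω - K * mbar|)
      ≤ K * ((N + 1) * escapeMoment (stepKernel a e q) (g * q))
        + K ^ 2 * (2 * ((N + 1) ^ 2 * (((2 : ℝ) ^ N)⁻¹ * escapeMoment (stepKernel a e q) (w * q))))
        + (K + (1 + K * ((2 : ℝ) ^ N)⁻¹)
          * ((N + 1) ^ 2 * escapeMoment (stepKernel a e q) (w * q)))
        + K * (1 + (m e - mbar) ^ 2) := by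
    filter_upwards [ae_nonneg_envLaw N] with e he
    have hA := isSymmStochastic_stepKernel a e q
    have h1 := statExp_abs_discCount_sub_le hA (W := w * q) (G := g * q) (η := ((2 : ℝ) ^ N)⁻¹)
      (fun k hk => stepKernel_pow_le hN hq (one_le_rate ha he)
        ((Nat.mul_le_mul_right q hg).trans hk)) hK
      (by have : 1 ≤ g * q := Nat.one_le_iff_ne_zero.2 (Nat.mul_ne_zero (by omega) (by omega))
          omega) (inv_two_pow_le_one N) (by positivity)
    calc _ ≤ statExp (stepKernel a e q) n (fun ω => |discCount n ω - K * m e|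
            + |K * m e - K * mbar|) := statExp_mono hA n fun ω => abs_sub_le _ _ _
      _ ≤ _ := by
          rw [statExp_add, statExp_const hA]
          refine add_le_add h1 ?_
          -- The bound |u| ≤ 1 + u² brings in the variance given by Efron–Stein; the 1 is harmless
          -- because the window mean is large.
          rw [← mul_sub, abs_mul, abs_of_nonneg (by positivity : (0 : ℝ) ≤ K)]
          gcongr
          nlinarith [sq_abs (m e - mbar), sq_nonneg (|m e - mbar| - 1), abs_nonneg (m e - mbar)]
  have hi1 := (hgi.const_mul ((N : ℝ) + 1)).const_mul (K : ℝ)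
  have hi2 := (((hwi.const_mul ((2 : ℝ) ^ N)⁻¹).const_mul (((N : ℝ) + 1) ^ 2)).const_mul
    2).const_mul ((K : ℝ) ^ 2)
  have hi3 : Integrable (fun e : V N → ℝ => (K : ℝ) + (1 + K * ((2 : ℝ) ^ N)⁻¹)
          * ((N + 1) ^ 2 * escapeMoment (stepKernel a e q) (w * q))) (envLaw N) :=
    (integrable_const _).add ((hwi.const_mul _).const_mul _)
  have hi4 : Integrable (fun e : V N → ℝ => (K : ℝ) * (1 + (m e - mbar) ^ 2)) (envLaw N) :=
    ((integrable_const _).add hvi).const_mul _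
  refine (integral_mono_ae (integrable_statExp_stepKernel a q n (C := 2 ^ N + |K * mbar|)
    fun ω => ?_) (((hi1.add hi2).add hi3).add hi4) hpt).trans ?_
  · rw [abs_abs]
    exact (abs_sub _ _).trans (add_le_add (abs_discCount_le n ω) le_rfl)
  · rw [integral_add' ((hi1.add hi2).add hi3) hi4, integral_add' (hi1.add hi2) hi3,
      integral_add' hi1 hi2]
    simp only [integral_const_mul]
    rw [integral_add (integrable_const _) ((hwi.const_mul _).const_mul _),
      integral_add (integrable_const _) hvi]
    simp only [integral_const_mul, integral_const, probReal_univ, smul_eq_mul, one_mul]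
    unfold blockError
    gcongr

lemma le_annealedExp_discCount {a : ℝ} (ha : 0 ≤ a) (hN : 1 ≤ N) {q : ℕ}
    (hq : 2 * N ≤ q) {g : ℕ} (hg : 2 * N ≤ g) (v : ℕ) :
    (v + 1 : ℝ) - 2 * (v + 1) ^ 2 * ((2 : ℝ) ^ N)⁻¹
      ≤ annealedExp N a q (v * g * q) (discCount (v * g * q)) := by
  have h : ∀ᵐ e ∂(envLaw N), (v + 1 : ℝ) - 2 * (v + 1) ^ 2 * ((2 : ℝ) ^ N)⁻¹
      ≤ statExp (stepKernel a e q) (v * g * q) (discCount (v * g * q)) := by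
    filter_upwards [ae_nonneg_envLaw N] with e he
    exact le_statExp_discCount (isSymmStochastic_stepKernel a e q) (G := g * q)
      (fun k hk => stepKernel_pow_le hN hq (one_le_rate ha he)
        ((Nat.mul_le_mul_right q hg).trans hk)) (mul_assoc v g q) (inv_two_pow_le_one N)
  have := integral_mono_ae (integrable_const _)
    (integrable_statExp_stepKernel a q _ (abs_discCount_le _)) h
  rwa [integral_const, probReal_univ, one_smul] at this

end Annealed

/-! ### The transition matrices -/

section Transition

variable {N : ℕ}

lemma generator_sum (a : ℝ) (e : V N → ℝ) (x : V N) : ∑ y, generator a e x y = 0 := by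
  have h : ∀ y, generator a e x y
      = rate a e x y + if x = y then -∑ z, rate a e x z else 0 := by
    intro y
    by_cases h : x = y
    · subst h; simp [generator, rate_self]
    · simp [generator, h]
  simp [h, Finset.sum_add_distrib]

attribute [local instance] Matrix.linftyOpNormedRing Matrix.linftyOpNormedAlgebra

lemma hasSum_matrix_exp {S : Type*} [Fintype S] [DecidableEq S] (M : Matrix S S ℝ) (x y : S) :
    HasSum (fun n : ℕ => ((n.factorial : ℝ)⁻¹) * (M ^ n) x y) (NormedSpace.exp M x y) := by
  have h := NormedSpace.exp_series_hasSum_exp' (𝕂 := ℝ) M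
  have h2 := (Pi.hasSum.1 ((Pi.hasSum.1 h) x)) y
  exact h2

/-- Adding a multiple of the identity makes M entrywise nonnegative, so the exponential series is
too; the shift commutes with M and only contributes a positive scalar. -/
lemma matrix_exp_nonneg {S : Type*} [Fintype S] [DecidableEq S] {M : Matrix S S ℝ}
    (hM : ∀ x y, x ≠ y → 0 ≤ M x y) (x y : S) : 0 ≤ NormedSpace.exp M x y := by
  obtain ⟨c, hc⟩ : ∃ c : ℝ, ∀ x, 0 ≤ M x x + c := by
    refine ⟨∑ x, |M x x|, fun x => ?_⟩
    have := Finset.single_le_sum (f := fun x => |M x x|) (fun _ _ => abs_nonneg _)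
      (Finset.mem_univ x)
    linarith [neg_abs_le (M x x)]
  have hcomm : Commute (M + c • (1 : Matrix S S ℝ)) (Matrix.diagonal fun _ => -c) := by
    rw [← Matrix.smul_one_eq_diagonal]
    exact (Commute.one_right _).smul_right _
  have e : M = (M + c • (1 : Matrix S S ℝ)) + Matrix.diagonal fun _ => -c := by
    rw [← Matrix.smul_one_eq_diagonal, neg_smul]; abel
  rw [e, Matrix.exp_add_of_commute _ _ hcomm, Matrix.exp_diagonal, Matrix.mul_diagonal]
  refine mul_nonneg ?_ ?_
  · refine (hasSum_matrix_exp _ x y).nonneg fun n => mul_nonneg (by positivity) ?_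
    have hB : ∀ x y, 0 ≤ (M + c • (1 : Matrix S S ℝ)) x y := by
      intro x y
      by_cases h : x = y
      · subst h; simpa using hc x
      · simpa [h] using hM x y h
    induction n generalizing x y with
    | zero => rw [pow_zero, Matrix.one_apply]; split_ifs <;> norm_num
    | succ n ih =>
      rw [pow_succ, Matrix.mul_apply]
      exact Finset.sum_nonneg fun z _ => mul_nonneg (ih x z) (hB z y)
  · rw [Pi.coe_exp, ← Real.exp_eq_exp_ℝ]
    exact (Real.exp_pos _).le

lemma transition_nonneg (a : ℝ) (e : V N → ℝ) {t : ℝ} (ht : 0 ≤ t) (x y : V N) :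
    0 ≤ transition a e t x y := by
  refine matrix_exp_nonneg (fun x y h => ?_) x y
  simp only [Matrix.smul_apply, smul_eq_mul, generator, Matrix.of_apply, if_neg h]
  exact mul_nonneg ht (rate_nonneg a e x y)

lemma transition_sum (a : ℝ) (e : V N → ℝ) (t : ℝ) (x : V N) :
    ∑ y, transition a e t x y = 1 := by
  have hpow : ∀ n : ℕ, n ≠ 0 → ∑ y, ((t • generator a e) ^ n) x y = 0 := by
    intro n hn
    obtain ⟨n, rfl⟩ := Nat.exists_eq_succ_of_ne_zero hn
    simp only [Nat.succ_eq_add_one, pow_succ, Matrix.mul_apply]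
    rw [Finset.sum_comm]
    refine Finset.sum_eq_zero fun z _ => ?_
    simp only [← Finset.mul_sum, Matrix.smul_apply, smul_eq_mul, generator_sum, mul_zero]
  have h1 := hasSum_sum fun y (_ : y ∈ Finset.univ) => hasSum_matrix_exp (t • generator a e) x y
  simp only [← Finset.mul_sum] at h1
  have h2 := hasSum_single (f := fun n : ℕ =>
    ((n.factorial : ℝ)⁻¹) * ∑ y, ((t • generator a e) ^ n) x y) 0
    (fun n hn => by rw [hpow n hn, mul_zero])
  refine h1.unique (by simpa [Matrix.one_apply] using h2)

lemma continuous_transition (a t : ℝ) (x y : V N) :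
    Continuous fun e : V N → ℝ => transition a e t x y := by
  have hr : ∀ x y, Continuous fun e : V N → ℝ => rate a e x y := fun x y => by
    unfold rate; split_ifs <;> fun_prop
  have hg : Continuous fun e : V N → ℝ => generator a e := by
    refine continuous_matrix fun x y => ?_
    simp only [generator, Matrix.of_apply]
    split_ifs
    · exact (continuous_finsetSum _ fun z _ => hr x z).neg
    · exact hr x y
  have h := (NormedSpace.exp_continuous (𝔸 := Matrix (V N) (V N) ℝ)).comp (hg.const_smul t)
  exact h.matrix_elem x y

lemma tendsto_transition (a : ℝ) (e : V N → ℝ) (x y : V N) :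
    Tendsto (fun q : ℕ => (q : ℝ) * (transition a e (1 / q) x y - (1 : Matrix (V N) (V N) ℝ) x y))
      atTop (𝓝 (generator a e x y)) := by
  have h := hasDerivAt_exp_smul_const (𝕂 := ℝ) (generator a e) (0 : ℝ)
  rw [hasDerivAt_iff_tendsto_slope_zero] at h
  simp only [zero_smul, NormedSpace.exp_zero, one_mul, zero_add] at h
  have hq : Tendsto (fun q : ℕ => (1 / q : ℝ)) atTop (𝓝[≠] 0) := by
    rw [tendsto_nhdsWithin_iff]
    refine ⟨tendsto_one_div_atTop_nhds_zero_nat, ?_⟩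
    filter_upwards [eventually_gt_atTop 0] with q hq
    have : (q : ℝ) ≠ 0 := by positivity
    simpa using this
  have h2 := h.comp hq
  have h3 := ((continuous_id.matrix_elem x y).tendsto (generator a e)).comp h2
  refine h3.congr fun q => ?_
  simp only [Function.comp_apply, id, one_div, inv_inv]
  rfl

/-- For a fixed environment the cap is inactive once q is large, so the discretized chain has
exactly the right generator. -/
lemma eventually_stepKernel_eq (a : ℝ) (e : V N → ℝ) (hN : 1 ≤ N) (x y : V N) :
    ∀ᶠ q : ℕ in atTop, (q : ℝ) * (stepKernel a e q x y - (1 : Matrix (V N) (V N) ℝ) x y)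
      = generator a e x y := by
  have hN0 : (0 : ℝ) < N := by exact_mod_cast hN
  have hr : ∀ z, ∀ᶠ q : ℕ in atTop, (q : ℝ) * stepRate a e q x z = rate a e x z := by
    intro z
    obtain ⟨n, hn⟩ := exists_nat_ge (2 * N * rate a e x z)
    filter_upwards [eventually_ge_atTop n, eventually_gt_atTop 0] with q hq hq0
    have hq0' : (0 : ℝ) < q := by exact_mod_cast hq0
    have hq' : (n : ℝ) ≤ q := by exact_mod_cast hq
    rw [stepRate, min_eq_left]
    · field_simp
    · rw [div_le_div_iff₀ hq0' (by positivity)]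
      linarith
  filter_upwards [eventually_all.2 hr] with q hq
  by_cases h : x = y
  · subst h
    simp only [stepKernel_self, Matrix.one_apply_eq, generator, Matrix.of_apply, if_true]
    rw [← Finset.sum_congr rfl fun z _ => hq z, ← Finset.mul_sum]
    ring
  · simp only [stepKernel_of_ne a e q h, Matrix.one_apply_ne h, generator, Matrix.of_apply,
      if_neg h, sub_zero, hq]

/-- One step of either matrix is 1 + generator/q up to o(1/q). Over τq steps the accumulated error
in `abs_pathExp_sub_le` therefore tends to 0. -/
lemma tendsto_statExp_transition_sub (a : ℝ) (e : V N → ℝ) (hN : 1 ≤ N) (τ : ℕ)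
    {G : ℕ → (ℕ → V N) → ℝ} {C : ℝ} (hC : 0 ≤ C) (hG : ∀ q ω, |G q ω| ≤ C) :
    Tendsto (fun q : ℕ => statExp (transition a e (1 / q)) (τ * q) (G q)
      - statExp (stepKernel a e q) (τ * q) (G q)) atTop (𝓝 0) := by
  set d : ℕ → ℝ := fun q => ∑ x, ∑ y, |transition a e (1 / q) x y - stepKernel a e q x y| with hd
  have hd0 : Tendsto (fun q : ℕ => q * d q) atTop (𝓝 0) := by
    have h1 : ∀ x y, Tendsto (fun q : ℕ => (q : ℝ)
        * |transition a e (1 / q) x y - stepKernel a e q x y|) atTop (𝓝 0) := by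
      intro x y
      have h := (tendsto_transition a e x y).sub_const (generator a e x y)
      rw [sub_self] at h
      have h' := h.abs
      rw [abs_zero] at h'
      refine h'.congr' ?_
      filter_upwards [eventually_stepKernel_eq a e hN x y] with q hq
      rw [← hq, ← mul_sub, abs_mul, Nat.abs_cast]
      congr 2
      ring
    have h2 := tendsto_finsetSum Finset.univ fun x _ => tendsto_finsetSum Finset.univ
      fun y _ => h1 x y
    simp only [Finset.sum_const_zero] at h2
    refine h2.congr fun q => ?_
    simp only [hd, Finset.mul_sum]
  have hbound : Tendsto (fun q : ℕ => τ * C * (q * d q)) atTop (𝓝 0) := by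
    simpa using hd0.const_mul (τ * C)
  refine squeeze_zero_norm (fun q => ?_) hbound
  have hS := isSymmStochastic_stepKernel a e q
  have hrow : ∀ x, ∑ y, |transition a e (1 / q) x y - stepKernel a e q x y| ≤ d q := fun x =>
    Finset.single_le_sum (f := fun x =>
      ∑ y, |transition a e (1 / q) x y - stepKernel a e q x y|)
      (fun _ _ => Finset.sum_nonneg fun _ _ => abs_nonneg _) (Finset.mem_univ x)
  have hp := abs_pathExp_sub_le (transition_nonneg a e (by positivity : (0 : ℝ) ≤ 1 / q))
    (transition_sum a e (1 / q)) hS.nonneg hS.row_sum hrow hC (τ * q) (hG q)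
  rw [Real.norm_eq_abs, statExp, statExp, ← mul_sub, ← Finset.sum_sub_distrib, abs_mul,
    abs_of_nonneg (by positivity : (0 : ℝ) ≤ (Fintype.card (V N) : ℝ)⁻¹)]
  calc _ ≤ (Fintype.card (V N) : ℝ)⁻¹ * ∑ _y : V N, ((τ * q : ℕ) : ℝ) * d q * C := by
        gcongr
        exact (Finset.abs_sum_le_sum_abs _ _).trans (Finset.sum_le_sum fun y _ => hp y)
    _ = _ := by
        rw [Finset.sum_const, nsmul_eq_mul, Finset.card_univ, ← mul_assoc,
          inv_mul_cancel₀ (by rw [card_V]; positivity), one_mul]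
        push_cast
        ring

end Transition

/-! ### Discrete skeletons of the walk -/

section Skeleton

/-- A finite path, extended by its last position. -/
def extendPath {S : Type*} {n : ℕ} (x : Fin (n + 1) → S) : ℕ → S :=
  fun i => x ⟨min i n, by omega⟩

lemma extendPath_cons {S : Type*} {n : ℕ} (y : S) (x : Fin (n + 1) → S) :
    extendPath (Fin.cons y x : Fin (n + 2) → S) = consPath y (extendPath x) := by
  funext i
  cases i with
  | zero => rfl
  | succ i =>
    simp only [extendPath, consPath_succ]
    have : (⟨min (i + 1) (n + 1), by omega⟩ : Fin (n + 2)) = Fin.succ ⟨min i n, by omega⟩ := by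
      ext; simp
    rw [this, Fin.cons_succ]

/-- Unfolds the recursion into a sum over finite paths, the form in which `quenchedProb` gives the
law of the walk. -/
lemma sum_paths_cons {S : Type*} [Fintype S] (A : Matrix S S ℝ) : ∀ (n : ℕ) (G : (ℕ → S) → ℝ),
    ∑ y, pathExp A n G y = ∑ x : Fin (n + 1) → S,
      (∏ i : Fin n, A (x i.castSucc) (x i.succ)) * G (extendPath x)
  | 0, G => by
      rw [← Equiv.sum_comp (Equiv.funUnique (Fin 1) S).symm]
      refine Finset.sum_congr rfl fun y _ => ?_
      simp only [pathExp, Finset.univ_eq_empty, Finset.prod_empty, one_mul]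
      rfl
  | n + 1, G => by
      have key : ∀ (y : S) (H : (ℕ → S) → ℝ) (f : S → ℝ), ∑ z, f z * pathExp A n H z
          = ∑ x : Fin (n + 1) → S, f (x 0)
            * ((∏ i : Fin n, A (x i.castSucc) (x i.succ)) * H (extendPath x)) := by
        intro y H f
        have h1 := sum_paths_cons A n fun ω => f (ω 0) * H ω
        have h2 : ∀ z, pathExp A n (fun ω => f (ω 0) * H ω) z = f z * pathExp A n H z := by
          intro z
          cases n with
          | zero => rfl
          | succ n => simp only [pathExp, consPath_zero, pathExp_const_mul, Finset.mul_sum]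
                      exact Finset.sum_congr rfl fun w _ => by ring
        simp only [h2] at h1
        rw [h1]
        refine Finset.sum_congr rfl fun x _ => ?_
        have : extendPath x 0 = x 0 := by simp [extendPath]
        rw [this]; ring
      rw [← Equiv.sum_comp (Fin.consEquiv fun _ : Fin (n + 2) => S), Fintype.sum_prod_type]
      refine Finset.sum_congr rfl fun y _ => ?_
      simp only [pathExp]
      rw [key y]
      refine Finset.sum_congr rfl fun x _ => ?_
      simp only [Fin.consEquiv, Equiv.coe_fn_mk]
      rw [extendPath_cons, Fin.prod_univ_succ, ← mul_assoc]
      rfl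

variable {N : ℕ} {Ω : Type*} {X : ℝ≥0 → Ω → V N}

/-- The positions of the walk at the multiples of `1 / q`. -/
def skeleton (X : ℝ≥0 → Ω → V N) (q : ℕ) (ω : Ω) : ℕ → V N := fun i => X (i / q) ω

lemma ncard_eq_sum {S : Type*} [Fintype S] (s : Set S) [DecidablePred (· ∈ s)] :
    (s.ncard : ℝ) = ∑ x, if x ∈ s then (1 : ℝ) else 0 := by
  rw [Set.ncard_eq_toFinset_card', ← Finset.sum_filter, Finset.sum_const, nsmul_eq_mul, mul_one]
  congr 2
  ext x
  simp

/-- By right-continuity, a fine enough skeleton of a path discovers the same sites. -/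
lemma eventually_discCount_skeleton {ω : Ω} (hω : ∀ s, ∀ᶠ r in 𝓝[≥] s, X r ω = X s ω) (τ : ℕ) :
    ∀ᶠ q : ℕ in atTop, discCount (τ * q) (skeleton X q ω) = numDiscovered X τ ω := by
  classical
  have key : ∀ x : V N, ∀ᶠ q : ℕ in atTop, ((∃ i ≤ τ * q, hammingDist (skeleton X q ω i) x ≤ 1) ↔
      x ∈ discovered (fun s => X s ω) τ) := by
    intro x
    by_cases hx : x ∈ discovered (fun s => X s ω) τ
    · obtain ⟨s, hs, hd⟩ := hx
      obtain ⟨u, hu, hsub⟩ := mem_nhdsGE_iff_exists_Ico_subset.1 (hω s)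
      have hu' : (0 : ℝ) < u - s := by
        have : (s : ℝ) < u := by exact_mod_cast hu
        linarith
      obtain ⟨n, hn⟩ := exists_nat_gt (1 / (u - s : ℝ))
      filter_upwards [eventually_ge_atTop n, eventually_gt_atTop 0] with q hq hq0
      have hq0' : (0 : ℝ) < q := by exact_mod_cast hq0
      -- A site discovered at time s is still in reach at the next grid point ⌈sq⌉/q, once 1/q is
      -- below the time during which the path stays put. As τ is an integer, that grid point does
      -- not exceed τ.
      refine ⟨fun _ => ⟨s, hs, hd⟩, fun _ => ⟨⌈(s : ℝ) * q⌉₊, ?_, ?_⟩⟩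
      · refine Nat.ceil_le.2 ?_
        push_cast
        gcongr
      · have hmem : ((⌈(s : ℝ) * q⌉₊ : ℝ≥0) / q) ∈ Set.Ico s u := by
          constructor
          · rw [← NNReal.coe_le_coe]
            push_cast
            rw [le_div_iff₀ hq0']
            exact Nat.le_ceil _
          · rw [← NNReal.coe_lt_coe]
            push_cast
            rw [div_lt_iff₀ hq0']
            have h1 := Nat.ceil_lt_add_one (by positivity : 0 ≤ (s : ℝ) * q)
            have h2 : 1 < (u - s : ℝ) * q := by
              have hq' : (n : ℝ) ≤ q := by exact_mod_cast hq
              have := (div_lt_iff₀ hu').1 (hn.trans_le hq')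
              linarith
            linarith
        have := hsub hmem
        simp only [Set.mem_ofPred_eq] at this
        simp only [skeleton, this]
        exact hd
    · filter_upwards [eventually_gt_atTop 0] with q hq0
      have hq0' : (0 : ℝ) < q := by exact_mod_cast hq0
      refine ⟨fun ⟨i, hi, hd⟩ => ⟨i / q, ?_, hd⟩, fun h => absurd h hx⟩
      push_cast
      rw [div_le_iff₀ hq0']
      exact_mod_cast hi
  filter_upwards [eventually_all.2 key] with q hq
  rw [numDiscovered, ncard_eq_sum, discCount]
  refine Finset.sum_congr rfl fun x _ => ?_
  simp only [seen, hq x]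

lemma ncard_le_two_pow (s : Set (V N)) : (s.ncard : ℝ) ≤ 2 ^ N := by
  have h := Set.ncard_le_ncard (Set.subset_univ s) Set.finite_univ
  rw [Set.ncard_univ, Nat.card_eq_fintype_card] at h
  rw [← card_V N]
  exact_mod_cast h

variable [MeasurableSpace Ω] {P : Measure Ω} {a : ℝ} {E : Ω → V N → ℝ}

lemma measurable_skeleton_discCount (hX : ∀ s, Measurable (X s)) (q n : ℕ) (φ : ℝ → ℝ) :
    Measurable fun ω => φ (discCount n (skeleton X q ω)) := by
  let Z : Ω → Fin (n + 1) → V N := fun ω i => X ((i : ℕ) / q) ω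
  have hZ : Measurable Z := measurable_pi_lambda _ fun i => hX _
  have : (fun ω => φ (discCount n (skeleton X q ω)))
      = (fun x => φ (discCount n (extendPath x))) ∘ Z := by
    funext ω
    simp only [Function.comp_apply]
    congr 1
    refine dependsOn_discCount n fun i hi => ?_
    have hi' : min i n = i := min_eq_left hi
    simp only [skeleton, extendPath, Z, hi']
  rw [this]
  exact (measurable_of_finite _).comp hZ

lemma aemeasurable_numDiscovered_nat (hm : ∀ s, Measurable (X s))
    (hr : ∀ᵐ ω ∂P, ∀ s, ∀ᶠ r in 𝓝[≥] s, X r ω = X s ω) (τ : ℕ) :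
    AEMeasurable (fun ω => (numDiscovered X τ ω : ℝ)) P := by
  refine aemeasurable_of_tendsto_metrizable_ae atTop
    (fun q : ℕ => (measurable_skeleton_discCount hm q (τ * q) id).aemeasurable) ?_
  filter_upwards [hr] with ω hω
  exact tendsto_const_nhds.congr' ((eventually_discCount_skeleton hω τ).mono fun q hq => hq.symm)

/-- Rescaling time by T reduces a real horizon to the integer horizon 1, for which the count is a
limit of skeleton counts. -/
lemma aemeasurable_numDiscovered (hX : IsAnnealedWalk a P E X) {T : ℝ} (hT : 0 < T) :
    AEMeasurable (fun ω => (numDiscovered X T ω : ℝ)) P := by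
  let T' : ℝ≥0 := ⟨T, hT.le⟩
  have h := aemeasurable_numDiscovered_nat (X := fun s => X (T' * s)) (P := P)
    (fun s => hX.measurable_walk _) (by
      filter_upwards [hX.right_continuous] with ω hω s
      have ht : Tendsto (fun r => T' * r) (𝓝[≥] s) (𝓝[≥] (T' * s)) := by
        refine tendsto_nhdsWithin_iff.2 ⟨?_, ?_⟩
        · exact ((continuous_const_mul T').tendsto s).mono_left nhdsWithin_le_nhds
        · filter_upwards [self_mem_nhdsWithin] with r hr
          exact mul_le_mul_right hr T'
      exact ht.eventually (hω (T' * s))) 1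
  refine h.congr (Eventually.of_forall fun ω => ?_)
  simp only [numDiscovered]
  congr 2
  ext x
  simp only [discovered, Set.mem_ofPred_eq]
  constructor
  · rintro ⟨s, hs, hd⟩
    refine ⟨T' * s, ?_, hd⟩
    have : (T' : ℝ) * s ≤ T' * 1 := mul_le_mul_of_nonneg_left (by simpa using hs) hT.le
    rw [mul_one] at this
    exact this
  · rintro ⟨s, hs, hd⟩
    have hT0 : T' ≠ 0 := fun h => hT.ne' (congrArg NNReal.toReal h)
    refine ⟨s / T', ?_, by rwa [mul_div_cancel₀ _ hT0]⟩
    push_cast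
    rw [div_le_one (by exact hT)]
    exact hs

variable [IsProbabilityMeasure P]

lemma integral_skeleton (hX : IsAnnealedWalk a P E X) {q : ℕ} (hq : 1 ≤ q) (n : ℕ)
    {G : (ℕ → V N) → ℝ} (hG : DependsOn G (Set.Iic n)) :
    ∫ ω, G (skeleton X q ω) ∂P = ∫ e, statExp (transition a e (1 / q)) n G ∂(envLaw N) := by
  let s : Fin (n + 1) → ℝ≥0 := fun i => (i : ℕ) / q
  let Z : Ω → Fin (n + 1) → V N := fun ω i => X (s i) ω
  have hZ : Measurable Z := measurable_pi_lambda _ fun i => hX.measurable_walk _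
  have hs : Monotone s := fun i j h => by
    simp only [s]
    gcongr
    exact_mod_cast h
  have hstep : ∀ i : Fin n, (s i.succ : ℝ) - (s i.castSucc : ℝ) = 1 / q := fun i => by
    simp only [s, Fin.val_succ, Fin.val_castSucc]
    push_cast
    ring
  have hqp : ∀ (e : V N → ℝ) x, quenchedProb a e n s x = ((2 : ℝ) ^ N)⁻¹
      * ∏ i : Fin n, transition a e (1 / q) (x i.castSucc) (x i.succ) := fun e x => by
    simp only [quenchedProb, hstep]
  have hqp0 : ∀ (e : V N → ℝ) x, 0 ≤ quenchedProb a e n s x := fun e x => by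
    rw [hqp]
    exact mul_nonneg (by positivity) (Finset.prod_nonneg fun i _ =>
      transition_nonneg a e (by positivity) _ _)
  have hqm : ∀ x : Fin (n + 1) → V N, Measurable fun e => quenchedProb a e n s x := fun x => by
    simp only [hqp]
    exact (Finset.measurable_prod _ fun i _ =>
      (continuous_transition a (1 / q) _ _).measurable).const_mul _
  have hle1 : ∀ (e : V N → ℝ) x y, transition a e (1 / q : ℝ) x y ≤ 1 := fun e x y => by
    refine (Finset.single_le_sum (f := fun y => transition a e (1 / q : ℝ) x y)
      (fun y _ => transition_nonneg a e (by positivity) x y) (Finset.mem_univ y)).trans ?_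
    exact (transition_sum a e (1 / q) x).le
  have hqi : ∀ x : Fin (n + 1) → V N, Integrable (fun e => quenchedProb a e n s x) (envLaw N) := fun x =>
    integrable_of_bounded (hqm x) (C := 1) fun e : V N → ℝ => by
      rw [abs_of_nonneg (hqp0 e x), hqp]
      refine mul_le_one₀ (inv_two_pow_le_one N) (Finset.prod_nonneg fun i _ =>
        transition_nonneg a e (by positivity) _ _) ?_
      exact Finset.prod_le_one (fun i _ => transition_nonneg a e (by positivity) _ _)
        fun i _ => hle1 e _ _
  have hprob : ∀ x, (P.map Z).real {x} = ∫ e, quenchedProb a e n s x ∂(envLaw N) := by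
    intro x
    rw [measureReal_def, Measure.map_apply hZ (measurableSet_singleton x)]
    have h := hX.finite_dim Set.univ MeasurableSet.univ n s (by simp [s]) hs x
    have e1 : Z ⁻¹' {x} = {ω | E ω ∈ Set.univ ∧ ∀ i, X (s i) ω = x i} := by
      ext ω; simp [Z, funext_iff]
    rw [e1, h, Measure.restrict_univ, ← ofReal_integral_eq_lintegral_ofReal (hqi x)
      (Eventually.of_forall fun e => hqp0 e x),
      ENNReal.toReal_ofReal (integral_nonneg fun e => hqp0 e x)]
  have hGZ : ∀ ω, G (skeleton X q ω) = G (extendPath (Z ω)) := fun ω => by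
    refine hG fun i hi => ?_
    have hi' : min i n = i := min_eq_left hi
    simp only [skeleton, extendPath, Z, s, hi']
  simp only [hGZ]
  rw [← integral_map (φ := Z) (f := fun x => G (extendPath x)) hZ.aemeasurable
    (measurable_of_finite _).aestronglyMeasurable, integral_fintype Integrable.of_finite]
  simp only [hprob, smul_eq_mul]
  simp only [← integral_mul_const]
  rw [← integral_finsetSum _ fun x _ => (hqi x).mul_const _]
  refine integral_congr_ae (Eventually.of_forall fun e => ?_)
  simp only [statExp, sum_paths_cons, card_V, Finset.mul_sum, hqp, mul_assoc]

/-- The law of the number of discovered sites is the limit of its analogues for the discretized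
walks. -/
lemma tendsto_annealedExp_discCount (hX : IsAnnealedWalk a P E X) (hN : 1 ≤ N) (τ : ℕ)
    {φ : ℝ → ℝ} {C : ℝ} (hφ : ∀ u, 0 ≤ u → u ≤ 2 ^ N → |φ u| ≤ C) :
    Tendsto (fun q : ℕ => annealedExp N a q (τ * q) fun ω => φ (discCount (τ * q) ω)) atTop
      (𝓝 (∫ ω, φ (numDiscovered X τ ω) ∂P)) := by
  have hC : 0 ≤ C := (abs_nonneg _).trans (hφ 0 le_rfl (by positivity))
  have hG : ∀ (q : ℕ) (ω : ℕ → V N), |φ (discCount (τ * q) ω)| ≤ C := fun q ω =>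
    hφ _ (discCount_nonneg _ _) (discCount_le _ _)
  have h1 : Tendsto (fun q : ℕ => ∫ ω, φ (discCount (τ * q) (skeleton X q ω)) ∂P) atTop
      (𝓝 (∫ ω, φ (numDiscovered X τ ω) ∂P)) := by
    refine tendsto_integral_of_dominated_convergence (fun _ => C)
      (fun q => (measurable_skeleton_discCount hX.measurable_walk q (τ * q) φ).aestronglyMeasurable)
      (integrable_const _) (fun q => Eventually.of_forall fun ω => hG q _) ?_
    filter_upwards [hX.right_continuous] with ω hω
    exact tendsto_const_nhds.congr'
      ((eventually_discCount_skeleton hω τ).mono fun q hq => by simp only [hq])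
  have hti : ∀ q : ℕ, Integrable (fun e => statExp (transition a e (1 / q)) (τ * q)
      fun ω : ℕ → V N => φ (discCount (τ * q) ω)) (envLaw N) := fun q =>
    integrable_of_bounded (measurable_statExp (fun x y =>
      (continuous_transition a (1 / q) x y).measurable) _ _) fun e =>
        abs_statExp_le (transition_nonneg a e (by positivity)) (transition_sum a e _) _ (hG q)
  have hsi : ∀ q : ℕ, Integrable (fun e : V N → ℝ => statExp (stepKernel a e q) (τ * q)
      fun ω : ℕ → V N => φ (discCount (τ * q) ω)) (envLaw N) := fun q =>
    integrable_statExp_stepKernel a q _ (hG q)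
  -- The skeleton has transition matrix exp(Q/q) rather than `stepKernel`; for each environment the
  -- two means merge, and boundedness allows dominated convergence.
  have h2 : Tendsto (fun q : ℕ => ∫ e, (statExp (transition a e (1 / q)) (τ * q)
        (fun ω : ℕ → V N => φ (discCount (τ * q) ω))
      - statExp (stepKernel a e q) (τ * q) fun ω : ℕ → V N => φ (discCount (τ * q) ω))
      ∂(envLaw N)) atTop (𝓝 (∫ _, (0 : ℝ) ∂(envLaw N))) := by
    refine tendsto_integral_of_dominated_convergence (fun _ => C + C)
      (fun q => ((hti q).sub (hsi q)).aestronglyMeasurable)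
      (integrable_const _) (fun q => Eventually.of_forall fun e => ?_)
      (Eventually.of_forall fun e => tendsto_statExp_transition_sub a e hN τ hC hG)
    rw [Real.norm_eq_abs]
    refine (abs_sub _ _).trans (add_le_add ?_ (abs_statExp_stepKernel_le a e q _ (hG q)))
    exact abs_statExp_le (transition_nonneg a e (by positivity)) (transition_sum a e _) _ (hG q)
  have h3 := h1.sub h2
  simp only [integral_zero, sub_zero] at h3
  refine h3.congr' ?_
  filter_upwards [eventually_ge_atTop 1] with q hq
  have hd : DependsOn (fun ω : ℕ → V N => φ (discCount (τ * q) ω)) (Set.Iic (τ * q)) :=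
    fun ω ω' h => by simp only [dependsOn_discCount _ h]
  rw [integral_skeleton hX hq (τ * q) hd, integral_sub (hti q) (hsi q), annealedExp]
  ring

end Skeleton

/-! ### The law of large numbers for a fixed dimension -/

section FixedDimension

variable {N : ℕ} {a : ℝ} {Ω : Type*} {X : ℝ≥0 → Ω → V N}

lemma numDiscovered_mono {S T : ℝ} (h : S ≤ T) (ω : Ω) :
    (numDiscovered X S ω : ℝ) ≤ numDiscovered X T ω := by
  have : discovered (fun s => X s ω) S ⊆ discovered (fun s => X s ω) T :=
    fun x ⟨s, hs, hd⟩ => ⟨s, hs.trans h, hd⟩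
  exact_mod_cast Set.ncard_le_ncard this (Set.toFinite _)

lemma numDiscovered_le (T : ℝ) (ω : Ω) : (numDiscovered X T ω : ℝ) ≤ 2 ^ N :=
  ncard_le_two_pow _

variable [MeasurableSpace Ω] {P : Measure Ω} [IsProbabilityMeasure P] {E : Ω → V N → ℝ}

lemma integrable_numDiscovered (hX : IsAnnealedWalk a P E X) {T : ℝ} (hT : 0 < T) :
    Integrable (fun ω => (numDiscovered X T ω : ℝ)) P :=
  Integrable.of_bound (aemeasurable_numDiscovered hX hT).aestronglyMeasurable (2 ^ N)
    (Eventually.of_forall fun ω => by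
      rw [Real.norm_eq_abs, Nat.abs_cast]; exact numDiscovered_le T ω)

lemma integrable_abs_numDiscovered_sub (hX : IsAnnealedWalk a P E X) {T : ℝ} (hT : 0 < T)
    (c : ℝ) : Integrable (fun ω => |(numDiscovered X T ω : ℝ) - c|) P :=
  ((integrable_numDiscovered hX hT).sub (integrable_const c)).abs

lemma tendsto_annealedExp_meanDiscovered (hX : IsAnnealedWalk a P E X) (hN : 1 ≤ N) (τ : ℕ) :
    Tendsto (fun q : ℕ => annealedExp N a q (τ * q) (discCount (τ * q))) atTop
      (𝓝 (meanDiscovered P X τ)) :=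
  tendsto_annealedExp_discCount hX hN τ (φ := fun u => u) (C := 2 ^ N)
    fun u h0 h1 => by rwa [abs_of_nonneg h0]

/-- Limit q → ∞ in the discrete estimate, whose bound does not depend on q. The centring at step 1/q
is first exchanged for its limit, at a vanishing cost. -/
lemma integral_abs_numDiscovered_sub_le (hX : IsAnnealedWalk a P E X) (ha : 0 ≤ a) (hN : 1 ≤ N)
    (w : ℕ) {g : ℕ} (hg : 2 * N ≤ g) {K : ℕ} (hK : 1 ≤ K) :
    ∫ ω, |(numDiscovered X ((K * (w + g) : ℕ) : ℝ) ω : ℝ) - K * meanDiscovered P X w| ∂P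
      ≤ blockError N a w g K := by
  set m := meanDiscovered P X w with hm
  set mq : ℕ → ℝ := fun q => annealedExp N a q (w * q) (discCount (w * q)) with hmq
  have hlim : Tendsto mq atTop (𝓝 m) := tendsto_annealedExp_meanDiscovered hX hN w
  have h1 := tendsto_annealedExp_discCount hX hN (K * (w + g)) (φ := fun u => |u - K * m|)
    (C := 2 ^ N + |K * m|) fun u h0 h1 => by
      rw [abs_abs]
      exact (abs_sub _ _).trans (by rw [abs_of_nonneg h0]; linarith)
  have h2 : Tendsto (fun q => blockError N a w g K + |K * mq q - K * m|) atTop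
      (𝓝 (blockError N a w g K + |K * m - K * m|)) :=
    tendsto_const_nhds.add (((hlim.const_mul _).sub_const _).abs)
  rw [sub_self, abs_zero, add_zero] at h2
  refine le_of_tendsto_of_tendsto h1 h2 ?_
  filter_upwards [eventually_ge_atTop (2 * N)] with q hq
  have h3 := annealedExp_abs_discCount_sub_le ha hN hq w hg hK
  have hb : ∀ (c : ℝ) (ω : ℕ → V N), |(|discCount (K * (w + g) * q) ω - c|)| ≤ 2 ^ N + |c| := by
    intro c ω
    rw [abs_abs]
    exact (abs_sub _ _).trans (add_le_add (abs_discCount_le _ ω) le_rfl)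
  have hi := integrable_statExp_stepKernel (N := N) a q (K * (w + g) * q) (hb (K * mq q))
  calc annealedExp N a q (K * (w + g) * q) (fun ω => |discCount (K * (w + g) * q) ω - K * m|)
      ≤ ∫ e, (statExp (stepKernel a e q) (K * (w + g) * q)
          (fun ω => |discCount (K * (w + g) * q) ω - K * mq q|) + |K * mq q - K * m|)
          ∂(envLaw N) := by
        refine integral_mono (integrable_statExp_stepKernel a q _ (hb (K * m)))
          (hi.add (integrable_const _)) fun e => ?_
        have hA := isSymmStochastic_stepKernel a e q
        refine (statExp_mono hA _ fun ω => abs_sub_le _ (K * mq q) _).trans ?_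
        rw [statExp_add, statExp_const hA]
    _ ≤ _ := by
        rw [integral_add hi (integrable_const _)]
        simp only [integral_const, probReal_univ, smul_eq_mul, one_mul]
        exact add_le_add h3 le_rfl

lemma meanDiscovered_le (hX : IsAnnealedWalk a P E X) (hN : 1 ≤ N) (τ : ℕ) :
    meanDiscovered P X τ ≤ (N + 1) * momentBound N a τ := by
  refine le_of_tendsto (tendsto_annealedExp_meanDiscovered hX hN τ) ?_
  filter_upwards [eventually_ge_atTop 1] with q hq
  exact annealedExp_discCount_le a hq τ

lemma le_meanDiscovered (hX : IsAnnealedWalk a P E X) (ha : 0 ≤ a) (hN : 1 ≤ N) {g : ℕ}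
    (hg : 2 * N ≤ g) (v : ℕ) :
    (v + 1 : ℝ) - 2 * (v + 1) ^ 2 * ((2 : ℝ) ^ N)⁻¹ ≤ meanDiscovered P X ((v * g : ℕ) : ℝ) := by
  refine ge_of_tendsto (tendsto_annealedExp_meanDiscovered hX hN (v * g)) ?_
  filter_upwards [eventually_ge_atTop (2 * N)] with q hq
  exact le_annealedExp_discCount ha hN hq hg v

/-- The active time of a block in dimension `N`. -/
def activeTime (N : ℕ) : ℕ := N ^ 12 * (2 * N)

/-- The length of a block in dimension `N`. -/
def blockTime (N : ℕ) : ℕ := activeTime N + 2 * N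

/-- The relative error in the law of large numbers in dimension `N`, for a time made of `x`
blocks. -/
def relError (N : ℕ) (x : ℝ) : ℝ :=
  3000000 * ((N : ℝ)⁻¹ + (N : ℝ) ^ 61 * x * ((2 : ℝ) ^ N)⁻¹ + (N : ℝ) ^ 61 / x)

/-- Exponent 9 = 4 + 4 + 1: the fourth power of the time 2N, the factor N⁴, and the Gaussian moment,
at most N. For a window of length 2N^13 it becomes 52 + 4 + 1 = 57. -/
lemma momentBound_gap_le (hN : 1 ≤ N) (hexp : Real.exp (32 * a ^ 2) ≤ N) :
    momentBound N a (2 * N) ≤ 5000 * (N : ℝ) ^ 9 := by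
  have hn : (1 : ℝ) ≤ N := by exact_mod_cast hN
  have h9 : (1 : ℝ) ≤ (N : ℝ) ^ 9 := one_le_pow₀ hn
  unfold momentBound
  push_cast
  calc 8 + 128 * (2 * (N : ℝ)) ^ 4 * N ^ 4 * (1 + Real.exp (32 * a ^ 2))
      ≤ 8 * (N : ℝ) ^ 9 + 128 * (2 * (N : ℝ)) ^ 4 * N ^ 4 * (N + N) := by gcongr; linarith
    _ = 4104 * (N : ℝ) ^ 9 := by ring
    _ ≤ _ := by gcongr; norm_num

lemma momentBound_active_le (hN : 1 ≤ N) (hexp : Real.exp (32 * a ^ 2) ≤ N) :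
    momentBound N a (activeTime N) ≤ 5000 * (N : ℝ) ^ 57 := by
  have hn : (1 : ℝ) ≤ N := by exact_mod_cast hN
  have h57 : (1 : ℝ) ≤ (N : ℝ) ^ 57 := one_le_pow₀ hn
  unfold momentBound activeTime
  push_cast
  calc 8 + 128 * ((N : ℝ) ^ 12 * (2 * N)) ^ 4 * N ^ 4 * (1 + Real.exp (32 * a ^ 2))
      ≤ 8 * (N : ℝ) ^ 57 + 128 * ((N : ℝ) ^ 12 * (2 * N)) ^ 4 * N ^ 4 * (N + N) := by
        gcongr; linarith
    _ = 4104 * (N : ℝ) ^ 57 := by ring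
    _ ≤ _ := by gcongr; norm_num

lemma blockError_le (hN : 1 ≤ N) (hexp : Real.exp (32 * a ^ 2) ≤ N) {K : ℕ} (hK : 1 ≤ K) :
    blockError N a (activeTime N) (2 * N) K
      ≤ 140000 * ((N : ℝ) ^ 10 * K + ((2 : ℝ) ^ N)⁻¹ * (N : ℝ) ^ 61 * K ^ 2 + (N : ℝ) ^ 61) := by
  have hn : (1 : ℝ) ≤ N := by exact_mod_cast hN
  have hk : (1 : ℝ) ≤ K := by exact_mod_cast hK
  have h1 := momentBound_gap_le hN hexp
  have h2 := momentBound_active_le hN hexp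
  have h1' := momentBound_nonneg N a (2 * N)
  have h2' := momentBound_nonneg N a (activeTime N)
  set γ := ((2 : ℝ) ^ N)⁻¹ with hγ
  have hγ0 : 0 ≤ γ := by positivity
  set n : ℝ := (N : ℝ) with hnn
  set k : ℝ := (K : ℝ) with hkk
  have hn1 : n + 1 ≤ 2 * n := by linarith
  have t1 : k * ((n + 1) * momentBound N a (2 * N)) ≤ 10000 * (n ^ 10 * k) := by
    calc _ ≤ k * ((2 * n) * (5000 * n ^ 9)) := by gcongr
      _ = _ := by ring
  have t2 : k ^ 2 * (2 * ((n + 1) ^ 2 * (γ * momentBound N a (activeTime N))))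
      ≤ 40000 * (γ * n ^ 61 * k ^ 2) := by
    calc _ ≤ k ^ 2 * (2 * ((2 * n) ^ 2 * (γ * (5000 * n ^ 57)))) := by gcongr
      _ = 40000 * (γ * n ^ 59 * k ^ 2) := by ring
      _ ≤ _ := by gcongr; norm_num
  have t3 : (1 + k * γ) * ((n + 1) ^ 2 * momentBound N a (activeTime N))
      ≤ 20000 * n ^ 61 + 20000 * (γ * n ^ 61 * k ^ 2) := by
    calc _ ≤ (1 + k * γ) * ((2 * n) ^ 2 * (5000 * n ^ 57)) := by gcongr
      _ = 20000 * n ^ 59 + 20000 * (γ * n ^ 59 * k ^ 1) := by ring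
      _ ≤ _ := by gcongr <;> norm_num
  have t4 : k * ((n + 1) ^ 4 * (γ * momentBound N a (activeTime N)))
      ≤ 80000 * (γ * n ^ 61 * k ^ 2) := by
    calc _ ≤ k * ((2 * n) ^ 4 * (γ * (5000 * n ^ 57))) := by gcongr
      _ = 80000 * (γ * n ^ 61 * k ^ 1) := by ring
      _ ≤ _ := by gcongr; norm_num
  have t5 : k ≤ n ^ 10 * k := le_mul_of_one_le_left (by positivity) (one_le_pow₀ hn)
  have t6 : 0 ≤ n ^ 61 := by positivity
  have t7 : 0 ≤ γ * n ^ 61 * k ^ 2 := by positivity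
  unfold blockError
  rw [mul_add k 1]
  linarith

/-- At N^12 + 1 times spaced by the mixing time the walk occupies mostly distinct sites, and the
assumed size of 2^N makes the collision term at most 1. -/
lemma half_le_meanDiscovered (hX : IsAnnealedWalk a P E X) (ha : 0 ≤ a) (hN : 1 ≤ N)
    (h2N : 8 * (N : ℝ) ^ 24 ≤ 2 ^ N) :
    (N : ℝ) ^ 12 / 2 ≤ meanDiscovered P X (activeTime N) := by
  have hn : (1 : ℝ) ≤ N := by exact_mod_cast hN
  have h := le_meanDiscovered hX ha hN le_rfl (N ^ 12)
  refine le_trans ?_ h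
  push_cast
  have h12 : (1 : ℝ) ≤ (N : ℝ) ^ 12 := one_le_pow₀ hn
  have : 2 * ((N : ℝ) ^ 12 + 1) ^ 2 * ((2 : ℝ) ^ N)⁻¹ ≤ 1 := by
    rw [← div_eq_mul_inv, div_le_one (by positivity)]
    refine le_trans ?_ h2N
    have : ((N : ℝ) ^ 12 + 1) ^ 2 ≤ (2 * (N : ℝ) ^ 12) ^ 2 := by gcongr; linarith
    nlinarith
  linarith

lemma meanDiscovered_active_le (hX : IsAnnealedWalk a P E X) (hN : 1 ≤ N)
    (hexp : Real.exp (32 * a ^ 2) ≤ N) :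
    meanDiscovered P X (activeTime N) ≤ 10000 * (N : ℝ) ^ 58 := by
  have hn : (1 : ℝ) ≤ N := by exact_mod_cast hN
  refine (meanDiscovered_le hX hN _).trans ?_
  calc _ ≤ (2 * (N : ℝ)) * (5000 * (N : ℝ) ^ 57) := by
        have := momentBound_active_le hN hexp
        have := momentBound_nonneg N a (activeTime N)
        gcongr
        linarith
    _ = _ := by ring

/-- Monotonicity in time sandwiches T between K and K + 1 whole blocks, with K the integer part of
the number x of blocks. The rounding costs one window mean m, a relative error of order 1/x. -/
lemma integral_abs_numDiscovered_sub_le_relError (hX : IsAnnealedWalk a P E X) (ha : 0 ≤ a)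
    (hN : 1 ≤ N) (hexp : Real.exp (32 * a ^ 2) ≤ N) (h2N : 8 * (N : ℝ) ^ 24 ≤ 2 ^ N) {T : ℝ}
    (hT : 1 ≤ T / blockTime N) :
    ∫ ω, |(numDiscovered X T ω : ℝ)
        - T / blockTime N * meanDiscovered P X (activeTime N)| ∂P
      ≤ relError N (T / blockTime N) * (T / blockTime N * meanDiscovered P X (activeTime N)) := by
  have hn : (1 : ℝ) ≤ N := by exact_mod_cast hN
  have hb0 : (0 : ℝ) < blockTime N := by
    have : 0 < blockTime N := by unfold blockTime; omega
    exact_mod_cast this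
  have hT0 : 0 < T := by
    by_contra h
    have : T / blockTime N ≤ 0 := div_nonpos_of_nonpos_of_nonneg (not_lt.1 h) hb0.le
    linarith
  set m := meanDiscovered P X (activeTime N) with hm
  set x := T / blockTime N with hx
  have hTx : T = x * blockTime N := by rw [hx]; field_simp
  have hmlow := half_le_meanDiscovered hX ha hN h2N
  rw [← hm] at hmlow
  have hm0 : 0 ≤ m := le_trans (by positivity) hmlow
  set K := ⌊x⌋₊ with hKdef
  have hK : 1 ≤ K := Nat.le_floor (by simpa using hT)
  have hK1 : (K : ℝ) ≤ x := Nat.floor_le (by linarith)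
  have hK2 : x < K + 1 := Nat.lt_floor_add_one x
  have hK3 : (1 : ℝ) ≤ K := by exact_mod_cast hK
  have hA := integral_abs_numDiscovered_sub_le hX ha hN (activeTime N) (le_refl (2 * N)) hK
  have hB := integral_abs_numDiscovered_sub_le hX ha hN (activeTime N) (le_refl (2 * N))
    (by omega : 1 ≤ K + 1)
  have hEA := hA.trans (blockError_le hN hexp hK)
  have hEB := hB.trans (blockError_le hN hexp (by omega : 1 ≤ K + 1))
  rw [← hm] at hEA hEB
  set S1 : ℝ := ((K * (activeTime N + 2 * N) : ℕ) : ℝ) with hS1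
  set S2 : ℝ := (((K + 1) * (activeTime N + 2 * N) : ℕ) : ℝ) with hS2
  have eS1 : S1 = K * blockTime N := by rw [hS1]; unfold blockTime; push_cast; ring
  have eS2 : S2 = (K + 1) * blockTime N := by rw [hS2]; unfold blockTime; push_cast; ring
  have hS1T : S1 ≤ T := by rw [eS1, hTx]; gcongr
  have hS2T : T ≤ S2 := by rw [eS2, hTx]; gcongr
  have hS1p : 0 < S1 := by rw [eS1]; positivity
  have hS2p : 0 < S2 := by rw [eS2]; positivity
  have hpt : ∀ ω, |(numDiscovered X T ω : ℝ) - x * m| ≤ |(numDiscovered X S1 ω : ℝ) - K * m|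
      + |(numDiscovered X S2 ω : ℝ) - ((K + 1 : ℕ) : ℝ) * m| + m := by
    intro ω
    have d1 := numDiscovered_mono (X := X) hS1T ω
    have d2 := numDiscovered_mono (X := X) hS2T ω
    have x1 : K * m ≤ x * m := by gcongr
    have x2 : x * m ≤ (K + 1) * m := by gcongr
    have a1 := neg_abs_le ((numDiscovered X S1 ω : ℝ) - K * m)
    have a2 := le_abs_self ((numDiscovered X S2 ω : ℝ) - ((K + 1 : ℕ) : ℝ) * m)
    have a3 := abs_nonneg ((numDiscovered X S1 ω : ℝ) - K * m)
    have a4 := abs_nonneg ((numDiscovered X S2 ω : ℝ) - ((K + 1 : ℕ) : ℝ) * m)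
    push_cast at a2 a4 ⊢
    rw [abs_le]
    constructor <;> linarith
  have hi1 := integrable_abs_numDiscovered_sub hX hS1p (K * m)
  have hi2 := integrable_abs_numDiscovered_sub hX hS2p (((K + 1 : ℕ) : ℝ) * m)
  have hi12 : Integrable (fun ω => |(numDiscovered X S1 ω : ℝ) - K * m|
      + |(numDiscovered X S2 ω : ℝ) - ((K + 1 : ℕ) : ℝ) * m|) P := hi1.add hi2
  have hint : ∫ ω, |(numDiscovered X T ω : ℝ) - x * m| ∂P
      ≤ (∫ ω, |(numDiscovered X S1 ω : ℝ) - K * m| ∂P)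
        + (∫ ω, |(numDiscovered X S2 ω : ℝ) - ((K + 1 : ℕ) : ℝ) * m| ∂P) + m := by
    refine (integral_mono (integrable_abs_numDiscovered_sub hX hT0 _)
      (hi12.add (integrable_const m)) hpt).trans (le_of_eq ?_)
    rw [integral_add' hi12 (integrable_const m), integral_add hi1 hi2]
    simp
  refine hint.trans ?_
  set γ := ((2 : ℝ) ^ N)⁻¹ with hγ
  set n : ℝ := (N : ℝ) with hnn
  have hγ0 : 0 ≤ γ := by positivity
  have hn0 : 0 < n := by linarith
  have hx0 : 0 < x := by linarith
  have bA : 140000 * (n ^ 10 * K + γ * n ^ 61 * (K : ℝ) ^ 2 + n ^ 61)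
      ≤ 560000 * (n ^ 10 * x + γ * n ^ 61 * x ^ 2 + n ^ 61) := by
    have s1 : n ^ 10 * K ≤ n ^ 10 * x := by gcongr
    have s2 : γ * n ^ 61 * (K : ℝ) ^ 2 ≤ γ * n ^ 61 * x ^ 2 := by gcongr
    have s3 : 0 ≤ n ^ 10 * x := by positivity
    have s4 : 0 ≤ γ * n ^ 61 * x ^ 2 := by positivity
    have s5 : 0 ≤ n ^ 61 := by positivity
    linarith
  have bB : 140000 * (n ^ 10 * ((K + 1 : ℕ) : ℝ) + γ * n ^ 61 * ((K + 1 : ℕ) : ℝ) ^ 2 + n ^ 61)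
      ≤ 560000 * (n ^ 10 * x + γ * n ^ 61 * x ^ 2 + n ^ 61) := by
    have hk : ((K + 1 : ℕ) : ℝ) ≤ 2 * x := by push_cast; linarith
    have s1 : n ^ 10 * ((K + 1 : ℕ) : ℝ) ≤ n ^ 10 * (2 * x) := by gcongr
    have s2 : γ * n ^ 61 * ((K + 1 : ℕ) : ℝ) ^ 2 ≤ γ * n ^ 61 * (2 * x) ^ 2 := by gcongr
    have s3 : 0 ≤ n ^ 10 * x := by positivity
    have s4 : 0 ≤ γ * n ^ 61 * x ^ 2 := by positivity
    have s5 : 0 ≤ n ^ 61 := by positivity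
    nlinarith
  have hm1 : 1 / 2 ≤ m := by
    have : (1 : ℝ) ≤ n ^ 12 := one_le_pow₀ hn
    linarith
  -- Gap discoveries are of order N^10 per block while a window brings at least N^12/2 sites; this
  -- is why the window is N^12 times longer than the gap.
  have c1 : n ^ 10 * x ≤ 2 * n⁻¹ * (x * m) := by
    have h1 : n ^ 11 ≤ n ^ 12 := pow_le_pow_right₀ hn (by norm_num)
    have h2 : n ^ 10 = n⁻¹ * n ^ 11 := by field_simp
    calc n ^ 10 * x = 2 * n⁻¹ * (x * (n ^ 11 / 2)) := by rw [h2]; ring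
      _ ≤ _ := by gcongr; linarith
  have c2 : γ * n ^ 61 * x ^ 2 ≤ 2 * (n ^ 61 * x * γ) * (x * m) := by
    calc γ * n ^ 61 * x ^ 2 = 2 * (n ^ 61 * x * γ) * (x * (1 / 2)) := by ring
      _ ≤ _ := by gcongr
  have c3 : n ^ 61 ≤ 2 * (n ^ 61 / x) * (x * m) := by
    calc n ^ 61 = 2 * (n ^ 61 / x) * (x * (1 / 2)) := by field_simp
      _ ≤ _ := by gcongr
  have c4 : m ≤ n ^ 61 / x * (x * m) := by
    have : (1 : ℝ) ≤ n ^ 61 := one_le_pow₀ hn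
    calc m = 1 / x * (x * m) := by field_simp
      _ ≤ _ := by gcongr
  have c5 : 0 ≤ n⁻¹ * (x * m) := by positivity
  have c6 : 0 ≤ n ^ 61 * x * γ * (x * m) := by positivity
  have c7 : 0 ≤ n ^ 61 / x * (x * m) := by positivity
  unfold relError
  rw [← hγ, ← hnn]
  linarith

end FixedDimension

/-! ### Asymptotics -/

section Asymptotics

lemma eventually_exp_le {u : ℕ → ℝ} {c : ℝ} (hc : 0 < c) (hu : ∀ᶠ N : ℕ in atTop, 0 < u N)
    (h : (fun N : ℕ => Real.log (u N)) ~[atTop] fun N : ℕ => c * (N : ℝ)) {b : ℝ} (hb : b < c) :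
    ∀ᶠ N : ℕ in atTop, Real.exp b ^ N ≤ u N := by
  have h1 := h.isLittleO.def (c := (c - b) / c) (div_pos (by linarith) hc)
  filter_upwards [hu, h1] with N hN h2
  rw [← Real.exp_nat_mul, ← Real.le_log_iff_exp_le hN]
  simp only [Pi.sub_apply, Real.norm_eq_abs] at h2
  rw [abs_of_nonneg (by positivity : 0 ≤ c * (N : ℝ))] at h2
  have e : (c - b) / c * (c * N) = (c - b) * N := by field_simp
  rw [e] at h2
  have := neg_abs_le (Real.log (u N) - c * N)
  nlinarith

lemma eventually_le_exp {u : ℕ → ℝ} {c : ℝ} (hc : 0 < c) (hu : ∀ᶠ N : ℕ in atTop, 0 < u N)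
    (h : (fun N : ℕ => Real.log (u N)) ~[atTop] fun N : ℕ => c * (N : ℝ)) {b : ℝ} (hb : c < b) :
    ∀ᶠ N : ℕ in atTop, u N ≤ Real.exp b ^ N := by
  have h1 := h.isLittleO.def (c := (b - c) / c) (div_pos (by linarith) hc)
  filter_upwards [hu, h1] with N hN h2
  rw [← Real.exp_nat_mul, ← Real.log_le_iff_le_exp hN]
  simp only [Pi.sub_apply, Real.norm_eq_abs] at h2
  rw [abs_of_nonneg (by positivity : 0 ≤ c * (N : ℝ))] at h2
  have e : (b - c) / c * (c * N) = (b - c) * N := by field_simp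
  rw [e] at h2
  have := le_abs_self (Real.log (u N) - c * N)
  nlinarith

lemma blockTime_le {N : ℕ} (hN : 1 ≤ N) : (blockTime N : ℝ) ≤ 4 * (N : ℝ) ^ 13 := by
  have hn : (1 : ℝ) ≤ N := by exact_mod_cast hN
  have : (N : ℝ) ≤ (N : ℝ) ^ 13 := le_self_pow₀ hn (by norm_num)
  unfold blockTime activeTime
  push_cast
  have e : (N : ℝ) ^ 12 * (2 * N) = 2 * (N : ℝ) ^ 13 := by ring
  linarith

lemma one_le_blockTime {N : ℕ} (hN : 1 ≤ N) : (1 : ℝ) ≤ blockTime N := by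
  have : 1 ≤ blockTime N := by unfold blockTime; omega
  exact_mod_cast this

variable {u : ℕ → ℝ} {c : ℝ}

/-- The overlap error: as c < log 2, the number of blocks is exponentially smaller than the cube. -/
lemma tendsto_pow_mul_div_two_pow (hc0 : 0 < c) (hc2 : c < Real.log 2)
    (hu : ∀ᶠ N : ℕ in atTop, 0 < u N)
    (h : (fun N : ℕ => Real.log (u N)) ~[atTop] fun N : ℕ => c * (N : ℝ)) {t : ℝ} (ht : 0 < t) :
    Tendsto (fun N : ℕ => (N : ℝ) ^ 61 * (t * u N / blockTime N) * ((2 : ℝ) ^ N)⁻¹) atTop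
      (𝓝 0) := by
  obtain ⟨b, hb1, hb2⟩ := exists_between hc2
  have hr : |Real.exp b / 2| < 1 := by
    rw [abs_of_pos (by positivity), div_lt_one (by norm_num), ← Real.lt_log_iff_exp_lt (by norm_num)]
    exact hb2
  have hlim := (tendsto_pow_const_mul_const_pow_of_abs_lt_one 61 hr).const_mul t
  rw [mul_zero] at hlim
  refine tendsto_of_tendsto_of_tendsto_of_le_of_le' tendsto_const_nhds hlim ?_ ?_
  · filter_upwards [hu] with N hN
    positivity
  · filter_upwards [hu, eventually_le_exp hc0 hu h hb1, eventually_ge_atTop 1] with N hN h1 h2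
    calc (N : ℝ) ^ 61 * (t * u N / blockTime N) * ((2 : ℝ) ^ N)⁻¹
        ≤ (N : ℝ) ^ 61 * (t * Real.exp b ^ N) * ((2 : ℝ) ^ N)⁻¹ := by
          gcongr
          exact (div_le_self (by positivity) (one_le_blockTime h2)).trans (by gcongr)
      _ = t * ((N : ℝ) ^ 61 * (Real.exp b / 2) ^ N) := by rw [div_pow]; ring

/-- The fluctuation and rounding error: as c > 0, the number of blocks beats any power of N. The
exponent 74 is 61 plus the 13 of the block length. -/
lemma tendsto_pow_div (hc0 : 0 < c) (hu : ∀ᶠ N : ℕ in atTop, 0 < u N)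
    (h : (fun N : ℕ => Real.log (u N)) ~[atTop] fun N : ℕ => c * (N : ℝ)) {t : ℝ} (ht : 0 < t) :
    Tendsto (fun N : ℕ => (N : ℝ) ^ 61 / (t * u N / blockTime N)) atTop (𝓝 0) := by
  obtain ⟨b, hb1, hb2⟩ := exists_between hc0
  have hr : |Real.exp (-b)| < 1 := by
    rw [abs_of_pos (by positivity), Real.exp_lt_one_iff]
    linarith
  have hlim := (tendsto_pow_const_mul_const_pow_of_abs_lt_one 74 hr).const_mul (4 / t)
  rw [mul_zero] at hlim
  refine tendsto_of_tendsto_of_tendsto_of_le_of_le' tendsto_const_nhds hlim ?_ ?_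
  · filter_upwards [hu] with N hN
    positivity
  · filter_upwards [hu, eventually_exp_le hc0 hu h hb2, eventually_ge_atTop 1] with N hN h1 h2
    have hb0 := one_le_blockTime h2
    calc (N : ℝ) ^ 61 / (t * u N / blockTime N)
        = (N : ℝ) ^ 61 * blockTime N / (t * u N) := by field_simp
      _ ≤ (N : ℝ) ^ 61 * (4 * (N : ℝ) ^ 13) / (t * Real.exp b ^ N) := by
          gcongr
          exact blockTime_le h2
      _ = 4 / t * ((N : ℝ) ^ 74 * Real.exp (-b) ^ N) := by
          rw [Real.exp_neg, inv_pow]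
          field_simp

lemma tendsto_relError (hc0 : 0 < c) (hc2 : c < Real.log 2) (hu : ∀ᶠ N : ℕ in atTop, 0 < u N)
    (h : (fun N : ℕ => Real.log (u N)) ~[atTop] fun N : ℕ => c * (N : ℝ)) {t : ℝ} (ht : 0 < t) :
    Tendsto (fun N : ℕ => relError N (t * u N / blockTime N)) atTop (𝓝 0) := by
  have h1 := tendsto_pow_mul_div_two_pow hc0 hc2 hu h ht
  have h2 := tendsto_pow_div hc0 hu h ht
  have h3 := ((tendsto_inv_atTop_nhds_zero_nat (𝕜 := ℝ)).add h1).add h2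
  simpa [relError] using h3.const_mul 3000000

lemma eventually_one_le_blocks (hc0 : 0 < c) (hu : ∀ᶠ N : ℕ in atTop, 0 < u N)
    (h : (fun N : ℕ => Real.log (u N)) ~[atTop] fun N : ℕ => c * (N : ℝ)) {t : ℝ} (ht : 0 < t) :
    ∀ᶠ N : ℕ in atTop, 1 ≤ t * u N / blockTime N := by
  filter_upwards [(tendsto_pow_div hc0 hu h ht).eventually_lt_const zero_lt_one, hu,
    eventually_ge_atTop 1] with N h1 h2 h3
  have hn : (1 : ℝ) ≤ N := by exact_mod_cast h3
  have hb0 := one_le_blockTime h3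
  rw [div_lt_one (by positivity)] at h1
  exact (one_le_pow₀ hn).trans h1.le

lemma eventually_pow_le_two_pow : ∀ᶠ N : ℕ in atTop, 8 * (N : ℝ) ^ 24 ≤ 2 ^ N := by
  have h := tendsto_pow_const_mul_const_pow_of_abs_lt_one 24 (r := (2⁻¹ : ℝ))
    (by rw [abs_of_pos] <;> norm_num)
  filter_upwards [h.eventually_lt_const (by norm_num : (0 : ℝ) < 1 / 8)] with N hN
  rw [inv_pow, ← div_eq_mul_inv, div_lt_iff₀ (by positivity)] at hN
  linarith

/-- With a at most `Real.sqrt (2 * Real.log N) / 20`, the exponent 32a² is at most (64/400) log N,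
so all Gaussian moments in the proof are at most N. -/
lemma exp_mul_sq_le {N : ℕ} (hN : 1 ≤ N) {abar a : ℝ} (habar : abar < 1 / 20) (h1 : 1 ≤ a)
    (h2 : a ≤ abar * Real.sqrt (2 * Real.log N)) : Real.exp (32 * a ^ 2) ≤ N := by
  have hn : (1 : ℝ) ≤ N := by exact_mod_cast hN
  have hlog : 0 ≤ Real.log N := Real.log_nonneg hn
  set r := Real.sqrt (2 * Real.log N) with hr
  have hr0 : 0 ≤ r := Real.sqrt_nonneg _
  have hr2 : r ^ 2 = 2 * Real.log N := Real.sq_sqrt (by positivity)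
  have h3 : a ≤ r / 20 := h2.trans (by nlinarith)
  have h4 : a ^ 2 ≤ (r / 20) ^ 2 := pow_le_pow_left₀ (by linarith) h3 2
  rw [← Real.le_log_iff_exp_le (by linarith)]
  nlinarith

/-- Markov's inequality when the variable and the normalisation d are both compared with the same
reference value y; δ ≤ 1/2 ensures d ≥ y/2. -/
lemma measure_ge_le_of_integral_le {Ω : Type*} [MeasurableSpace Ω] {P : Measure Ω}
    [IsProbabilityMeasure P] {D : Ω → ℝ} (hD : Integrable D P) {y d δ δ' ε : ℝ} (hy : 0 < y)
    (hδ : δ ≤ 1 / 2) (hε : 0 < ε) (hd : |d - y| ≤ δ * y) (hDy : ∫ ω, |D ω - y| ∂P ≤ δ' * y) :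
    P {ω | ε ≤ |D ω / d - 1|} ≤ ENNReal.ofReal (2 * (δ + δ') / ε) := by
  have hd2 : y / 2 ≤ d := by nlinarith [neg_abs_le (d - y)]
  have hd0 : 0 < d := by linarith
  have hint : Integrable (fun ω => |D ω - d|) P := (hD.sub (integrable_const d)).abs
  have hint' : Integrable (fun ω => |D ω - y|) P := (hD.sub (integrable_const y)).abs
  have hsub : {ω | ε ≤ |D ω / d - 1|} ⊆ {ω | ε * d ≤ |D ω - d|} := by
    intro ω hω
    simp only [Set.mem_ofPred_eq] at hω ⊢
    have e : D ω / d - 1 = (D ω - d) / d := by field_simp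
    rw [e, abs_div, abs_of_pos hd0, le_div_iff₀ hd0] at hω
    exact hω
  have hI : ∫ ω, |D ω - d| ∂P ≤ (δ + δ') * y := by
    calc ∫ ω, |D ω - d| ∂P ≤ ∫ ω, (|D ω - y| + |y - d|) ∂P :=
          integral_mono hint (hint'.add (integrable_const _)) fun ω => abs_sub_le _ _ _
      _ = ∫ ω, |D ω - y| ∂P + |y - d| := by
          rw [integral_add hint' (integrable_const _)]; simp
      _ ≤ _ := by rw [abs_sub_comm y d]; linarith
  have hM := mul_meas_ge_le_integral_of_nonneg
    (Eventually.of_forall fun ω => abs_nonneg (D ω - d)) hint (ε * d)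
  refine (measure_mono hsub).trans ?_
  rw [← ENNReal.ofReal_toReal (measure_ne_top P {ω | ε * d ≤ |D ω - d|})]
  refine ENNReal.ofReal_le_ofReal ?_
  rw [le_div_iff₀ hε]
  have h1 : ε * (y / 2) * P.real {ω | ε * d ≤ |D ω - d|} ≤ (δ + δ') * y := by
    refine le_trans ?_ (hM.trans hI)
    gcongr
  rw [measureReal_def] at h1
  have h2 : (P {ω | ε * d ≤ |D ω - d|}).toReal * ε * y ≤ 2 * (δ + δ') * y := by linarith
  exact le_of_mul_le_mul_right h2 hy

end Asymptotics

end

end REM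

/-! ### Conclusion: the limit law and the growth of the mean -/

theorem theoremt
    (abar : ℝ) (habar : abar < 1 / 20)
    (a : ℕ → ℝ)
    (ha : ∀ᶠ N : ℕ in atTop, 1 ≤ a N ∧ a N ≤ abar * Real.sqrt (2 * Real.log N))
    (cbar : ℝ) (hcbar : cbar ∈ Set.Ioo 0 (Real.log 2))
    (tt : ℕ → ℝ) (htt_pos : ∀ᶠ N : ℕ in atTop, 0 < tt N)
    (htt : (fun N : ℕ => Real.log (tt N)) ~[atTop] (fun N : ℕ => cbar * (N : ℝ)))
    (Ω : ℕ → Type*) [∀ N, MeasurableSpace (Ω N)]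
    (P : ∀ N, Measure (Ω N)) [∀ N, IsProbabilityMeasure (P N)]
    (E : ∀ N, Ω N → REM.V N → ℝ) (X : ∀ N, ℝ≥0 → Ω N → REM.V N)
    (hX : ∀ N, REM.IsAnnealedWalk (a N) (P N) (E N) (X N)) :
    (∀ t : ℝ, 0 < t → ∀ ε : ℝ, 0 < ε →
      Tendsto (fun N : ℕ => P N {ω |
          ε ≤ |(REM.numDiscovered (X N) (t * tt N) ω : ℝ)
                / (t * REM.meanDiscovered (P N) (X N) (tt N)) - 1|})
        atTop (𝓝 0)) ∧
    (fun N : ℕ => Real.log (REM.meanDiscovered (P N) (X N) (tt N)))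
      ~[atTop] (fun N : ℕ => cbar * (N : ℝ)) := by
  obtain ⟨hc0, hc2⟩ := hcbar
  set m : ℕ → ℝ := fun N => REM.meanDiscovered (P N) (X N) (REM.activeTime N) with hm
  -- The common reference is x N * m N, blocks times window mean: it is linear in time, so t times
  -- it serves at time t * tt N.
  set x : ℕ → ℝ := fun N => tt N / REM.blockTime N with hx
  have hmlow : ∀ᶠ N : ℕ in atTop, (N : ℝ) ^ 12 / 2 ≤ m N := by
    filter_upwards [ha, eventually_ge_atTop 1, REM.eventually_pow_le_two_pow] with N h1 h2 h3
    exact REM.half_le_meanDiscovered (hX N) (by linarith [h1.1]) h2 h3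
  have hlln : ∀ t : ℝ, 0 < t → ∀ᶠ N : ℕ in atTop,
      ∫ ω, |(REM.numDiscovered (X N) (t * tt N) ω : ℝ) - t * (x N * m N)| ∂(P N)
        ≤ REM.relError N (t * tt N / REM.blockTime N) * (t * (x N * m N)) := by
    intro t ht
    filter_upwards [ha, eventually_ge_atTop 1, REM.eventually_pow_le_two_pow,
      REM.eventually_one_le_blocks hc0 htt_pos htt ht] with N h1 h2 h3 h4
    have := REM.integral_abs_numDiscovered_sub_le_relError (hX N) (by linarith [h1.1]) h2
      (REM.exp_mul_sq_le h2 habar h1.1 h1.2) h3 h4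
    have e : t * (x N * m N) = t * tt N / REM.blockTime N * m N := by simp only [hx]; ring
    rw [e]
    exact this
  have hmean : ∀ᶠ N : ℕ in atTop,
      |REM.meanDiscovered (P N) (X N) (tt N) - x N * m N|
        ≤ REM.relError N (1 * tt N / REM.blockTime N) * (x N * m N) := by
    filter_upwards [hlln 1 one_pos, htt_pos] with N h1 h2
    simp only [one_mul] at h1 ⊢
    have hi := REM.integrable_numDiscovered (hX N) h2
    refine le_trans ?_ h1
    have e : REM.meanDiscovered (P N) (X N) (tt N) - x N * m N
        = ∫ ω, ((REM.numDiscovered (X N) (tt N) ω : ℝ) - x N * m N) ∂(P N) := by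
      rw [integral_sub hi (integrable_const _)]
      simp [REM.meanDiscovered]
    rw [e]
    exact abs_integral_le_integral_abs
  have hxm : ∀ᶠ N : ℕ in atTop, 0 < x N * m N := by
    filter_upwards [hmlow, htt_pos, eventually_ge_atTop 1] with N h1 h2 h3
    have hn : (1 : ℝ) ≤ N := by exact_mod_cast h3
    have hb := REM.one_le_blockTime h3
    have : 0 < m N := lt_of_lt_of_le (by positivity) h1
    simp only [hx]
    positivity
  have herr := fun t (ht : (0 : ℝ) < t) => REM.tendsto_relError hc0 hc2 htt_pos htt ht
  have hhalf : ∀ᶠ N : ℕ in atTop, REM.relError N (1 * tt N / REM.blockTime N) ≤ 1 / 2 :=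
    (herr 1 one_pos).eventually_le_const (by norm_num)
  constructor
  · intro t ht ε hε
    have hlim : Tendsto (fun N : ℕ => ENNReal.ofReal (2 * (REM.relError N (1 * tt N / REM.blockTime N)
        + REM.relError N (t * tt N / REM.blockTime N)) / ε)) atTop (𝓝 0) := by
      have h := ((((herr 1 one_pos).add (herr t ht)).const_mul 2).div_const ε)
      simp only [add_zero, mul_zero, zero_div] at h
      simpa using ENNReal.tendsto_ofReal h
    refine tendsto_of_tendsto_of_tendsto_of_le_of_le' tendsto_const_nhds hlim
      (Eventually.of_forall fun N => zero_le) ?_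
    filter_upwards [hlln t ht, hmean, hxm, hhalf, htt_pos] with N h1 h2 h3 h4 h5
    refine REM.measure_ge_le_of_integral_le
      (REM.integrable_numDiscovered (hX N) (mul_pos ht h5)) (mul_pos ht h3) h4 hε ?_ h1
    rw [← mul_sub, abs_mul, abs_of_pos ht]
    calc t * |REM.meanDiscovered (P N) (X N) (tt N) - x N * m N|
        ≤ t * (REM.relError N (1 * tt N / REM.blockTime N) * (x N * m N)) := by gcongr
      _ = _ := by ring
  · have hdiff : (fun N : ℕ => Real.log (REM.meanDiscovered (P N) (X N) (tt N))
        - Real.log (tt N)) =o[atTop] fun N : ℕ => cbar * (N : ℝ) := by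
      -- The window mean lies between N^12/2 and 10000 N^58 and the block length between 1 and
      -- 4N^13, so the mean at time tt N and tt N itself differ by a polynomial factor; its
      -- logarithm is o(N).
      have hbound : ∀ᶠ N : ℕ in atTop, ‖Real.log (REM.meanDiscovered (P N) (X N) (tt N))
          - Real.log (tt N)‖ ≤ Real.log 20000 + 58 * Real.log N := by
        filter_upwards [hmlow, hmean, hxm, hhalf, htt_pos, ha, eventually_ge_atTop 1]
          with N h1 h2 h3 h4 h5 h6 h7
        have hn : (1 : ℝ) ≤ N := by exact_mod_cast h7
        have hb := REM.one_le_blockTime h7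
        have hb' := REM.blockTime_le h7
        have hmup := REM.meanDiscovered_active_le (hX N) h7
          (REM.exp_mul_sq_le h7 habar h6.1 h6.2)
        set d := REM.meanDiscovered (P N) (X N) (tt N) with hd
        have hlow : x N * m N / 2 ≤ d := by nlinarith [neg_abs_le (d - x N * m N)]
        have hup : d ≤ 2 * (x N * m N) := by nlinarith [le_abs_self (d - x N * m N)]
        have hd0 : 0 < d := by linarith
        have hup' : d ≤ 20000 * (N : ℝ) ^ 58 * tt N := by
          calc d ≤ 2 * (x N * m N) := hup
            _ ≤ 2 * (tt N * (10000 * (N : ℝ) ^ 58)) := by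
                have : x N ≤ tt N := div_le_self h5.le hb
                have : 0 ≤ m N := le_trans (by positivity) h1
                gcongr
            _ = _ := by ring
        have hlow' : tt N ≤ 20000 * (N : ℝ) ^ 58 * d := by
          have e : tt N = x N * REM.blockTime N := by simp only [hx]; field_simp
          have hx0 : 0 ≤ x N := by simp only [hx]; positivity
          calc tt N ≤ x N * (4 * (N : ℝ) ^ 13) := by rw [e]; gcongr
            _ = 16 * (N : ℝ) * (x N * ((N : ℝ) ^ 12 / 2) / 2) := by ring
            _ ≤ 16 * (N : ℝ) * (x N * m N / 2) := by gcongr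
            _ ≤ 16 * (N : ℝ) * d := by gcongr
            _ ≤ 20000 * (N : ℝ) ^ 58 * d := by
                have : (N : ℝ) ≤ (N : ℝ) ^ 58 := le_self_pow₀ hn (by norm_num)
                gcongr
                norm_num
        have hC : Real.log (20000 * (N : ℝ) ^ 58) = Real.log 20000 + 58 * Real.log N := by
          rw [Real.log_mul (by norm_num) (by positivity), Real.log_pow]
          norm_num
        have l1 := Real.log_le_log hd0 hup'
        have l2 := Real.log_le_log h5 hlow'
        rw [Real.log_mul (by positivity) (by positivity), hC] at l1 l2
        rw [Real.norm_eq_abs, abs_le]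
        constructor <;> linarith
      have hlog : (fun N : ℕ => Real.log 20000 + 58 * Real.log (N : ℝ))
          =o[atTop] fun N : ℕ => cbar * (N : ℝ) := by
        have h1 : (fun N : ℕ => Real.log (N : ℝ)) =o[atTop] fun N : ℕ => (N : ℝ) :=
          Real.isLittleO_log_id_atTop.comp_tendsto tendsto_natCast_atTop_atTop
        have h2 : (fun _ : ℕ => Real.log 20000) =o[atTop] fun N : ℕ => (N : ℝ) :=
          (isLittleO_const_id_atTop (Real.log 20000)).comp_tendsto tendsto_natCast_atTop_atTop
        exact (h2.add (h1.const_mul_left 58)).const_mul_right hc0.ne'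
      exact (IsBigO.of_bound' (hbound.mono fun N h => h.trans (le_abs_self _))).trans_isLittleO hlog
    have := hdiff.add htt.isLittleO
    refine this.congr_left fun N => ?_
    simp only [Pi.sub_apply]
    ring
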